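/- **Setting.** A stochastic shortest path (SSP) instance has a finite nonempty state set $\mathcal S$ ($S=|\mathcal S|$), a finite nonempty action set $\mathcal A$ ($A=|\mathcal A|$), a goal $g\notin\mathcal S$ that is absorbing and free of cost, a known cost function $c:\mathcal S\times\mathcal A\to[0,1]$ with $c_{\min}=\min_{s,a}c(s,a)$, and unknown transition laws $P_{s,a}$ on $\mathcal S_+=\mathcal S\cup\{g\}$. For a (possibly randomized and time-dependent) Markov policy $\pi$, $V^\pi(s)\in[0,\infty]$ is the expected total cost and $T^\pi(s)\in[0,\infty]$ the expected hitting time of $g$, from $s$. Let $D=\max_s\inf_\pi T^\pi(s)$; $V^\star(s)=\inf\{V^\pi(s):\max_{s'}T^\pi(s')<\infty\}$ and $B_\star=\max_sV^\star(s)$; $V^{\star,T}(s)=\inf\{V^\pi(s):\max_{s'}T^\pi(s')\le T\}$ and $B_{\star,T}=\max_sV^{\star,T}(s)$, where these infima are over stationary randomized policies and $\inf\emptyset=\infty$. Put $T_\ddagger=\max\{B_\star,1\}/c_{\min}$ ($=\infty$ if $c_{\min}=0$) and $\bar B=\max\{B_{\star,T},1\}$. A policy $\pi$ is $(\epsilon,T)$-optimal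 if $V^\pi(s)\le V^{\star,T}(s)+\epsilon$ for all $s\in\mathcal S$. A generative model returns, on each call at $(s,a)$, an independent sample of $P_{s,a}$. **LCBVI$(H,N,B,c_f,\delta)$.** Given transition counts $N(s,a,y)$, with $N(s,a)=\sum_yN(s,a,y)$, $N^+(s,a)=\max\{1,N(s,a)\}$, $\bar P_{s,a}(y)=N(s,a,y)/N^+(s,a)$, $n=\sum_{s,a}N(s,a)$, $\iota=\ln\frac{2SAHn}{\delta}$ and $b(s,a,V)=\max\{7\sqrt{\mathrm{Var}_{\bar P_{s,a}}(V)\,\iota/N^+(s,a)},\;49B\iota/N^+(s,a)\}$, put $\hat V_{H+1}=c_f$ and, for $h=H,\dots,1$, $\hat Q_h(s,a)=(c(s,a)+\bar P_{s,a}\hat V_{h+1}-b(s,a,\hat V_{h+1}))_+$, $\hat V_h(s)=\min_a\hat Q_h(s,a)$, $\hat V_h(g)=0$, $\hat\pi(s,h)\in\operatorname{argmin}_a\hat Q_h(s,a)$. Return $(\hat\pi,\hat V)$. **Search Horizon$(T,\epsilon,\delta)$.** For $i\ge1$ let $B_i=2^i$, $H_i=\lceil4\min\{B_i/c_{\min},T\}\ln(48B_i/\epsilon)\rceil$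 (with $B_i/0=\infty$), $c_{f,i}=0.6B_i\mathbb 1\{s\ne g\}$, $\delta_i=\delta/(40i^2)$, $N_i=\hat N(B_i,H_i,0.1B_i,\delta_i)$ and $N^\star_i=N^\star(B_i,H_i,\epsilon/2,\delta_i)$, where, with $\ell=\ln\frac{2SAB'H'}{\epsilon'\delta'}$ and a constant $\kappa>0$, $$\hat N(B',H',\epsilon',\delta')=\Big\lceil\kappa\Big(\tfrac{B'^2SH'}{\epsilon'^2}+\tfrac{SB'H'}{\epsilon'}\Big)\ell\Big\rceil,\qquad N^\star(B',H',\epsilon',\delta')=\Big\lceil\kappa\Big(\tfrac{B'^2H'}{\epsilon'^2}+\tfrac{SB'H'}{\epsilon'}+SH'^2\Big)\ell\Big\rceil.$$ Start with $i=1$. In iteration $i$, reset the counts, draw $N_i$ fresh samples at each $(s,a)$ and run LCBVI$(H_i,N,B_i,c_{f,i},\delta_i)$, obtaining $V^i$. If $\|V^i_1\|_\infty\le0.1B_i$ and $\max_{1\le h\le H_i+1}\|V^i_h\|_\infty\le0.7B_i$, then reset the counts, draw $N^\star_i$ fresh samples at each $(s,a)$, run LCBVI with the same parameters, and output its policy $\hat\pi$,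 repeated with period $H_i$. Otherwise increase $i$ by one; if now $B_i>40T$, output $\varnothing$ (the claim that $T<D$); else go on with the next iteration. **Theorem.** There are absolute constants $\kappa,C>0$ and $k\in\mathbb N$ such that for every SSP instance, all real $T\ge1$ and all $\epsilon,\delta\in(0,1)$, with $L=C\ln^k\frac{2SAT}{\epsilon\delta}$, with probability at least $1-\delta$ one of the following holds for Search Horizon$(T,\epsilon,\delta)$: 1. it outputs $\varnothing$, indeed $T<D$, and it uses at most $L\,S^2AT$ samples in total; or 2. it outputs an $(\epsilon,T)$-optimal policy and uses in total at most $$L\Big(\min\{T_\ddagger,T\}\frac{\bar B^2SA}{\epsilon^2}+\min\{T_\ddagger,T\}\frac{\bar BS^2A}{\epsilon}+\min\{T_\ddagger,T\}^2S^2A\Big)$$ samples. -/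

import Mathlib

open MeasureTheory ProbabilityTheory
open scoped ENNReal

/-- A stochastic shortest path instance with state space `S` (the goal is not in `S`) and action
space `A`. In `Option S`, the value `none` is the goal state, which is absorbing and free of cost. -/
structure SSP (S A : Type*) where
  /-- the transition function -/
  P : S → A → PMF (Option S)
  /-- the (known) cost function -/
  c : S → A → ℝ
  c_nonneg : ∀ s a, 0 ≤ c s a
  c_le_one : ∀ s a, c s a ≤ 1

namespace SSP

/-! ### Policies, expected costs, hitting times -/

section Values

variable {S A : Type*}

/-- One step of the Markov chain that a (randomized, time-dependent) Markov policy `π` induces;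
`π t s` is the law of the action taken in state `s` at time `t = 0, 1, 2, …`. -/
noncomputable def step (M : SSP S A) (π : ℕ → S → PMF A) (t : ℕ) : Option S → PMF (Option S)
  | none => PMF.pure none
  | some s => (π t s).bind fun a => M.P s a

/-- The law of the state at time `t` when following `π` from the initial state `s`. -/
noncomputable def stateLaw (M : SSP S A) (π : ℕ → S → PMF A) (s : S) : ℕ → PMF (Option S)
  | 0 => PMF.pure (some s)
  | t + 1 => (stateLaw M π s t).bind (M.step π t)

variable [Fintype S] [Fintype A]

/-- `V^π(s)`: the expected total cost of `π` from `s`, that is the sum over all times `t` of the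
expectation of the cost paid at time `t` (no cost is paid in the goal state). -/
noncomputable def value (M : SSP S A) (π : ℕ → S → PMF A) (s : S) : ℝ≥0∞ :=
  ∑' t : ℕ, ∑ s' : S, ∑ a : A,
    M.stateLaw π s t (some s') * π t s' a * ENNReal.ofReal (M.c s' a)

/-- `T^π(s)`: the expected hitting time of the goal when following `π` from `s`, that is the sum
over all times `t` of the probability that the goal has not been reached at time `t`. -/
noncomputable def hitTime (M : SSP S A) (π : ℕ → S → PMF A) (s : S) : ℝ≥0∞ :=
  ∑' t : ℕ, ∑ s' : S, M.stateLaw π s t (some s')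

/-- A stationary randomized policy, seen as a time-dependent one. -/
def stationary (π : S → PMF A) : ℕ → S → PMF A := fun _ => π

/-- A stationary policy is proper if its expected hitting time is finite from every state. -/
def IsProper (M : SSP S A) (π : S → PMF A) : Prop :=
  ∀ s, M.hitTime (stationary π) s < ∞

/-- `V⋆(s)`: the optimal value over the proper stationary policies. -/
noncomputable def optValue (M : SSP S A) (s : S) : ℝ≥0∞ :=
  ⨅ (π : S → PMF A) (_ : M.IsProper π), M.value (stationary π) s

/-- `B⋆`, the largest optimal value. -/
noncomputable def Bstar (M : SSP S A) : ℝ≥0∞ := ⨆ s, M.optValue s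

/-- The diameter `D`: the largest over the states of the minimal expected hitting time. -/
noncomputable def diam (M : SSP S A) : ℝ≥0∞ :=
  ⨆ s, ⨅ π : S → PMF A, M.hitTime (stationary π) s

/-- `V^{⋆,T}(s)`: the optimal value over the stationary policies whose expected hitting time is at
most `T` from every state (`∞` if there is no such policy). -/
noncomputable def optValueT (M : SSP S A) (T : ℝ) (s : S) : ℝ≥0∞ :=
  ⨅ (π : S → PMF A) (_ : ∀ s', M.hitTime (stationary π) s' ≤ ENNReal.ofReal T),
    M.value (stationary π) s

/-- `B_{⋆,T}`, the largest restricted optimal value. -/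
noncomputable def BstarT (M : SSP S A) (T : ℝ) : ℝ≥0∞ := ⨆ s, M.optValueT T s

/-- `(ε, T)`-optimality of a policy. -/
def IsOptimalT (M : SSP S A) (ε T : ℝ) (π : ℕ → S → PMF A) : Prop :=
  ∀ s, M.value π s ≤ M.optValueT T s + ENNReal.ofReal ε

/-- The minimum cost `c_min` over all state-action pairs. -/
noncomputable def cmin (M : SSP S A) : ℝ := ⨅ p : S × A, M.c p.1 p.2

/-- A deterministic policy, seen as a randomized one. -/
noncomputable def ofDet (π : ℕ → S → A) : ℕ → S → PMF A := fun t s => PMF.pure (π t s)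

end Values

/-! ### The finite-horizon algorithm LCBVI

Throughout, `N s a y` is the number of transitions from `(s, a)` to `y` that were observed. -/

section LCBVI

variable {S A : Type*} [Fintype S] [Fintype A]

/-- `N(s, a)` -/
def visits (N : S → A → Option S → ℕ) (s : S) (a : A) : ℕ := ∑ y, N s a y

/-- `N⁺(s, a) = max {1, N(s, a)}` -/
def visitsPlus (N : S → A → Option S → ℕ) (s : S) (a : A) : ℕ := max 1 (visits N s a)

/-- The empirical transition function. -/
noncomputable def empP (N : S → A → Option S → ℕ) (s : S) (a : A) (y : Option S) : ℝ :=
  (N s a y : ℝ) / (visitsPlus N s a : ℝ)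

/-- The expectation of `V` under the empirical transition function at `(s, a)`. -/
noncomputable def empMean (N : S → A → Option S → ℕ) (s : S) (a : A) (V : Option S → ℝ) : ℝ :=
  ∑ y, empP N s a y * V y

/-- The variance of `V` under the empirical transition function at `(s, a)`. -/
noncomputable def empVar (N : S → A → Option S → ℕ) (s : S) (a : A) (V : Option S → ℝ) : ℝ :=
  ∑ y, empP N s a y * (V y - empMean N s a V) ^ 2

/-- `ι = ln (2 S A H n / δ)`, where `n` is the total number of samples. -/
noncomputable def iota (N : S → A → Option S → ℕ) (H : ℕ) (δ : ℝ) : ℝ :=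
  Real.log (2 * Fintype.card S * Fintype.card A * H * ((∑ s, ∑ a, visits N s a : ℕ) : ℝ) / δ)

/-- The Bernstein-style bonus. -/
noncomputable def bonus (N : S → A → Option S → ℕ) (H : ℕ) (B δ : ℝ) (s : S) (a : A)
    (V : Option S → ℝ) : ℝ :=
  max (7 * Real.sqrt (empVar N s a V * iota N H δ / (visitsPlus N s a : ℝ)))
    (49 * B * iota N H δ / (visitsPlus N s a : ℝ))

/-- The action-value estimate obtained from the value estimate `V` of the next stage. -/
noncomputable def qBackup (M : SSP S A) (H : ℕ) (N : S → A → Option S → ℕ) (B δ : ℝ)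
    (V : Option S → ℝ) (s : S) (a : A) : ℝ :=
  max (M.c s a + empMean N s a V - bonus N H B δ s a V) 0

/-- The value estimate of LCBVI when `m` stages remain, that is at stage `H + 1 - m`. -/
noncomputable def lcbviToGo (M : SSP S A) (H : ℕ) (N : S → A → Option S → ℕ) (B : ℝ)
    (cf : Option S → ℝ) (δ : ℝ) : ℕ → Option S → ℝ
  | 0 => cf
  | m + 1 => fun y =>
      match y with
      | none => 0
      | some s => ⨅ a, M.qBackup H N B δ (lcbviToGo M H N B cf δ m) s a

/-- The value estimate of LCBVI at stage `h ∈ {1, …, H + 1}`. -/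
noncomputable def lcbviV (M : SSP S A) (H : ℕ) (N : S → A → Option S → ℕ) (B : ℝ)
    (cf : Option S → ℝ) (δ : ℝ) (h : ℕ) : Option S → ℝ :=
  M.lcbviToGo H N B cf δ (H + 1 - h)

/-- A minimizer of a function on a finite nonempty type. -/
noncomputable def argmin [Nonempty A] (f : A → ℝ) : A :=
  Classical.choose (Finite.exists_min f)

/-- The deterministic policy returned by LCBVI, at stage `h ∈ {1, …, H}`. -/
noncomputable def lcbviPi [Nonempty A] (M : SSP S A) (H : ℕ) (N : S → A → Option S → ℕ) (B : ℝ)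
    (cf : Option S → ℝ) (δ : ℝ) (h : ℕ) (s : S) : A :=
  argmin fun a => M.qBackup H N B δ (M.lcbviV H N B cf δ (h + 1)) s a

/-- The infinite-horizon policy that repeats a policy with stages `1, …, H` periodically
(time `t = 0, 1, 2, …` corresponds to stage `t + 1`). -/
def extend (H : ℕ) (π : ℕ → S → A) : ℕ → S → A := fun t => π (t % H + 1)

end LCBVI

/-! ### The algorithm Search Horizon -/

section SearchHorizon

variable {S A : Type*} [Fintype S] [Fintype A]

/-- `B_i = 2^i` -/
noncomputable def Bi (i : ℕ) : ℝ := 2 ^ i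

/-- `H_i = 4 min {B_i / c_min, T} ln (48 B_i / ε)`, rounded up, with `B_i / 0 = ∞`. -/
noncomputable def Hi (M : SSP S A) (T ε : ℝ) (i : ℕ) : ℕ :=
  ⌈4 * (if M.cmin = 0 then T else min (Bi i / M.cmin) T) * Real.log (48 * Bi i / ε)⌉₊

/-- The terminal cost `0.6 B_i 𝟙{s ≠ g}`. -/
noncomputable def cfi (i : ℕ) : Option S → ℝ
  | none => 0
  | some _ => 0.6 * Bi i

/-- `δ_i = δ / (40 i²)` -/
noncomputable def deltai (δ : ℝ) (i : ℕ) : ℝ := δ / (40 * (i : ℝ) ^ 2)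

/-- The logarithmic factor in the batch sizes; `S`, `A` are the numbers of states and actions. -/
noncomputable def logFactor (S A : ℕ) (B : ℝ) (H : ℕ) (ε δ : ℝ) : ℝ :=
  Real.log (2 * S * A * B * H / (ε * δ))

/-- The batch size `N⋆` for a fine estimate. -/
noncomputable def fineN (κ : ℝ) (S A : ℕ) (B : ℝ) (H : ℕ) (ε δ : ℝ) : ℕ :=
  ⌈κ * (B ^ 2 * H / ε ^ 2 + S * B * H / ε + S * (H : ℝ) ^ 2) * logFactor S A B H ε δ⌉₊

/-- The batch size `N̂` for a coarse estimate. -/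
noncomputable def coarseN (κ : ℝ) (S A : ℕ) (B : ℝ) (H : ℕ) (ε δ : ℝ) : ℕ :=
  ⌈κ * (B ^ 2 * S * H / ε ^ 2 + S * B * H / ε) * logFactor S A B H ε δ⌉₊

/-- `N_i`, the number of samples per state-action pair in iteration `i` of the search. -/
noncomputable def searchN (M : SSP S A) (κ T ε δ : ℝ) (i : ℕ) : ℕ :=
  coarseN κ (Fintype.card S) (Fintype.card A) (Bi i) (M.Hi T ε i) (0.1 * Bi i) (deltai δ i)

/-- `N⋆_i`, the number of samples per state-action pair for the output policy. -/
noncomputable def finalN (M : SSP S A) (κ T ε δ : ℝ) (i : ℕ) : ℕ :=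
  fineN κ (Fintype.card S) (Fintype.card A) (Bi i) (M.Hi T ε i) (ε / 2) (deltai δ i)

open Classical in
/-- The counter after a reset and `n` fresh calls of the generative model at each state-action
pair, the first `k` answers at each pair having been used before. Here `x t s a` is the answer to
call number `t = 0, 1, 2, …` at `(s, a)`. -/
noncomputable def counter (x : ℕ → S → A → Option S) (k n : ℕ) : S → A → Option S → ℕ :=
  fun s a y => ((Finset.range n).filter fun j => x (k + j) s a = y).card

/-- The stopping test of iteration `i`, applied to the value estimate `V` of LCBVI. -/
def StopTest (H i : ℕ) (V : ℕ → Option S → ℝ) : Prop :=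
  (∀ y, |V 1 y| ≤ 0.1 * Bi i) ∧ ∀ h ∈ Finset.Icc 1 (H + 1), ∀ y, |V h y| ≤ 0.7 * Bi i

/-- What a run of the algorithm returns: an infinite-horizon deterministic policy, or `none` for
the answer `∅` (claiming `T < D`), and the total number of calls of the generative model. -/
structure Outcome (S A : Type*) where
  output : Option (ℕ → S → A)
  samples : ℕ

open Classical in
/-- The loop of Search Horizon at iteration `i`, when `k` samples of each state-action pair have
been used before. -/
noncomputable def searchLoop [Nonempty A] (M : SSP S A) (κ T ε δ : ℝ)
    (x : ℕ → S → A → Option S) (i k : ℕ) : Outcome S A :=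
  if StopTest (M.Hi T ε i) i
      (M.lcbviV (M.Hi T ε i) (counter x k (M.searchN κ T ε δ i)) (Bi i) (cfi i) (deltai δ i)) then
    { output := some (extend (M.Hi T ε i)
        (M.lcbviPi (M.Hi T ε i)
          (counter x (k + M.searchN κ T ε δ i) (M.finalN κ T ε δ i))
          (Bi i) (cfi i) (deltai δ i)))
      samples := Fintype.card S * Fintype.card A *
        (k + M.searchN κ T ε δ i + M.finalN κ T ε δ i) }
  else if 40 * T < Bi (i + 1) then
    { output := none
      samples := Fintype.card S * Fintype.card A * (k + M.searchN κ T ε δ i) }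
  else searchLoop M κ T ε δ x (i + 1) (k + M.searchN κ T ε δ i)
termination_by ⌊40 * T⌋₊ + 1 - 2 ^ i
decreasing_by
  rename_i h
  have h1 : 2 ^ (i + 1) ≤ ⌊40 * T⌋₊ := by
    apply Nat.le_floor
    have := not_lt.mp h
    simpa [Bi] using this
  have h2 : 2 ^ i < 2 ^ (i + 1) := Nat.pow_lt_pow_right (by norm_num) (Nat.lt_succ_self i)
  omega

/-- Search Horizon with input `T`, `ε`, `δ`, run on the answers `x` of the generative model; `κ` is
the absolute constant in the batch sizes. -/
noncomputable def searchHorizon [Nonempty A] (M : SSP S A) (κ T ε δ : ℝ)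
    (x : ℕ → S → A → Option S) : Outcome S A :=
  M.searchLoop κ T ε δ x 1 0

end SearchHorizon

/-! ### The generative model -/

/-- `X t s a` is the answer of a generative model of `M` to call number `t` at `(s, a)`: all answers
are independent, and those at `(s, a)` have law `P_{s,a}`. -/
def IsGenerativeModel {S A Ω : Type*} [MeasurableSpace Ω] (M : SSP S A) (μ : Measure Ω)
    (X : ℕ → S → A → Ω → Option S) : Prop :=
  (∀ t s a, Measurable[_, ⊤] (X t s a)) ∧
  (∀ t s a y, μ (X t s a ⁻¹' {y}) = M.P s a y) ∧
  iIndepFun (m := fun _ => ⊤) (fun p : ℕ × S × A => X p.1 p.2.1 p.2.2) μ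

/-! ### The sample complexity bound -/

section Bound

variable {S A : Type*} [Fintype S] [Fintype A]

/-- `min {T‡, T}` with `T‡ = max {B⋆, 1} / c_min` (`= ∞` if `c_min = 0`). -/
noncomputable def effHorizon (M : SSP S A) (T : ℝ) : ℝ≥0∞ :=
  min (max M.Bstar 1 / ENNReal.ofReal M.cmin) (ENNReal.ofReal T)

/-- The bound for the output of a policy, up to constants and logarithms: the leading term and the
two lower order terms. -/
noncomputable def policyBound (M : SSP S A) (T ε : ℝ) : ℝ≥0∞ :=
  M.effHorizon T * max (M.BstarT T) 1 ^ 2 * Fintype.card S * Fintype.card A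
      / ENNReal.ofReal ε ^ 2
    + M.effHorizon T * max (M.BstarT T) 1 * Fintype.card S ^ 2 * Fintype.card A
      / ENNReal.ofReal ε
    + M.effHorizon T ^ 2 * Fintype.card S ^ 2 * Fintype.card A

/-- Constants and logarithmic factors hidden by the notation `Õ`. -/
noncomputable def polylog (C : ℝ) (k : ℕ) (S A : ℕ) (T ε δ : ℝ) : ℝ :=
  C * Real.log (2 * S * A * T / (ε * δ)) ^ k

end Bound

end SSP

/-! The argument is deterministic on one event of high probability. Fix an iteration and write `U_m`
for the optimal cost with `m` stages left and terminal cost `f` (`optToGo`), `V_m` for the estimate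
of LCBVI (`lcbviToGo`) and `J_m` for the cost of its policy (`detToGo`).

Concentration. Batch sizes do not depend on the answers, so each batch is a fixed segment of the
samples, and `U_m` is a fixed function. Bernstein's inequality and a union bound control the entries
of the empirical laws, the means of `U_m` and the means of its squared deviations (`BatchGood`,
`measure_not_runGood_le`).

LCBVI. If `U ≤ B`, then `V ≤ U` (`lcbviToGo_le_optToGo`), because the pessimistic backup is monotone
(`lcb_mono`) and the bonus covers the deviation for the fixed function `U`
(`abs_mean_sub_le_bonus`). Upper bounds on `J` come from a potential argument: the error of a backup
is charged to a small multiple of a variance, and the variances telescope along the trajectory up to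
a multiple of the cost (`var_le_telescope`). There are two versions. The coarse one
(`detToGo_le_of_lcbviToGo_le`) needs only entrywise estimates and bounds on `V` itself, so that it
is available before any bound on `U` is known. The fine one (`detToGo_le_of_close`) also uses the
variance of `U - V`: a uniform gap `w ≥ ε` implies `J ≤ V + w/2`. Since `U ≤ J`, the gap cannot
exceed `ε`, and `J ≤ U + ε/2` follows (`detToGo_le_add`).

Horizon. A chain whose expected cost stays below `R` times the least cost of a step misses the goal
within `4RL` steps with probability at most `exp (-L)` (`notHit_le_exp`). With the horizon of the
algorithm the terminal cost `0.6 B_i` then contributes only `ε/80`. Conversely, a policy with `J_H ≤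
f` can be repeated periodically at total cost at most `J_H` (`value_periodic_le`).

Search. A passed test forces `U_H ≤ 0.2 B_i`, which activates the fine analysis and makes the output
`(ε, T)`-optimal (`isOptimalT_of_stops`). In the other direction, optimism shows that the test is
passed as soon as `B_i/20` exceeds `B_{⋆,T}`, or exceeds `B⋆` with `B_i/c_min ≤ T`, or exceeds `T`
with `D ≤ T` (`stops_of_BstarT_le`, `stops_of_Bstar_le`, `stops_of_diam_le`). The first two bound
the last `B_i` and the last horizon, hence the number of samples; the third justifies the answer
`∅`. -/

set_option linter.unusedSectionVars false

namespace SSP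

/-! ### Means and variances under finite weights -/

section Weights

variable {Y : Type*} [Fintype Y]

/-- The mean of `V` under the weights `p`. -/
noncomputable def wmean (p V : Y → ℝ) : ℝ := ∑ y, p y * V y

/-- The variance of `V` under the weights `p`. -/
noncomputable def wvar (p V : Y → ℝ) : ℝ := ∑ y, p y * (V y - wmean p V) ^ 2

/-- The Bernstein-style bonus, with `x` the ratio of the logarithmic factor and the sample size. -/
noncomputable def wbonus (p : Y → ℝ) (B x : ℝ) (V : Y → ℝ) : ℝ :=
  max (7 * √(wvar p V * x)) (49 * B * x)

/-- Probability vectors. -/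
structure IsWeight (p : Y → ℝ) : Prop where
  nonneg : ∀ y, 0 ≤ p y
  sum_eq : ∑ y, p y = 1

theorem IsWeight.mean_const {p : Y → ℝ} (hp : IsWeight p) (c : ℝ) :
    wmean p (fun _ => c) = c := by
  simp [wmean, ← Finset.sum_mul, hp.sum_eq]

theorem IsWeight.mean_mono {p : Y → ℝ} (hp : IsWeight p) {V W : Y → ℝ} (h : ∀ y, V y ≤ W y) :
    wmean p V ≤ wmean p W :=
  Finset.sum_le_sum fun y _ => mul_le_mul_of_nonneg_left (h y) (hp.nonneg y)

theorem IsWeight.mean_le {p : Y → ℝ} (hp : IsWeight p) {V : Y → ℝ} {B : ℝ} (h : ∀ y, V y ≤ B) :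
    wmean p V ≤ B := (hp.mean_mono h).trans (hp.mean_const B).le

theorem IsWeight.le_mean {p : Y → ℝ} (hp : IsWeight p) {V : Y → ℝ} {B : ℝ} (h : ∀ y, B ≤ V y) :
    B ≤ wmean p V := (hp.mean_const B).ge.trans (hp.mean_mono h)

theorem wmean_add (p V W : Y → ℝ) : wmean p (fun y => V y + W y) = wmean p V + wmean p W := by
  simp [wmean, mul_add, Finset.sum_add_distrib]

theorem wmean_sub (p V W : Y → ℝ) : wmean p (fun y => V y - W y) = wmean p V - wmean p W := by
  simp [wmean, mul_sub, Finset.sum_sub_distrib]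

theorem wmean_const_mul (p V : Y → ℝ) (c : ℝ) : wmean p (fun y => c * V y) = c * wmean p V := by
  simp only [wmean, Finset.mul_sum]
  exact Finset.sum_congr rfl fun y _ => by ring

theorem IsWeight.mean_sq_sub {p : Y → ℝ} (hp : IsWeight p) (V : Y → ℝ) (c : ℝ) :
    wmean p (fun y => (V y - c) ^ 2) = wmean p (fun y => V y ^ 2) - 2 * c * wmean p V + c ^ 2 := by
  have : (fun y => (V y - c) ^ 2) = fun y => (V y ^ 2 - (2 * c) * V y) + c ^ 2 := by
    funext y; ring
  rw [this, wmean_add, wmean_sub, wmean_const_mul, hp.mean_const]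

theorem IsWeight.var_eq {p : Y → ℝ} (hp : IsWeight p) (V : Y → ℝ) :
    wvar p V = wmean p (fun y => V y ^ 2) - wmean p V ^ 2 := by
  have h := hp.mean_sq_sub V (wmean p V)
  rw [show wvar p V = wmean p (fun y => (V y - wmean p V) ^ 2) from rfl, h]; ring

theorem IsWeight.mean_sq_sub_eq_var {p : Y → ℝ} (hp : IsWeight p) (V : Y → ℝ) (c : ℝ) :
    wmean p (fun y => (V y - c) ^ 2) = wvar p V + (wmean p V - c) ^ 2 := by
  rw [hp.mean_sq_sub, hp.var_eq]; ring

theorem IsWeight.var_nonneg {p : Y → ℝ} (hp : IsWeight p) (V : Y → ℝ) : 0 ≤ wvar p V :=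
  Finset.sum_nonneg fun y _ => mul_nonneg (hp.nonneg y) (sq_nonneg _)

theorem IsWeight.var_sub_le {p : Y → ℝ} (hp : IsWeight p) (V W : Y → ℝ) :
    wvar p (fun y => V y - W y) ≤ 2 * wvar p V + 2 * wvar p W := by
  simp only [wvar, wmean_sub, Finset.mul_sum, ← Finset.sum_add_distrib]
  refine Finset.sum_le_sum fun y _ => ?_
  nlinarith [mul_nonneg (hp.nonneg y)
    (sq_nonneg ((V y - wmean p V) + (W y - wmean p W)))]

theorem wbonus_nonneg (p : Y → ℝ) (B x : ℝ) (V : Y → ℝ) : 0 ≤ wbonus p B x V :=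
  le_max_of_le_left (by positivity)

/-- Pessimistic means are monotone on functions with values in `[0, B]`. -/
theorem IsWeight.lcb_mono {p : Y → ℝ} (hp : IsWeight p) {V W : Y → ℝ} {B x : ℝ} (hx : 0 ≤ x)
    (hV : ∀ y, 0 ≤ V y) (hVW : ∀ y, V y ≤ W y) (hW : ∀ y, W y ≤ B) (hB : 0 ≤ B) :
    wmean p V - wbonus p B x V ≤ wmean p W - wbonus p B x W := by
  -- If the claim fails, the bonus grows by more than the mean, so the variance branch is active for
  -- `W`. Then the squares of the bonuses differ by at most `49x(Var W - Var V) ≤ 98Bx(mean W - mean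
  -- V)`, whereas the sum of the bonuses exceeds `98Bx`. This is why the constants are `7` and `49 =
  -- 7²`.
  by_contra! hlt
  have hD := hp.mean_mono hVW
  have hb : wbonus p B x V < wbonus p B x W := by linarith
  have h1 : 49 * B * x ≤ wbonus p B x V := le_max_right _ _
  have h2 : 7 * √(wvar p V * x) ≤ wbonus p B x V := le_max_left _ _
  have h3 : wbonus p B x W = 7 * √(wvar p W * x) := by
    rcases max_choice (7 * √(wvar p W * x)) (49 * B * x) with h | h
    · exact h
    · rw [show wbonus p B x W = 49 * B * x from h] at hb; linarith
  have h4 : wbonus p B x W ^ 2 = 49 * (wvar p W * x) := by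
    rw [h3, mul_pow, Real.sq_sqrt (mul_nonneg (hp.var_nonneg W) hx)]; norm_num
  have h5 : 49 * (wvar p V * x) ≤ wbonus p B x V ^ 2 := by
    have := pow_le_pow_left₀ (by positivity) h2 2
    rw [mul_pow, Real.sq_sqrt (mul_nonneg (hp.var_nonneg V) hx)] at this
    linarith
  have h6 : wvar p W - wvar p V ≤ 2 * B * (wmean p W - wmean p V) := by
    have h7 : wmean p (fun y => W y ^ 2) - wmean p (fun y => V y ^ 2)
        ≤ 2 * B * (wmean p W - wmean p V) := by
      rw [← wmean_sub, ← wmean_sub, ← wmean_const_mul]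
      refine hp.mean_mono fun y => ?_
      nlinarith [hV y, hVW y, hW y]
    have h8 : wmean p V ^ 2 ≤ wmean p W ^ 2 :=
      pow_le_pow_left₀ (hp.le_mean hV) hD 2
    rw [hp.var_eq, hp.var_eq]; linarith
  have h9 : (wvar p W - wvar p V) * x ≤ 2 * B * (wmean p W - wmean p V) * x :=
    mul_le_mul_of_nonneg_right h6 hx
  have hBx : 0 ≤ B * x := mul_nonneg hB hx
  nlinarith [mul_pos (sub_pos.2 hb) (by linarith : 0 < wbonus p B x W + wbonus p B x V - 98 * (B * x))]

/-- A deviation bound in terms of the empirical variance. -/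
theorem abs_mean_sub_le_bonus {p q : Y → ℝ} (hp : IsWeight p) (hq : IsWeight q) {V : Y → ℝ}
    {B x : ℝ} (hx : 0 ≤ x) (hV : ∀ y, 0 ≤ V y) (hVB : ∀ y, V y ≤ B) (hB : 0 ≤ B)
    (h1 : |wmean q V - wmean p V| ≤ max (2 * √(wvar p V * x)) (2 * B * x))
    (h2 : |wmean q (fun y => (V y - wmean p V) ^ 2) - wmean p (fun y => (V y - wmean p V) ^ 2)|
      ≤ max (2 * √(B ^ 2 * wvar p V * x)) (2 * B ^ 2 * x)) :
    |wmean q V - wmean p V| ≤ wbonus q B x V := by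
  set v := wvar p V with hv
  have hv0 : 0 ≤ v := hp.var_nonneg V
  have hBx : 0 ≤ B * x := mul_nonneg hB hx
  -- A small variance gives a deviation of at most `20Bx`, which the second branch of the bonus
  -- covers.
  rcases le_or_gt v (100 * B ^ 2 * x) with hc | hc
  · have : √(v * x) ≤ 10 * (B * x) := by
      apply Real.sqrt_le_iff.2 ⟨by positivity, ?_⟩
      nlinarith [mul_le_mul_of_nonneg_right hc hx]
    refine h1.trans (max_le ?_ ?_) <;> refine le_max_of_le_right ?_ <;> nlinarith
  -- For `x > 1/49` the trivial bound `B` on the deviation is below `49Bx`.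
  rcases lt_or_ge (1 / 49) x with hx1 | hx1
  · refine le_max_of_le_right ?_
    have a1 := hp.mean_le hVB
    have a2 := hp.le_mean hV
    have a3 := hq.mean_le hVB
    have a4 := hq.le_mean hV
    have : |wmean q V - wmean p V| ≤ B := abs_le.2 ⟨by linarith, by linarith⟩
    nlinarith
  have hs : 2 * B * x ≤ 2 * √(v * x) := by
    have : B * x ≤ √(v * x) := by
      apply Real.le_sqrt_of_sq_le
      nlinarith [mul_le_mul_of_nonneg_right hc.le hx, mul_nonneg (mul_nonneg hB hB) (mul_nonneg hx hx)]
    linarith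
  rw [max_eq_left hs] at h1
  have hd : (wmean q V - wmean p V) ^ 2 ≤ 4 * (v * x) := by
    have := pow_le_pow_left₀ (abs_nonneg _) h1 2
    rw [sq_abs, mul_pow, Real.sq_sqrt (by positivity)] at this
    linarith
  have hB2 : √(B ^ 2 * v * x) ≤ v / 10 := by
    apply Real.sqrt_le_iff.2 ⟨by positivity, ?_⟩
    nlinarith
  have h2' := (abs_le.1 (h2.trans (max_le (by linarith : _ ≤ v / 5) (by nlinarith)))).1
  rw [hq.mean_sq_sub_eq_var, show wmean p (fun y => (V y - wmean p V) ^ 2) = v from rfl] at h2'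
  -- The second moment under `q` about the true mean is at least `4v/5`, and the squared error of
  -- the mean is at most `4vx ≤ 4v/49`; the empirical variance is the difference.
  have hvq : v ≤ 2 * wvar q V := by nlinarith
  refine le_max_of_le_left (h1.trans ?_)
  have : √(v * x) ≤ 2 * √(wvar q V * x) := by
    apply Real.sqrt_le_iff.2 ⟨by positivity, ?_⟩
    rw [mul_pow, Real.sq_sqrt (mul_nonneg (hq.var_nonneg V) hx)]
    nlinarith [mul_le_mul_of_nonneg_right hvq hx, mul_nonneg (hq.var_nonneg V) hx]
  linarith [Real.sqrt_nonneg (wvar q V * x)]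

/-- The inequality of arithmetic and geometric means. The free parameter `l` is the price per unit
of variance, to be paid by a telescoping sum; the rest is an additive error. -/
theorem mul_sqrt_le {c v x l : ℝ} (hv : 0 ≤ v) (hx : 0 ≤ x) (hl : 0 < l) :
    c * √(v * x) ≤ l * v + c ^ 2 / 4 * x / l := by
  have h1 : √(v * x) = √v * √x := Real.sqrt_mul hv x
  have h2 := Real.sq_sqrt hv
  have h3 := Real.sq_sqrt hx
  have h4 : l * v + c ^ 2 / 4 * x / l - c * √(v * x) = (2 * l * √v - c * √x) ^ 2 / (4 * l) := by
    rw [h1]; nth_rw 1 [← h2, ← h3]; field_simp; ring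
  have : 0 ≤ (2 * l * √v - c * √x) ^ 2 / (4 * l) := by positivity
  linarith

/-- The bounds on the deviation of the entries that hold with high probability. -/
def EntryClose (p q : Y → ℝ) (x : ℝ) : Prop :=
  ∀ y, |q y - p y| ≤ max (2 * √(p y * x)) (2 * x)

/-- Both weights have mass one, so `V` may be centred at its mean under `p`; Cauchy–Schwarz over the
entries then produces the standard deviation at the price of the cardinality under the root. The
event does not depend on `V`, so the bound also applies to functions computed from the data. -/
theorem EntryClose.abs_mean_sub_le {p q : Y → ℝ} {x : ℝ} (h : EntryClose p q x) (hp : IsWeight p)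
    (hq : IsWeight q) {V : Y → ℝ} {B : ℝ} (hx : 0 ≤ x)
    (hV : ∀ y, 0 ≤ V y) (hVB : ∀ y, V y ≤ B) :
    |wmean q V - wmean p V| ≤
      2 * √(Fintype.card Y * wvar p V * x) + 2 * Fintype.card Y * B * x := by
  set m := wmean p V with hm
  have hm0 : 0 ≤ m := hp.le_mean hV
  have hmB : m ≤ B := hp.mean_le hVB
  have e1 : wmean q V - m = ∑ y, (q y - p y) * (V y - m) := by
    have : ∑ y, (q y - p y) * (V y - m)
        = (wmean q V - wmean p V) - (∑ y, q y - ∑ y, p y) * m := by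
      simp only [wmean, sub_mul, ← Finset.sum_sub_distrib, Finset.sum_mul]
      exact Finset.sum_congr rfl fun y _ => by ring
    rw [this, hp.sum_eq, hq.sum_eq]; ring
  have e2 : ∀ y, |(q y - p y) * (V y - m)| ≤ 2 * (√(p y * x) * |V y - m|) + 2 * x * B := by
    intro y
    have a1 : |V y - m| ≤ B := abs_le.2 ⟨by linarith [hV y], by linarith [hVB y]⟩
    have a2 : |q y - p y| ≤ 2 * √(p y * x) + 2 * x :=
      (h y).trans (max_le (by linarith) (by linarith [Real.sqrt_nonneg (p y * x)]))
    rw [abs_mul]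
    calc |q y - p y| * |V y - m| ≤ (2 * √(p y * x) + 2 * x) * |V y - m| :=
          mul_le_mul_of_nonneg_right a2 (abs_nonneg _)
      _ = 2 * (√(p y * x) * |V y - m|) + 2 * x * |V y - m| := by ring
      _ ≤ _ := by gcongr
  have e3 : ∑ y, √(p y * x) * |V y - m| ≤ √(Fintype.card Y * wvar p V * x) := by
    apply Real.le_sqrt_of_sq_le
    refine sq_sum_le_card_mul_sum_sq.trans (le_of_eq ?_)
    rw [Finset.card_univ, mul_assoc, wvar, Finset.sum_mul]
    congr 1
    refine Finset.sum_congr rfl fun y _ => ?_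
    rw [mul_pow, Real.sq_sqrt (mul_nonneg (hp.nonneg y) hx), sq_abs]; ring
  rw [e1]
  calc |∑ y, (q y - p y) * (V y - m)| ≤ ∑ y, |(q y - p y) * (V y - m)| :=
        Finset.abs_sum_le_sum_abs _ _
    _ ≤ ∑ y, (2 * (√(p y * x) * |V y - m|) + 2 * x * B) := Finset.sum_le_sum fun y _ => e2 y
    _ = 2 * ∑ y, √(p y * x) * |V y - m| + 2 * Fintype.card Y * B * x := by
        rw [Finset.sum_add_distrib, ← Finset.mul_sum]; simp; ring
    _ ≤ _ := by linarith

/-- The entrywise bound implies `q y ≤ 2 * p y + 3 * x`, and centring at the mean under `p` instead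
of `q` only increases the second moment. -/
theorem EntryClose.var_le {p q : Y → ℝ} {x : ℝ} (h : EntryClose p q x) (hp : IsWeight p)
    (hq : IsWeight q) {V : Y → ℝ} {B : ℝ} (hx : 0 ≤ x)
    (hV : ∀ y, 0 ≤ V y) (hVB : ∀ y, V y ≤ B) :
    wvar q V ≤ 2 * wvar p V + 3 * Fintype.card Y * B ^ 2 * x := by
  set m := wmean p V with hm
  have hm0 : 0 ≤ m := hp.le_mean hV
  have hmB : m ≤ B := hp.mean_le hVB
  have e0 : wvar q V ≤ wmean q (fun y => (V y - m) ^ 2) := by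
    rw [hq.mean_sq_sub_eq_var]; linarith [sq_nonneg (wmean q V - m)]
  refine e0.trans ?_
  have e1 : ∀ y, q y * (V y - m) ^ 2 ≤ 2 * (p y * (V y - m) ^ 2) + 3 * x * B ^ 2 := by
    intro y
    have a1 : (V y - m) ^ 2 ≤ B ^ 2 := by
      rw [sq_le_sq, abs_of_nonneg (hm0.trans hmB)]
      exact abs_le.2 ⟨by linarith [hV y], by linarith [hVB y]⟩
    have a2 : q y ≤ 2 * p y + 3 * x := by
      have a3 := (abs_le.1 (h y)).2
      have a4 : 2 * √(p y * x) ≤ p y + x := by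
        have := mul_sqrt_le (c := 2) (hp.nonneg y) hx one_pos
        linarith
      have : max (2 * √(p y * x)) (2 * x) ≤ p y + 3 * x :=
        max_le (by linarith) (by linarith [hp.nonneg y])
      linarith
    calc q y * (V y - m) ^ 2 ≤ (2 * p y + 3 * x) * (V y - m) ^ 2 :=
          mul_le_mul_of_nonneg_right a2 (sq_nonneg _)
      _ = 2 * (p y * (V y - m) ^ 2) + 3 * x * (V y - m) ^ 2 := by ring
      _ ≤ _ := by gcongr
  calc wmean q (fun y => (V y - m) ^ 2) ≤ ∑ y, (2 * (p y * (V y - m) ^ 2) + 3 * x * B ^ 2) :=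
        Finset.sum_le_sum fun y _ => e1 y
    _ = _ := by rw [Finset.sum_add_distrib, ← Finset.mul_sum, wvar]; simp; ring

theorem one_le_card_of_isWeight {p : Y → ℝ} (hp : IsWeight p) : (1 : ℝ) ≤ Fintype.card Y := by
  have : Nonempty Y := by
    by_contra hne
    rw [not_nonempty_iff] at hne
    have := hp.sum_eq
    simp at this
  exact_mod_cast Fintype.card_pos (α := Y)

/-- The error of a pessimistic backup of an arbitrary function. -/
theorem EntryClose.backup_error_le {p q : Y → ℝ} {x : ℝ} (h : EntryClose p q x) (hp : IsWeight p)
    (hq : IsWeight q) {V : Y → ℝ} {B l : ℝ} (hx : 0 ≤ x) (hB : 0 ≤ B) (hl : 0 < l)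
    (hV : ∀ y, 0 ≤ V y) (hVB : ∀ y, V y ≤ B) :
    |wmean q V - wmean p V| + wbonus q B x V ≤
      l * wvar p V + 43 * Fintype.card Y * x / l + 64 * Fintype.card Y * B * x := by
  have hd := one_le_card_of_isWeight hp
  have h1 := h.abs_mean_sub_le hp hq hx hV hVB
  have h2 := h.var_le hp hq hx hV hVB
  set d : ℝ := (Fintype.card Y : ℝ)
  set v := wvar p V with hv
  have hv0 : 0 ≤ v := hp.var_nonneg V
  have hBx : 0 ≤ B * x := mul_nonneg hB hx
  have hdB : B * x ≤ d * (B * x) := le_mul_of_one_le_left hBx hd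
  set t := √(v * (d * x)) with ht
  have ht0 : 0 ≤ t := Real.sqrt_nonneg _
  have ht2 : t ^ 2 = v * (d * x) := Real.sq_sqrt (by positivity)
  have htd : √(d * v * x) = t := by rw [ht]; congr 1; ring
  rw [htd] at h1
  have hvx : v * x ≤ t ^ 2 := by
    rw [ht2]; nlinarith [mul_nonneg hv0 hx]
  have h3 : √(wvar q V * x) ≤ 1.5 * t + 1.75 * (d * (B * x)) := by
    apply Real.sqrt_le_iff.2 ⟨by positivity, ?_⟩
    have a1 := mul_le_mul_of_nonneg_right h2 hx
    have a2 : d * (B * x) ^ 2 ≤ (d * (B * x)) ^ 2 := by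
      rw [mul_pow]; nlinarith [sq_nonneg (B * x)]
    nlinarith [mul_nonneg ht0 (hBx.trans hdB)]
  have h4 : wbonus q B x V ≤ 10.5 * t + 61.25 * (d * (B * x)) :=
    max_le (by linarith) (by linarith)
  -- The factor covers `2` from the mean and `10.5` from the bonus; `13²/4 < 43`.
  have h5 := mul_sqrt_le (c := 13) hv0 (by positivity : 0 ≤ d * x) hl
  have h6 : (13 : ℝ) ^ 2 / 4 * (d * x) / l ≤ 43 * d * x / l := by
    apply div_le_div_of_nonneg_right _ hl.le
    nlinarith [mul_nonneg (zero_le_one.trans hd) hx]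
  rw [← ht] at h5
  linarith

/-- The error of a pessimistic backup of a function close to a function whose mean is estimated
well. -/
theorem EntryClose.backup_error_le_of_close {p q : Y → ℝ} {x : ℝ} (h : EntryClose p q x)
    (hp : IsWeight p) (hq : IsWeight q) {V U : Y → ℝ} {B l m : ℝ} (hx : 0 ≤ x) (hB : 0 ≤ B)
    (hl : 0 < l) (hm : 0 < m) (hU : ∀ y, 0 ≤ U y) (hUV : ∀ y, U y ≤ V y) (hVB : ∀ y, V y ≤ B)
    (hV : |wmean q V - wmean p V| ≤ max (2 * √(wvar p V * x)) (2 * B * x)) :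
    |wmean q U - wmean p U| + wbonus q B x U ≤
      l * wvar p V + m * wvar p (fun y => V y - U y) + 64 * x / l + 64 * Fintype.card Y * x / m
        + 66 * Fintype.card Y * B * x := by
  have hd := one_le_card_of_isWeight hp
  -- `U` is split as `V - (V - U)`. The mean of `V` has a direct bound without the cardinality
  -- factor, and only the difference pays that factor.
  have h1 := h.abs_mean_sub_le hp hq hx (V := fun y => V y - U y) (B := B)
    (fun y => sub_nonneg.2 (hUV y)) (fun y => by linarith [hU y, hVB y])
  have h2 := h.var_le hp hq hx hU (fun y => (hUV y).trans (hVB y))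
  have h2' : wvar p U ≤ 2 * wvar p V + 2 * wvar p (fun y => V y - U y) := by
    have := hp.var_sub_le V (fun y => V y - U y)
    simpa using this
  rw [wmean_sub, wmean_sub] at h1
  set d : ℝ := (Fintype.card Y : ℝ)
  set v := wvar p V with hv
  set w := wvar p (fun y => V y - U y) with hw
  have hv0 : 0 ≤ v := hp.var_nonneg V
  have hw0 : 0 ≤ w := hp.var_nonneg _
  have hBx : 0 ≤ B * x := mul_nonneg hB hx
  have hdB : B * x ≤ d * (B * x) := le_mul_of_one_le_left hBx hd
  set t := √(v * x) with ht
  have ht0 : 0 ≤ t := Real.sqrt_nonneg _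
  have ht2 : t ^ 2 = v * x := Real.sq_sqrt (by positivity)
  set r := √(w * (d * x)) with hr
  have hr0 : 0 ≤ r := Real.sqrt_nonneg _
  have hr2 : r ^ 2 = w * (d * x) := Real.sq_sqrt (by positivity)
  have hrd : √(d * w * x) = r := by rw [hr]; congr 1; ring
  rw [hrd] at h1
  have hwx : w * x ≤ r ^ 2 := by
    rw [hr2]; nlinarith [mul_nonneg hw0 hx]
  have h3 : √(wvar q U * x) ≤ 2 * t + 2 * r + 1.75 * (d * (B * x)) := by
    apply Real.sqrt_le_iff.2 ⟨by positivity, ?_⟩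
    have a1 := mul_le_mul_of_nonneg_right (h2.trans (by linarith : _ ≤
      2 * (2 * v + 2 * w) + 3 * d * B ^ 2 * x)) hx
    have a2 : d * (B * x) ^ 2 ≤ (d * (B * x)) ^ 2 := by
      rw [mul_pow]; nlinarith [sq_nonneg (B * x)]
    nlinarith [mul_nonneg ht0 (hBx.trans hdB), mul_nonneg hr0 (hBx.trans hdB), mul_nonneg ht0 hr0]
  have h4 : wbonus q B x U ≤ 14 * t + 14 * r + 61.25 * (d * (B * x)) :=
    max_le (by linarith) (by linarith)
  have h5 := mul_sqrt_le (c := 16) hw0 (by positivity : 0 ≤ d * x) hm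
  have h6 := mul_sqrt_le (c := 16) hv0 hx hl
  have h7 : |wmean q V - wmean p V| ≤ 2 * t + 2 * (B * x) :=
    hV.trans (max_le (by linarith) (by linarith))
  have h8 : |wmean q U - wmean p U| ≤ 2 * t + 2 * (B * x) + (2 * r + 2 * d * B * x) := by
    rw [abs_le] at h1 h7 ⊢
    constructor <;> linarith [h1.1, h1.2, h7.1, h7.2]
  rw [← ht] at h6
  rw [← hr] at h5
  have e1 : (16 : ℝ) ^ 2 / 4 * (d * x) / m = 64 * d * x / m := by ring
  have e2 : (16 : ℝ) ^ 2 / 4 * x / l = 64 * x / l := by ring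
  rw [e1] at h5
  rw [e2] at h6
  linarith

/-- The variance of the next value is a telescoping term plus the drift. -/
theorem IsWeight.var_le_telescope {p : Y → ℝ} (hp : IsWeight p) {V : Y → ℝ} {B v c : ℝ}
    (hV : ∀ y, 0 ≤ V y) (hVB : ∀ y, V y ≤ B) (hvB : v ≤ B) (hv : 0 ≤ v) (hc : 0 ≤ c)
    (h : v ≤ c + wmean p V) :
    wvar p V ≤ wmean p (fun y => V y ^ 2) - v ^ 2 + 2 * B * c := by
  rw [hp.var_eq]
  have h1 := hp.le_mean hV
  have h2 := hp.mean_le hVB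
  set a := wmean p V
  -- What remains is `v² - a² ≤ 2Bc`: trivial for `v ≤ a`, and otherwise a product of `v - a ≤ c`
  -- and `v + a ≤ 2B`.
  rcases le_total v a with h3 | h3
  · nlinarith [mul_nonneg (hv.trans hvB) hc]
  · nlinarith [mul_nonneg (sub_nonneg.2 h3) (by linarith : 0 ≤ 2 * B - (v + a)),
      mul_nonneg (hv.trans hvB) (by linarith : 0 ≤ c - (v - a))]

end Weights

/-! ### Finite-horizon dynamic programming -/

section FiniteHorizon

variable {S A : Type*}

/-- The transition probabilities as real numbers. -/
noncomputable def prob (M : SSP S A) (s : S) (a : A) (y : Option S) : ℝ := (M.P s a y).toReal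

theorem isWeight_prob [Fintype S] (M : SSP S A) (s : S) (a : A) : IsWeight (M.prob s a) where
  nonneg _ := ENNReal.toReal_nonneg
  sum_eq := by
    simp only [prob]
    rw [← ENNReal.toReal_sum fun y _ => PMF.apply_ne_top _ _, ← tsum_fintype (L := .unconditional _),
      PMF.tsum_coe, ENNReal.toReal_one]

/-- The function on `Option S` that vanishes in the goal. -/
def onStates (f : S → ℝ) : Option S → ℝ
  | none => 0
  | some s => f s

variable [Fintype S] [Fintype A]

/-- The optimal cost when `m` stages remain and `f` is the terminal cost. -/
noncomputable def optToGo (M : SSP S A) (f : Option S → ℝ) : ℕ → Option S → ℝ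
  | 0 => f
  | m + 1 => onStates fun s => ⨅ a, (M.c s a + wmean (M.prob s a) (optToGo M f m))

omit [Fintype A] in
/-- The cost of a deterministic policy when `m` stages remain and `f` is the terminal cost;
`σ m s` is the action in the state `s` when `m + 1` stages remain. -/
noncomputable def detToGo (M : SSP S A) (σ : ℕ → S → A) (f : Option S → ℝ) : ℕ → Option S → ℝ
  | 0 => f
  | m + 1 => onStates fun s => M.c s (σ m s) + wmean (M.prob s (σ m s)) (detToGo M σ f m)

variable (M : SSP S A) {f : Option S → ℝ}

theorem optToGo_succ_le (f : Option S → ℝ) (m : ℕ) (s : S) (a : A) :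
    M.optToGo f (m + 1) (some s) ≤ M.c s a + wmean (M.prob s a) (M.optToGo f m) :=
  ciInf_le (Set.finite_range _).bddBelow a

theorem exists_optToGo_succ_eq [Nonempty A] (f : Option S → ℝ) (m : ℕ) (s : S) :
    ∃ a, M.optToGo f (m + 1) (some s) = M.c s a + wmean (M.prob s a) (M.optToGo f m) := by
  obtain ⟨a, ha⟩ := exists_eq_ciInf_of_finite
    (f := fun a => M.c s a + wmean (M.prob s a) (M.optToGo f m))
  exact ⟨a, ha.symm⟩

theorem optToGo_nonneg [Nonempty A] (hf : ∀ y, 0 ≤ f y) (m : ℕ) (y : Option S) :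
    0 ≤ M.optToGo f m y := by
  induction m generalizing y with
  | zero => exact hf y
  | succ m ih =>
    cases y with
    | none => exact le_rfl
    | some s => exact le_ciInf fun a => add_nonneg (M.c_nonneg s a) ((M.isWeight_prob s a).le_mean ih)

theorem detToGo_nonneg (σ : ℕ → S → A) (hf : ∀ y, 0 ≤ f y) (m : ℕ) (y : Option S) :
    0 ≤ M.detToGo σ f m y := by
  induction m generalizing y with
  | zero => exact hf y
  | succ m ih =>
    cases y with
    | none => exact le_rfl
    | some s => exact add_nonneg (M.c_nonneg s _) ((M.isWeight_prob s _).le_mean ih)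

theorem optToGo_le_detToGo (σ : ℕ → S → A) (f : Option S → ℝ) (m : ℕ) (y : Option S) :
    M.optToGo f m y ≤ M.detToGo σ f m y := by
  induction m generalizing y with
  | zero => exact le_rfl
  | succ m ih =>
    cases y with
    | none => exact le_rfl
    | some s =>
      exact (M.optToGo_succ_le f m s (σ m s)).trans
        (add_le_add le_rfl ((M.isWeight_prob s _).mean_mono ih))

end FiniteHorizon

/-! ### Deterministic analysis of LCBVI -/

section Analysis

variable {S A : Type*} [Fintype S] [Fintype A]

theorem isWeight_empP {N : S → A → Option S → ℕ} {n : ℕ} (hN : ∀ s a, visits N s a = n)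
    (hn : 0 < n) (s : S) (a : A) : IsWeight (empP N s a) where
  nonneg _ := by unfold empP; positivity
  sum_eq := by
    have h : visitsPlus N s a = visits N s a := by rw [visitsPlus, hN]; omega
    simp only [empP, h]
    rw [← Finset.sum_div, ← Nat.cast_sum, ← visits, hN]
    exact div_self (by positivity)

theorem qBackup_eq (M : SSP S A) {N : S → A → Option S → ℕ} {n : ℕ}
    (hN : ∀ s a, visits N s a = n) (hn : 0 < n) (H : ℕ) (B δ : ℝ) (V : Option S → ℝ) (s : S)
    (a : A) : M.qBackup H N B δ V s a =
      max (M.c s a + wmean (empP N s a) V - wbonus (empP N s a) B (iota N H δ / n) V) 0 := by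
  have h : visitsPlus N s a = n := by rw [visitsPlus, hN]; omega
  simp only [qBackup, bonus, wbonus, h, mul_div_assoc]
  rfl

/-- The action of the policy of LCBVI when `m + 1` stages remain. -/
noncomputable def lcbviGreedy [Nonempty A] (M : SSP S A) (H : ℕ) (N : S → A → Option S → ℕ)
    (B : ℝ) (cf : Option S → ℝ) (δ : ℝ) (m : ℕ) (s : S) : A :=
  argmin fun a => M.qBackup H N B δ (M.lcbviToGo H N B cf δ m) s a

theorem lcbviPi_eq [Nonempty A] (M : SSP S A) (H : ℕ) (N : S → A → Option S → ℕ)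
    (B : ℝ) (cf : Option S → ℝ) (δ : ℝ) (h : ℕ) (s : S) :
    M.lcbviPi H N B cf δ h s = M.lcbviGreedy H N B cf δ (H - h) s := by
  simp [lcbviPi, lcbviGreedy, lcbviV]

variable (M : SSP S A) {N : S → A → Option S → ℕ} {H : ℕ} {B δ : ℝ} {f : Option S → ℝ}

theorem lcbviToGo_succ_le (m : ℕ) (s : S) (a : A) :
    M.lcbviToGo H N B f δ (m + 1) (some s) ≤ M.qBackup H N B δ (M.lcbviToGo H N B f δ m) s a :=
  ciInf_le (Set.finite_range _).bddBelow a

theorem lcbviToGo_nonneg [Nonempty A] (hf : ∀ y, 0 ≤ f y) (m : ℕ) (y : Option S) :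
    0 ≤ M.lcbviToGo H N B f δ m y := by
  cases m with
  | zero => exact hf y
  | succ m =>
    cases y with
    | none => exact le_rfl
    | some s => exact le_ciInf fun a => le_max_right _ _

theorem qBackup_greedy_le [Nonempty A] (m : ℕ) (s : S) :
    M.qBackup H N B δ (M.lcbviToGo H N B f δ m) s (M.lcbviGreedy H N B f δ m s) ≤
      M.lcbviToGo H N B f δ (m + 1) (some s) :=
  le_ciInf (Classical.choose_spec (Finite.exists_min
    fun a => M.qBackup H N B δ (M.lcbviToGo H N B f δ m) s a))

variable {n : ℕ} [Nonempty A]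

/-- The value estimates of LCBVI are optimistic. -/
theorem lcbviToGo_le_optToGo (hN : ∀ s a, visits N s a = n) (hn : 0 < n) (hB : 0 ≤ B)
    (hx : 0 ≤ iota N H δ / n) (hf : ∀ y, 0 ≤ f y) {K : ℕ}
    (hVB : ∀ m ≤ K, ∀ y, M.optToGo f m y ≤ B)
    (hdev : ∀ m < K, ∀ s a, |wmean (empP N s a) (M.optToGo f m)
      - wmean (M.prob s a) (M.optToGo f m)|
        ≤ wbonus (empP N s a) B (iota N H δ / n) (M.optToGo f m))
    {m : ℕ} (hm : m ≤ K) (y : Option S) :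
    M.lcbviToGo H N B f δ m y ≤ M.optToGo f m y := by
  induction m generalizing y with
  | zero => exact le_rfl
  | succ m ih =>
    cases y with
    | none => exact le_rfl
    | some s =>
      refine le_ciInf fun a => (M.lcbviToGo_succ_le m s a).trans ?_
      rw [M.qBackup_eq hN hn]
      refine max_le ?_ (add_nonneg (M.c_nonneg s a)
        ((M.isWeight_prob s a).le_mean (M.optToGo_nonneg hf m)))
      -- Monotonicity of the pessimistic backup replaces the random estimate by `optToGo`, so that
      -- only the deviation for a fixed function matters.
      have h1 := (isWeight_empP hN hn s a).lcb_mono hx (M.lcbviToGo_nonneg (H := H) (N := N)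
        (B := B) (δ := δ) hf m) (fun y => ih (by omega) y) (hVB m (by omega)) hB
      have h2 := (abs_le.1 (hdev m (by omega) s a)).2
      linarith

/-- The cost of the policy of LCBVI exceeds the value estimates by little, if these are bounded. -/
theorem detToGo_le_of_lcbviToGo_le (hN : ∀ s a, visits N s a = n) (hn : 0 < n) (hB : 0 < B)
    (hx : 0 ≤ iota N H δ / n) (hf : ∀ y, 0 ≤ f y) {K : ℕ}
    (hVB : ∀ m ≤ K, ∀ y, M.lcbviToGo H N B f δ m y ≤ B)
    (hP : ∀ s a, EntryClose (M.prob s a) (empP N s a) (iota N H δ / n))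
    (hsmall : Fintype.card (Option S) * K * (iota N H δ / n) ≤ 1 / 1000000)
    (hV1 : ∀ y, M.lcbviToGo H N B f δ K y ≤ 0.1 * B) (y : Option S) :
    M.detToGo (M.lcbviGreedy H N B f δ) f K y ≤ 0.2 * B := by
  set x := iota N H δ / n with hxdef
  set V := M.lcbviToGo H N B f δ with hVdef
  set σ := M.lcbviGreedy H N B f δ with hσ
  set d : ℝ := (Fintype.card (Option S) : ℝ) with hd
  have hd0 : 0 ≤ d := by positivity
  have hV0 : ∀ m y, 0 ≤ V m y := M.lcbviToGo_nonneg hf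
  -- With this `l` the drift term `2 * B * (c + e)` of the telescoping bound costs only one percent
  -- of `c + e`.
  set l : ℝ := 1 / (200 * B) with hl
  have hl0 : 0 < l := by positivity
  have hlB : l * B = 1 / 200 := by rw [hl]; field_simp
  set r : ℝ := 43 * d * x / l + 64 * d * B * x with hr
  have hr' : r = 8664 * (d * x) * B := by
    rw [hr, hl]; field_simp; ring
  -- The potential `l(B² - V²)` pays for the variances. Of the error `e` of a backup, one percent is
  -- absorbed on the left (hence `0.99`), and one percent of the cost is spent on the drift (hence
  -- `0.98`).
  have key : ∀ m ≤ K, ∀ y, 0.98 * M.detToGo σ f m y ≤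
      0.99 * V m y + l * (B ^ 2 - V m y ^ 2) + m * r := by
    have hr0 : 0 ≤ r := by rw [hr']; positivity
    intro m
    induction m with
    | zero =>
      intro _ y
      have h1 : M.detToGo σ f 0 y = V 0 y := rfl
      have h2 := hVB 0 (by omega) y
      have h3 := hV0 0 y
      have h4 : 0 ≤ l * (B ^ 2 - V 0 y ^ 2) :=
        mul_nonneg hl0.le (sub_nonneg.2 (pow_le_pow_left₀ h3 h2 2))
      rw [h1]; push_cast; linarith
    | succ m ih =>
      intro hm y
      cases y with
      | none =>
        have h1 : M.detToGo σ f (m + 1) none = 0 := rfl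
        have h2 : V (m + 1) none = 0 := rfl
        rw [h1, h2]; simp; positivity
      | some s =>
        set a := σ m s with ha
        have hp := M.isWeight_prob s a
        have hq := isWeight_empP hN hn s a
        have hVm := hVB m (by omega)
        have h1 : M.detToGo σ f (m + 1) (some s)
          = M.c s a + wmean (M.prob s a) (M.detToGo σ f m) := rfl
        have h2 : M.c s a + wmean (empP N s a) (V m) - wbonus (empP N s a) B x (V m)
            ≤ V (m + 1) (some s) := by
          refine le_trans ?_ (M.qBackup_greedy_le m s)
          rw [M.qBackup_eq hN hn]
          exact le_max_left _ _
        have hc := M.c_nonneg s a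
        have hb0 := wbonus_nonneg (empP N s a) B x (V m)
        have hqV : 0 ≤ wmean (empP N s a) (V m) := hq.le_mean (hV0 m)
        have h3 : V (m + 1) (some s) ≤ M.c s a + wmean (empP N s a) (V m) := by
          refine (M.lcbviToGo_succ_le m s a).trans ?_
          rw [M.qBackup_eq hN hn]
          exact max_le (by linarith) (by linarith)
        have h4 := (hP s a).backup_error_le hp hq hx hB.le hl0 (hV0 m) hVm
        set e := |wmean (empP N s a) (V m) - wmean (M.prob s a) (V m)|
          + wbonus (empP N s a) B x (V m) with he
        have h5 := le_abs_self (wmean (empP N s a) (V m) - wmean (M.prob s a) (V m))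
        have h6 := neg_abs_le (wmean (empP N s a) (V m) - wmean (M.prob s a) (V m))
        have he0 : 0 ≤ e := by positivity
        have h7 := hp.var_le_telescope (hV0 m) hVm (hVB (m + 1) hm (some s)) (hV0 _ _)
          (add_nonneg hc he0) (by linarith)
        have h8 := mul_le_mul_of_nonneg_left h7 hl0.le
        have h9 : l * (wmean (M.prob s a) (fun y => V m y ^ 2) - V (m + 1) (some s) ^ 2
            + 2 * B * (M.c s a + e)) = l * wmean (M.prob s a) (fun y => V m y ^ 2)
              - l * V (m + 1) (some s) ^ 2 + (M.c s a + e) / 100 := by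
          linear_combination (2 * (M.c s a + e)) * hlB
        have h10 : 0.98 * wmean (M.prob s a) (M.detToGo σ f m) ≤
            0.99 * wmean (M.prob s a) (V m)
              - l * wmean (M.prob s a) (fun y => V m y ^ 2) + (l * B ^ 2 + m * r) := by
          rw [← wmean_const_mul, ← wmean_const_mul, ← wmean_const_mul, ← wmean_sub,
            ← hp.mean_const (l * B ^ 2 + m * r), ← wmean_add]
          refine hp.mean_mono fun y => ?_
          linarith [ih (by omega) y]
        rw [h1]
        push_cast
        linarith
  -- The three terms are at most `0.099B`, `0.005B` and `0.009B`, well below `0.98 * 0.2B`.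
  have h1 := key K le_rfl y
  have h2 := hV1 y
  have h3 : K * r ≤ 0.009 * B := by
    rw [hr']
    have := mul_le_mul_of_nonneg_right hsmall hB.le
    nlinarith
  have h4 : l * (B ^ 2 - V K y ^ 2) ≤ B / 200 := by
    have : l * B ^ 2 = B / 200 := by linear_combination B * hlB
    nlinarith [mul_nonneg hl0.le (sq_nonneg (V K y))]
  nlinarith

set_option maxHeartbeats 400000 in
/-- One halving step of the analysis of the fine estimate. -/
theorem detToGo_le_of_close (hN : ∀ s a, visits N s a = n) (hn : 0 < n) (hB : 1 ≤ B)
    (hx : 0 ≤ iota N H δ / n) (hf : ∀ y, 0 ≤ f y) {K : ℕ} {ε w : ℝ} (hε : 0 < ε) (hε1 : ε ≤ 1)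
    (hεw : ε ≤ w) (hwB : w ≤ B)
    (hVB : ∀ m ≤ K, ∀ y, M.optToGo f m y ≤ B)
    (hopt : ∀ m ≤ K, ∀ y, M.lcbviToGo H N B f δ m y ≤ M.optToGo f m y)
    (hw : ∀ m ≤ K, ∀ y, M.optToGo f m y - M.lcbviToGo H N B f δ m y ≤ w)
    (hdev : ∀ m < K, ∀ s a, |wmean (empP N s a) (M.optToGo f m)
      - wmean (M.prob s a) (M.optToGo f m)|
        ≤ max (2 * √(wvar (M.prob s a) (M.optToGo f m) * (iota N H δ / n)))
          (2 * B * (iota N H δ / n)))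
    (hP : ∀ s a, EntryClose (M.prob s a) (empP N s a) (iota N H δ / n))
    (h1 : Fintype.card (Option S) * K * (iota N H δ / n) ≤ 1 / 1000000)
    (h2 : B ^ 2 * K * (iota N H δ / n) ≤ ε ^ 2 / 1000000)
    (h3 : Fintype.card (Option S) * B * K * (iota N H δ / n) ≤ ε / 1000000)
    {m : ℕ} (hm : m ≤ K) (y : Option S) :
    M.detToGo (M.lcbviGreedy H N B f δ) f m y ≤ M.lcbviToGo H N B f δ m y + w / 2 := by
  have hB0 : 0 < B := by linarith
  have hw0 : 0 < w := by linarith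
  set x := iota N H δ / n with hxdef
  set V := M.lcbviToGo H N B f δ with hVdef
  set U := M.optToGo f with hUdef
  set σ := M.lcbviGreedy H N B f δ with hσ
  set d : ℝ := (Fintype.card (Option S) : ℝ) with hd
  have hd0 : 0 ≤ d := by positivity
  have hV0 : ∀ m y, 0 ≤ V m y := M.lcbviToGo_nonneg hf
  have hU0 : ∀ m y, 0 ≤ U m y := M.optToGo_nonneg hf
  -- The potential of `U` is thus worth at most `ε/100` in total, and its drift costs a fraction `b
  -- = 2Bl` of the cost of each step.
  set l : ℝ := ε / (100 * B ^ 2) with hl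
  have hl0 : 0 < l := by positivity
  have hlB2 : l * B ^ 2 = ε / 100 := by rw [hl]; field_simp
  set b : ℝ := ε / (50 * B) with hb
  have hlB : 2 * B * l = b := by rw [hl, hb]; field_simp; ring
  have hbB : b * B = ε / 50 := by rw [hb]; field_simp
  have hb0 : 0 < b := by positivity
  -- The gap `U - V` is at most `w` and its drift in a step is at most the error `e` of the backup;
  -- with `2wu = 1/2` its variance term returns exactly half of `e`.
  set u : ℝ := 1 / (4 * w) with hu
  have hu0 : 0 < u := by positivity
  have huw : u * w = 1 / 4 := by rw [hu]; field_simp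
  set r : ℝ := 64 * x / l + 64 * d * x / u + 66 * d * B * x with hr
  have hr0 : 0 ≤ r := by positivity
  have hr' : r = 6400 * (B ^ 2 * x) / ε + 256 * (d * x) * w + 66 * (d * B * x) := by
    rw [hr, hl, hu]; field_simp; ring
  -- The factor `1/2` is the half of the backup error that remains after absorption, and `b` is the
  -- share of the costs spent on the variance of `U`. The two quadratic terms are the potentials
  -- that telescope.
  have key : ∀ m ≤ K, ∀ y, (1 / 2 - b) * M.detToGo σ f m y ≤
      V m y / 2 + l * (B ^ 2 - U m y ^ 2) - u * (U m y - V m y) ^ 2 + m * r := by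
    intro m
    induction m with
    | zero =>
      intro _ y
      have h1 : M.detToGo σ f 0 y = V 0 y := rfl
      have h2 : U 0 y = V 0 y := rfl
      have h4 : 0 ≤ l * (B ^ 2 - U 0 y ^ 2) :=
        mul_nonneg hl0.le (sub_nonneg.2 (pow_le_pow_left₀ (hU0 0 y) (hVB 0 (by omega) y) 2))
      have h5 : u * (U 0 y - V 0 y) ^ 2 = 0 := by rw [h2]; ring
      rw [h5, h1]; push_cast
      nlinarith [mul_nonneg hb0.le (hV0 0 y)]
    | succ m ih =>
      intro hm y
      cases y with
      | none =>
        have h1 : M.detToGo σ f (m + 1) none = 0 := rfl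
        have h2 : V (m + 1) none = 0 := rfl
        have h3 : U (m + 1) none = 0 := rfl
        rw [h1, h2, h3]; simp; positivity
      | some s =>
        set a := σ m s with ha
        have hp := M.isWeight_prob s a
        have hq := isWeight_empP hN hn s a
        have h1 : M.detToGo σ f (m + 1) (some s)
          = M.c s a + wmean (M.prob s a) (M.detToGo σ f m) := rfl
        have h2 : M.c s a + wmean (empP N s a) (V m) - wbonus (empP N s a) B x (V m)
            ≤ V (m + 1) (some s) := by
          refine le_trans ?_ (M.qBackup_greedy_le m s)
          rw [M.qBackup_eq hN hn]
          exact le_max_left _ _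
        have hc := M.c_nonneg s a
        have hb0' := wbonus_nonneg (empP N s a) B x (V m)
        have h3 : U (m + 1) (some s) ≤ M.c s a + wmean (M.prob s a) (U m) :=
          M.optToGo_succ_le f m s a
        have h4 := (hP s a).backup_error_le_of_close hp hq hx hB0.le hl0 hu0 (hV0 m)
          (hopt m (by omega)) (hVB m (by omega)) (hdev m (by omega) s a)
        set e := |wmean (empP N s a) (V m) - wmean (M.prob s a) (V m)|
          + wbonus (empP N s a) B x (V m) with he
        have h5 := le_abs_self (wmean (empP N s a) (V m) - wmean (M.prob s a) (V m))
        have h6 := neg_abs_le (wmean (empP N s a) (V m) - wmean (M.prob s a) (V m))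
        have he0 : 0 ≤ e := by positivity
        have h7 := hp.var_le_telescope (hU0 m) (hVB m (by omega)) (hVB (m + 1) hm (some s))
          (hU0 _ _) hc h3
        have h7' := hp.var_le_telescope (V := fun y => U m y - V m y) (B := w)
          (v := U (m + 1) (some s) - V (m + 1) (some s)) (c := e)
          (fun y => sub_nonneg.2 (hopt m (by omega) y)) (hw m (by omega))
          (hw (m + 1) hm (some s)) (sub_nonneg.2 (hopt (m + 1) hm _)) he0
          (by rw [wmean_sub]; linarith)
        have h8 := mul_le_mul_of_nonneg_left h7 hl0.le
        have h8' := mul_le_mul_of_nonneg_left h7' hu0.le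
        have h9 : l * (wmean (M.prob s a) (fun y => U m y ^ 2) - U (m + 1) (some s) ^ 2
            + 2 * B * M.c s a) = l * wmean (M.prob s a) (fun y => U m y ^ 2)
              - l * U (m + 1) (some s) ^ 2 + b * M.c s a := by
          linear_combination M.c s a * hlB
        have h9' : u * (wmean (M.prob s a) (fun y => (U m y - V m y) ^ 2)
            - (U (m + 1) (some s) - V (m + 1) (some s)) ^ 2
            + 2 * w * e) = u * wmean (M.prob s a) (fun y => (U m y - V m y) ^ 2)
              - u * (U (m + 1) (some s) - V (m + 1) (some s)) ^ 2 + e / 2 := by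
          linear_combination (2 * e) * huw
        have h10 : (1 / 2 - b) * wmean (M.prob s a) (M.detToGo σ f m) ≤
            1 / 2 * wmean (M.prob s a) (V m)
              - l * wmean (M.prob s a) (fun y => U m y ^ 2)
              - u * wmean (M.prob s a) (fun y => (U m y - V m y) ^ 2)
              + (l * B ^ 2 + m * r) := by
          rw [← wmean_const_mul, ← wmean_const_mul, ← wmean_const_mul, ← wmean_const_mul,
            ← wmean_sub, ← wmean_sub, ← hp.mean_const (l * B ^ 2 + m * r), ← wmean_add]
          refine hp.mean_mono fun y => ?_
          linarith [ih (by omega) y]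
        rw [h1]
        push_cast
        linarith
  have k1 := key m hm y
  have hmr : m * r ≤ 0.007 * w := by
    have e1 : (m : ℝ) * r ≤ K * r :=
      mul_le_mul_of_nonneg_right (by exact_mod_cast hm) hr0
    have e2 : K * r = 6400 * ((B ^ 2 * K * x) / ε) + 256 * (d * K * x) * w
        + 66 * (d * B * K * x) := by
      rw [hr']; field_simp
    have e3 : (B ^ 2 * K * x) / ε ≤ ε / 1000000 := by
      rw [div_le_iff₀ hε]; linarith
    have e4 := mul_le_mul_of_nonneg_right h1 hw0.le
    linarith
  have k2 : l * (B ^ 2 - U m y ^ 2) ≤ ε / 100 := by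
    have := mul_nonneg hl0.le (sq_nonneg (U m y))
    linarith
  have k3 : 0 ≤ u * (U m y - V m y) ^ 2 := by positivity
  have k4 : b ≤ 1 / 50 := by
    have := mul_le_mul_of_nonneg_left hB hb0.le
    linarith
  have k5 : V m y ≤ B := (hopt m hm y).trans (hVB m hm y)
  -- A crude bound `J ≤ 2B` shows that the loss `b * J` is at most `ε/25`. Altogether `J/2` exceeds
  -- `V/2` by at most `0.04ε + 0.01ε + 0.007w`, which is less than `w/4`.
  have hJ0 : 0 ≤ M.detToGo σ f m y := M.detToGo_nonneg σ hf m y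
  have k6 : M.detToGo σ f m y ≤ 2 * B := by
    have := mul_le_mul_of_nonneg_right k4 hJ0
    linarith
  have k7 : b * M.detToGo σ f m y ≤ ε / 25 := by
    have := mul_le_mul_of_nonneg_left k6 hb0.le
    linarith
  linarith

/-- The policy of LCBVI is nearly optimal if the batch is large. -/
theorem detToGo_le_add (hN : ∀ s a, visits N s a = n) (hn : 0 < n) (hB : 1 ≤ B)
    (hx : 0 ≤ iota N H δ / n) (hf : ∀ y, 0 ≤ f y) {K : ℕ} {ε : ℝ} (hε : 0 < ε) (hε1 : ε ≤ 1)
    (hVB : ∀ m ≤ K, ∀ y, M.optToGo f m y ≤ B)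
    (hopt : ∀ m ≤ K, ∀ y, M.lcbviToGo H N B f δ m y ≤ M.optToGo f m y)
    (hdev : ∀ m < K, ∀ s a, |wmean (empP N s a) (M.optToGo f m)
      - wmean (M.prob s a) (M.optToGo f m)|
        ≤ max (2 * √(wvar (M.prob s a) (M.optToGo f m) * (iota N H δ / n)))
          (2 * B * (iota N H δ / n)))
    (hP : ∀ s a, EntryClose (M.prob s a) (empP N s a) (iota N H δ / n))
    (h1 : Fintype.card (Option S) * K * (iota N H δ / n) ≤ 1 / 1000000)
    (h2 : B ^ 2 * K * (iota N H δ / n) ≤ ε ^ 2 / 1000000)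
    (h3 : Fintype.card (Option S) * B * K * (iota N H δ / n) ≤ ε / 1000000) (y : Option S) :
    M.detToGo (M.lcbviGreedy H N B f δ) f K y ≤ M.optToGo f K y + ε / 2 := by
  suffices hW : ∀ m ≤ K, ∀ y, M.optToGo f m y - M.lcbviToGo H N B f δ m y ≤ ε by
    have := M.detToGo_le_of_close hN hn hB hx hf hε hε1 le_rfl (by linarith) hVB hopt hW hdev hP
      h1 h2 h3 le_rfl y
    linarith [hopt K le_rfl y]
  -- Self-bounding: let the largest gap serve as `w`. Were it larger than `ε`, the halving step at a
  -- maximizer together with `U ≤ J` would give `w ≤ w/2`.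
  obtain ⟨⟨m₀, y₀⟩, hmem, hmax⟩ := Finset.exists_max_image
    (Finset.range (K + 1) ×ˢ (Finset.univ : Finset (Option S)))
    (fun q => M.optToGo f q.1 q.2 - M.lcbviToGo H N B f δ q.1 q.2) ⟨(0, none), by simp⟩
  have hm₀ : m₀ ≤ K := by simp at hmem; omega
  have hle : ∀ m ≤ K, ∀ y, M.optToGo f m y - M.lcbviToGo H N B f δ m y ≤
      M.optToGo f m₀ y₀ - M.lcbviToGo H N B f δ m₀ y₀ := fun m hm y =>
    hmax (m, y) (by simp; omega)
  by_cases hc : M.optToGo f m₀ y₀ - M.lcbviToGo H N B f δ m₀ y₀ ≤ ε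
  · exact fun m hm y => (hle m hm y).trans hc
  push Not at hc
  have hB' : M.optToGo f m₀ y₀ - M.lcbviToGo H N B f δ m₀ y₀ ≤ B := by
    linarith [hVB m₀ hm₀ y₀, M.lcbviToGo_nonneg (H := H) (N := N) (B := B) (δ := δ) hf m₀ y₀]
  have := M.detToGo_le_of_close hN hn hB hx hf hε hε1 hc.le hB' hVB hopt hle hdev hP
    h1 h2 h3 hm₀ y₀
  have := M.optToGo_le_detToGo (M.lcbviGreedy H N B f δ) f m₀ y₀
  linarith

end Analysis

/-! ### The probability of missing the goal -/

section NotHit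

variable {S : Type*} [Fintype S]

/-- The probability that the goal is not reached within `n` steps; `K n` is the transition matrix
when `n + 1` steps remain. -/
noncomputable def notHit (K : ℕ → S → Option S → ℝ) : ℕ → Option S → ℝ
  | 0 => onStates fun _ => 1
  | n + 1 => onStates fun s => wmean (K n s) (notHit K n)

variable {K : ℕ → S → Option S → ℝ} (hK : ∀ n s, IsWeight (K n s))
include hK

theorem notHit_le_one (n : ℕ) (y : Option S) : notHit K n y ≤ 1 := by
  induction n generalizing y with
  | zero => cases y <;> simp [notHit, onStates]
  | succ n ih =>
    cases y with
    | none => exact zero_le_one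
    | some s => exact (hK n s).mean_le ih

variable {u : ℕ → Option S → ℝ} {θ : ℝ} (hu0 : ∀ n y, 0 ≤ u n y)
  (hu : ∀ n s, θ + wmean (K n s) (u n) ≤ u (n + 1) (some s)) (hθ : 0 < θ)
include hu0 hu hθ

/-- Markov's inequality: on the event that the goal is missed, each of the `n` steps has cost at
least `θ`. -/
theorem mul_notHit_le (n : ℕ) (y : Option S) : n * θ * notHit K n y ≤ u n y := by
  induction n generalizing y with
  | zero => simpa using hu0 0 y
  | succ n ih =>
    cases y with
    | none => simpa [notHit, onStates] using hu0 (n + 1) none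
    | some s =>
      refine le_trans ?_ (hu n s)
      have h1 : n * θ * wmean (K n s) (notHit K n) ≤ wmean (K n s) (u n) := by
        rw [← wmean_const_mul]
        exact (hK n s).mean_mono ih
      have h2 : notHit K (n + 1) (some s) = wmean (K n s) (notHit K n) := rfl
      have h3 := notHit_le_one hK (n + 1) (some s)
      rw [h2] at h3 ⊢
      push_cast
      nlinarith

/-- While `u ≤ R * θ`, the decrease of `u` by `θ` in a step is at least a fraction `1 / R` of its
value. So `u` contracts geometrically in expectation during `t` steps; the last `m` steps are left
to Markov's inequality. -/
theorem notHit_le_pow {R : ℝ} (hR : 1 ≤ R) {m t : ℕ} (hm : 0 < m)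
    (hub : ∀ n ≤ m + t, ∀ y, u n y ≤ R * θ) (y : Option S) :
    notHit K (m + t) y ≤ (1 - 1 / R) ^ t * (u (m + t) y / (m * θ)) := by
  have hR1 : 0 ≤ 1 - 1 / R := by
    rw [sub_nonneg, div_le_one (by linarith)]; exact hR
  have hmθ : 0 < m * θ := by positivity
  induction t generalizing y with
  | zero =>
    rw [pow_zero, one_mul, le_div_iff₀ hmθ]
    rw [add_zero, mul_comm]
    exact mul_notHit_le hK hu0 hu hθ m y
  | succ t ih =>
    have ih := ih fun n hn => hub n (by omega)
    cases y with
    | none => exact mul_nonneg (pow_nonneg hR1 _) (div_nonneg (hu0 _ _) hmθ.le)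
    | some s =>
      have h1 : notHit K (m + t + 1) (some s) ≤
          (1 - 1 / R) ^ t / (m * θ) * wmean (K (m + t) s) (u (m + t)) := by
        rw [← wmean_const_mul]
        exact (hK _ s).mean_mono fun y => (ih y).trans (le_of_eq (by ring))
      have h2 : wmean (K (m + t) s) (u (m + t)) ≤ (1 - 1 / R) * u (m + t + 1) (some s) := by
        have h3 := hu (m + t) s
        have h4 : 1 / R * u (m + t + 1) (some s) ≤ θ := by
          rw [div_mul_eq_mul_div, one_mul, div_le_iff₀ (by linarith)]
          linarith [hub (m + t + 1) (by omega) (some s)]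
        linarith
      refine h1.trans ((mul_le_mul_of_nonneg_left h2 (by positivity)).trans (le_of_eq ?_))
      rw [pow_succ, ← add_assoc]; ring

/-- With `m = ⌈R⌉` the bound of Markov's inequality is at most `1`. The other `t ≥ 4RL - R - 1 ≥
2RL` steps contract, and the factor `4` leaves room for the rounding. -/
theorem notHit_le_exp {R L : ℝ} {H : ℕ} (hR : 1 ≤ R) (hL : 1 ≤ L) (hH : 4 * R * L ≤ H)
    (hub : ∀ n ≤ H, ∀ y, u n y ≤ R * θ) (y : Option S) :
    notHit K H y ≤ Real.exp (-L) := by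
  have hR0 : 0 < R := by linarith
  set m := ⌈R⌉₊ with hm
  have hm1 : R ≤ m := Nat.le_ceil R
  have hm2 : (m : ℝ) < R + 1 := Nat.ceil_lt_add_one hR0.le
  have hRL : R ≤ R * L := le_mul_of_one_le_right hR0.le hL
  have hmH : m ≤ H := by
    have : (m : ℝ) ≤ H := by linarith
    exact_mod_cast this
  obtain ⟨t, rfl⟩ := Nat.exists_eq_add_of_le hmH
  have hm0 : 0 < m := Nat.ceil_pos.2 hR0
  have hR1 : 0 ≤ 1 - 1 / R := by
    rw [sub_nonneg, div_le_one (by linarith)]; exact hR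
  refine (notHit_le_pow hK hu0 hu hθ hR hm0 hub y).trans ?_
  have h1 : u (m + t) y / (m * θ) ≤ 1 := by
    rw [div_le_one (by positivity)]
    exact (hub _ le_rfl y).trans (mul_le_mul_of_nonneg_right hm1 hθ.le)
  have h2 : (1 - 1 / R) ^ t ≤ Real.exp (-(t / R)) := by
    calc (1 - 1 / R) ^ t ≤ Real.exp (-(1 / R)) ^ t := by
          refine pow_le_pow_left₀ hR1 ?_ t
          linarith [Real.add_one_le_exp (-(1 / R))]
      _ = _ := by rw [← Real.exp_nat_mul]; congr 1; ring
  have h3 : -(t / R) ≤ -L := by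
    rw [neg_le_neg_iff, le_div_iff₀ hR0]
    push_cast at hH
    nlinarith
  calc _ ≤ (1 - 1 / R) ^ t * 1 := mul_le_mul_of_nonneg_left h1 (pow_nonneg hR1 _)
    _ ≤ _ := by rw [mul_one]; exact h2.trans (Real.exp_le_exp.2 h3)

-- A difference of terminal values is merely transported by the chain, and it counts only on the
-- event that the goal is missed.
omit hu0 hu hθ in
theorem le_add_mul_notHit {V w : ℕ → Option S → ℝ} {d : ℕ → S → ℝ} {b : ℝ}
    (h0 : ∀ y, V 0 y ≤ w 0 y + b * notHit K 0 y) (hV : ∀ n, V (n + 1) none ≤ w (n + 1) none)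
    (hVs : ∀ n s, V (n + 1) (some s) ≤ d n s + wmean (K n s) (V n))
    (hw : ∀ n s, d n s + wmean (K n s) (w n) ≤ w (n + 1) (some s)) (n : ℕ) (y : Option S) :
    V n y ≤ w n y + b * notHit K n y := by
  induction n generalizing y with
  | zero => exact h0 y
  | succ n ih =>
    cases y with
    | none => simpa [notHit, onStates] using hV n
    | some s =>
      have h1 : wmean (K n s) (V n) ≤ wmean (K n s) (w n) + b * notHit K (n + 1) (some s) := by
        change _ ≤ _ + b * wmean (K n s) (notHit K n)
        rw [← wmean_const_mul, ← wmean_add]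
        exact (hK n s).mean_mono ih
      linarith [hVs n s, hw n s]

end NotHit

/-! ### Comparison of finite-horizon costs -/

section Comparison

variable {S A : Type*} [Fintype S] [Fintype A] [Nonempty A] (M : SSP S A)

theorem optToGo_none {f : Option S → ℝ} (hf : f none = 0) (m : ℕ) : M.optToGo f m none = 0 := by
  cases m
  · exact hf
  · rfl

theorem optToGo_zero_mono {m k : ℕ} (h : m ≤ k) (y : Option S) :
    M.optToGo (fun _ => 0) m y ≤ M.optToGo (fun _ => 0) k y := by
  have key : ∀ m y, M.optToGo (fun _ => 0) m y ≤ M.optToGo (fun _ => 0) (m + 1) y := by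
    intro m
    induction m with
    | zero => exact fun y => M.optToGo_nonneg (fun _ => le_rfl) 1 y
    | succ m ih =>
      intro y
      cases y with
      | none => exact le_rfl
      | some s =>
        refine le_ciInf fun a => (M.optToGo_succ_le _ m s a).trans ?_
        exact add_le_add le_rfl ((M.isWeight_prob s a).mean_mono ih)
  exact monotone_nat_of_le_succ (f := fun m => M.optToGo (fun _ => 0) m y) (fun m => key m y) h

/-- The instance with the same transitions and unit costs. -/
def unitCost (M : SSP S A) : SSP S A where
  P := M.P
  c _ _ := 1
  c_nonneg _ _ := zero_le_one
  c_le_one _ _ := le_rfl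

variable {M} {M' : SSP S A} (hP : M'.P = M.P) (hc : ∀ s a, M.c s a ≤ M'.c s a) {b : ℝ}
include hP hc

/-- The kernels are those of a policy optimal for `M'` with terminal cost zero, used as a candidate
in `M`. The instance `M'` will be either `M` itself, with `θ = c_min`, or the unit-cost instance,
where costs are hitting times and `θ = 1`. -/
theorem optToGo_le_notHit : ∃ K : ℕ → S → Option S → ℝ, (∀ n s, IsWeight (K n s)) ∧
    (∀ θ, (∀ s a, θ ≤ M'.c s a) → ∀ n s, θ + wmean (K n s) (M'.optToGo (fun _ => 0) n)
      ≤ M'.optToGo (fun _ => 0) (n + 1) (some s)) ∧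
    ∀ n y, M.optToGo (onStates fun _ => b) n y ≤
      M'.optToGo (fun _ => 0) n y + b * notHit K n y := by
  choose a ha using M'.exists_optToGo_succ_eq (fun _ => 0)
  have hprob : ∀ s a, M'.prob s a = M.prob s a := fun s a => by
    funext y; simp [prob, hP]
  have hK : ∀ n s, IsWeight (M.prob s (a n s)) := fun n s => M.isWeight_prob s _
  refine ⟨fun n s => M.prob s (a n s), hK, ?_, ?_⟩
  · intro θ hθ n s
    rw [ha n s, hprob]
    exact add_le_add (hθ _ _) le_rfl
  · refine le_add_mul_notHit (K := fun n s => M.prob s (a n s)) hK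
      (d := fun n s => M.c s (a n s)) ?_ (fun n => le_rfl) ?_ ?_
    · intro y
      cases y <;> simp [optToGo, notHit, onStates]
    · exact fun n s => M.optToGo_succ_le _ n s (a n s)
    · intro n s
      rw [ha n s, hprob]
      exact add_le_add (hc _ _) le_rfl

theorem optToGo_le_add (hb : 0 ≤ b) (n : ℕ) (y : Option S) :
    M.optToGo (onStates fun _ => b) n y ≤ M'.optToGo (fun _ => 0) n y + b := by
  obtain ⟨K, hK, -, h⟩ := optToGo_le_notHit (b := b) hP hc
  have := mul_le_mul_of_nonneg_left (notHit_le_one hK n y) hb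
  linarith [h n y]

theorem optToGo_le_add_exp (hb : 0 ≤ b) {θ R L : ℝ} {H : ℕ} (hθ : 0 < θ)
    (hθc : ∀ s a, θ ≤ M'.c s a) (hR : 1 ≤ R) (hL : 1 ≤ L) (hH : 4 * R * L ≤ H)
    (hub : ∀ y, M'.optToGo (fun _ => 0) H y ≤ R * θ) (y : Option S) :
    M.optToGo (onStates fun _ => b) H y ≤
      M'.optToGo (fun _ => 0) H y + b * Real.exp (-L) := by
  obtain ⟨K, hK, h1, h⟩ := optToGo_le_notHit (b := b) hP hc
  have := mul_le_mul_of_nonneg_left (notHit_le_exp hK (M'.optToGo_nonneg fun _ => le_rfl)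
    (h1 θ hθc) hθ hR hL hH (fun n hn y => (M'.optToGo_zero_mono hn y).trans (hub y)) y) hb
  linarith [h H y]

end Comparison

/-! ### Values of infinite-horizon policies -/

section InfiniteHorizon

variable {S A : Type*} [Fintype S] [Fintype A] (M : SSP S A)

/-- The expected cost paid at time `t`. -/
noncomputable def costAt (π : ℕ → S → PMF A) (s : S) (t : ℕ) : ℝ≥0∞ :=
  ∑ s' : S, ∑ a : A, M.stateLaw π s t (some s') * π t s' a * ENNReal.ofReal (M.c s' a)

theorem sum_stateLaw_succ_mul (π : ℕ → S → PMF A) (s : S) (t : ℕ) (g : S → ℝ≥0∞) :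
    ∑ y : S, M.stateLaw π s (t + 1) (some y) * g y =
      ∑ s' : S, M.stateLaw π s t (some s') *
        ∑ a, π t s' a * ∑ y : S, M.P s' a (some y) * g y := by
  have h : ∀ y : S, M.stateLaw π s (t + 1) (some y) =
      ∑ s' : S, M.stateLaw π s t (some s') * ∑ a, π t s' a * M.P s' a (some y) := by
    intro y
    rw [stateLaw, PMF.bind_apply, tsum_fintype, Fintype.sum_option]
    simp [step, PMF.bind_apply, tsum_fintype]
  simp only [h, Finset.sum_mul, Finset.mul_sum]
  rw [Finset.sum_comm]
  refine Finset.sum_congr rfl fun s' _ => ?_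
  rw [Finset.sum_comm]
  refine Finset.sum_congr rfl fun a _ => Finset.sum_congr rfl fun y _ => ?_
  ring

theorem costAt_add (π : ℕ → S → PMF A) (s : S) (t : ℕ) (g : S → ℝ≥0∞) :
    M.costAt π s t + ∑ y : S, M.stateLaw π s (t + 1) (some y) * g y =
      ∑ s' : S, M.stateLaw π s t (some s') *
        ∑ a, π t s' a * (ENNReal.ofReal (M.c s' a) + ∑ y : S, M.P s' a (some y) * g y) := by
  rw [sum_stateLaw_succ_mul, costAt, ← Finset.sum_add_distrib]
  refine Finset.sum_congr rfl fun s' _ => ?_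
  simp only [mul_add, Finset.sum_add_distrib, Finset.mul_sum, mul_assoc]

theorem sum_stateLaw_zero_mul (π : ℕ → S → PMF A) (s : S) (g : S → ℝ≥0∞) :
    ∑ y : S, M.stateLaw π s 0 (some y) * g y = g s := by
  classical
  simp [stateLaw, PMF.pure_apply]

/-- A supersolution of the evaluation equations dominates the value. -/
theorem value_le_of_supersolution (π : ℕ → S → PMF A) (Φ : ℕ → S → ℝ≥0∞)
    (h : ∀ t s, ∑ a, π t s a * (ENNReal.ofReal (M.c s a) +
      ∑ y : S, M.P s a (some y) * Φ (t + 1) y) ≤ Φ t s) (s : S) : M.value π s ≤ Φ 0 s := by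
  have key : ∀ n, ∑ t ∈ Finset.range n, M.costAt π s t
      + ∑ y : S, M.stateLaw π s n (some y) * Φ n y ≤ Φ 0 s := by
    intro n
    induction n with
    | zero => simp [sum_stateLaw_zero_mul]
    | succ n ih =>
      refine le_trans ?_ ih
      rw [Finset.sum_range_succ, add_assoc, costAt_add]
      gcongr
      exact h _ _
  change ∑' t, M.costAt π s t ≤ _
  rw [ENNReal.tsum_eq_iSup_nat]
  exact iSup_le fun n => le_self_add.trans (key n)

/-- A subsolution of the evaluation equations that vanishes eventually is dominated by the
value. -/
theorem le_value_of_subsolution (π : ℕ → S → PMF A) (Φ : ℕ → S → ℝ≥0∞) {n : ℕ}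
    (hn : ∀ s, Φ n s = 0)
    (h : ∀ t < n, ∀ s, Φ t s ≤ ∑ a, π t s a * (ENNReal.ofReal (M.c s a) +
      ∑ y : S, M.P s a (some y) * Φ (t + 1) y)) (s : S) : Φ 0 s ≤ M.value π s := by
  have key : ∀ k ≤ n, Φ 0 s ≤ ∑ t ∈ Finset.range k, M.costAt π s t
      + ∑ y : S, M.stateLaw π s k (some y) * Φ k y := by
    intro k
    induction k with
    | zero => simp [sum_stateLaw_zero_mul]
    | succ k ih =>
      intro hk
      refine (ih (by omega)).trans ?_
      rw [Finset.sum_range_succ, add_assoc, costAt_add]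
      gcongr
      exact h _ (by omega) _
  have h1 := key n le_rfl
  simp only [hn, mul_zero, Finset.sum_const_zero, add_zero] at h1
  exact h1.trans (ENNReal.sum_le_tsum (f := fun t => M.costAt π s t) _)

theorem ofReal_backup (s : S) (a : A) {V : Option S → ℝ} (hV : ∀ y, 0 ≤ V y) (h0 : V none = 0) :
    ENNReal.ofReal (M.c s a + wmean (M.prob s a) V) =
      ENNReal.ofReal (M.c s a) + ∑ y : S, M.P s a (some y) * ENNReal.ofReal (V (some y)) := by
  rw [ENNReal.ofReal_add (M.c_nonneg s a) ((M.isWeight_prob s a).le_mean hV), wmean,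
    Fintype.sum_option, h0, mul_zero, zero_add,
    ENNReal.ofReal_sum_of_nonneg fun y _ => mul_nonneg ((M.isWeight_prob s a).nonneg _) (hV _)]
  congr 1
  refine Finset.sum_congr rfl fun y _ => ?_
  rw [prob, ENNReal.ofReal_mul ENNReal.toReal_nonneg, ENNReal.ofReal_toReal (PMF.apply_ne_top _ _)]

theorem sum_pmf_mul_const (p : PMF A) (x : ℝ≥0∞) : ∑ a, p a * x = x := by
  rw [← Finset.sum_mul, ← tsum_fintype (L := .unconditional _), PMF.tsum_coe, one_mul]

variable [Nonempty A]

/-- The finite-horizon optimal cost is at most the value of any policy. -/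
theorem optToGo_le_value (π : ℕ → S → PMF A) (n : ℕ) (s : S) :
    ENNReal.ofReal (M.optToGo (fun _ => 0) n (some s)) ≤ M.value π s := by
  refine M.le_value_of_subsolution π
    (fun t s => ENNReal.ofReal (M.optToGo (fun _ => 0) (n - t) (some s))) (n := n) ?_ ?_ s
  · intro s; simp [optToGo]
  · intro t ht s
    rw [← sum_pmf_mul_const (π t s) (ENNReal.ofReal (M.optToGo (fun _ => 0) (n - t) (some s)))]
    gcongr with a
    rw [← M.ofReal_backup s a (M.optToGo_nonneg (fun _ => le_rfl) _) (M.optToGo_none rfl _)]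
    refine ENNReal.ofReal_le_ofReal ?_
    rw [show n - t = n - (t + 1) + 1 by omega]
    exact M.optToGo_succ_le _ _ _ _

theorem hitTime_eq_value_unitCost (π : ℕ → S → PMF A) (s : S) :
    M.hitTime π s = M.unitCost.value π s := by
  have h : ∀ t, M.unitCost.stateLaw π s t = M.stateLaw π s t := by
    intro t
    induction t with
    | zero => rfl
    | succ t ih =>
      rw [stateLaw, stateLaw, ih]
      congr 1
  simp only [hitTime, value, h]
  refine tsum_congr fun t => Finset.sum_congr rfl fun s' _ => ?_
  simp only [unitCost, ENNReal.ofReal_one, mul_one]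
  rw [← Finset.mul_sum]
  have := sum_pmf_mul_const (π t s') 1
  simp only [mul_one] at this
  rw [this, mul_one]

/-- The value of a periodic policy is at most its cost over one period with a terminal cost that
dominates it. -/
theorem value_periodic_le (σ : ℕ → S → A) {f : Option S → ℝ} {H : ℕ} (hH : 0 < H)
    (hf : ∀ y, 0 ≤ f y) (hf0 : f none = 0) {τ : ℕ → S → A}
    (hτ : ∀ t s, τ t s = σ (H - (t % H + 1)) s)
    (hle : ∀ y, M.detToGo σ f H y ≤ f y) (s : S) :
    M.value (ofDet τ) s ≤ ENNReal.ofReal (M.detToGo σ f H (some s)) := by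
  have h0 : ∀ m, M.detToGo σ f m none = 0 := by
    intro m; cases m
    · exact hf0
    · rfl
  -- The supersolution is the cost to go in the current phase. Inside a period it solves the
  -- evaluation equation; at the end of a period the terminal cost `f` is replaced by the smaller
  -- cost of a whole new period, by `hle`.
  have := M.value_le_of_supersolution (ofDet τ)
    (fun t s => ENNReal.ofReal (M.detToGo σ f (H - t % H) (some s))) ?_ s
  · simpa using this
  intro t s
  have hsum : ∀ g : A → ℝ≥0∞, ∑ a, ofDet τ t s a * g a = g (τ t s) := by
    intro g
    classical
    simp [ofDet, PMF.pure_apply]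
  rw [hsum, ← M.ofReal_backup s _ (V := M.detToGo σ f (H - (t + 1) % H))
    (M.detToGo_nonneg σ hf _) (h0 _)]
  refine ENNReal.ofReal_le_ofReal ?_
  have hlt := Nat.mod_lt t hH
  have e1 : M.detToGo σ f (H - t % H) (some s) = M.c s (τ t s) +
      wmean (M.prob s (τ t s)) (M.detToGo σ f (H - (t % H + 1))) := by
    rw [show H - t % H = H - (t % H + 1) + 1 by omega, hτ]; rfl
  rw [e1]
  refine add_le_add le_rfl ((M.isWeight_prob s _).mean_mono fun y => ?_)
  rcases Nat.lt_or_ge (t % H + 1) H with h | h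
  · have : (t + 1) % H = t % H + 1 := by
      rw [Nat.add_mod, Nat.mod_eq_of_lt (show 1 < H by omega), Nat.mod_eq_of_lt h]
    rw [this]
  · have e2 : t % H + 1 = H := by omega
    have : (t + 1) % H = 0 := by
      rw [← Nat.mod_add_mod, e2, Nat.mod_self]
    rw [this, e2, Nat.sub_self, Nat.sub_zero]
    exact hle y

/-- The finite-horizon cost of a stationary randomized policy. -/
noncomputable def randToGo (M : SSP S A) (π : S → PMF A) : ℕ → Option S → ℝ
  | 0 => fun _ => 0
  | n + 1 => onStates fun s =>
      ∑ a, (π s a).toReal * (M.c s a + wmean (M.prob s a) (randToGo M π n))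

theorem randToGo_nonneg (π : S → PMF A) (n : ℕ) (y : Option S) : 0 ≤ M.randToGo π n y := by
  induction n generalizing y with
  | zero => exact le_rfl
  | succ n ih =>
    cases y with
    | none => exact le_rfl
    | some s =>
      exact Finset.sum_nonneg fun a _ => mul_nonneg ENNReal.toReal_nonneg
        (add_nonneg (M.c_nonneg s a) ((M.isWeight_prob s a).le_mean ih))

theorem randToGo_le_value (π : S → PMF A) (n : ℕ) (s : S) :
    ENNReal.ofReal (M.randToGo π n (some s)) ≤ M.value (stationary π) s := by
  refine M.le_value_of_subsolution (stationary π)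
    (fun t s => ENNReal.ofReal (M.randToGo π (n - t) (some s))) (n := n) ?_ ?_ s
  · intro s; simp [randToGo]
  · intro t ht s
    rw [show n - t = n - (t + 1) + 1 by omega]
    have h0 : M.randToGo π (n - (t + 1)) none = 0 := by cases n - (t + 1) <;> rfl
    change ENNReal.ofReal (∑ a, _) ≤ _
    rw [ENNReal.ofReal_sum_of_nonneg fun a _ => mul_nonneg ENNReal.toReal_nonneg
      (add_nonneg (M.c_nonneg s a) ((M.isWeight_prob s a).le_mean (M.randToGo_nonneg π _)))]
    refine Finset.sum_le_sum fun a _ => ?_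
    rw [ENNReal.ofReal_mul ENNReal.toReal_nonneg, ENNReal.ofReal_toReal (PMF.apply_ne_top _ _),
      M.ofReal_backup s a (M.randToGo_nonneg π _) h0]
    rfl

theorem isWeight_toReal (p : PMF A) : IsWeight fun a => (p a).toReal where
  nonneg _ := ENNReal.toReal_nonneg
  sum_eq := by
    rw [← ENNReal.toReal_sum fun y _ => PMF.apply_ne_top _ _, ← tsum_fintype (L := .unconditional _),
      PMF.tsum_coe, ENNReal.toReal_one]

/-- The finite-horizon optimal cost is nearly dominated by the value of a stationary policy that
reaches the goal fast. -/
theorem optToGo_le_value_add_exp (π : S → PMF A) {T L b : ℝ} {H : ℕ} (hT : 1 ≤ T) (hL : 1 ≤ L)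
    (hb : 0 ≤ b) (hH : 4 * T * L ≤ H)
    (hπ : ∀ s, M.hitTime (stationary π) s ≤ ENNReal.ofReal T) (s : S) :
    ENNReal.ofReal (M.optToGo (onStates fun _ => b) H (some s)) ≤
      M.value (stationary π) s + ENNReal.ofReal (b * Real.exp (-L)) := by
  -- Averaging over the actions turns the randomized policy into one chain. Its unit-cost
  -- truncations are bounded by the hitting time, so the exponential bound applies with `R = T` and
  -- `θ = 1`.
  set K : ℕ → S → Option S → ℝ := fun _ s y => ∑ a, (π s a).toReal * M.prob s a y with hKdef
  have hw := fun s => isWeight_toReal (π s)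
  have hKmean : ∀ n s V, wmean (K n s) V = ∑ a, (π s a).toReal * wmean (M.prob s a) V := by
    intro n s V
    simp only [wmean, hKdef, Finset.sum_mul, Finset.mul_sum]
    rw [Finset.sum_comm]
    simp only [mul_assoc]
  have hK : ∀ n s, IsWeight (K n s) := fun n s =>
    { nonneg := fun y => Finset.sum_nonneg fun a _ =>
        mul_nonneg ENNReal.toReal_nonneg ENNReal.toReal_nonneg
      sum_eq := by
        have := hKmean n s (fun _ => 1)
        simp only [(M.isWeight_prob s _).mean_const, mul_one, (hw s).sum_eq] at this
        simpa [wmean] using this }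
  have hq := notHit_le_exp (u := M.unitCost.randToGo π) (θ := 1) hK (M.unitCost.randToGo_nonneg π)
    (fun n s => ?_) one_pos hT hL hH (fun n _ y => ?_)
  · have hle := le_add_mul_notHit (b := b) (V := M.optToGo (onStates fun _ => b))
      (w := M.randToGo π) (d := fun _ s => ∑ a, (π s a).toReal * M.c s a) hK ?_ (fun n => le_rfl)
      ?_ ?_ H (some s)
    · have h1 := mul_le_mul_of_nonneg_left (hq (some s)) hb
      calc ENNReal.ofReal (M.optToGo (onStates fun _ => b) H (some s))
          ≤ ENNReal.ofReal (M.randToGo π H (some s) + b * Real.exp (-L)) :=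
            ENNReal.ofReal_le_ofReal (by linarith)
        _ ≤ _ := ENNReal.ofReal_add_le.trans (add_le_add (M.randToGo_le_value π H s) le_rfl)
    · intro y; cases y <;> simp [optToGo, notHit, onStates, randToGo]
    · intro n s
      rw [hKmean n, ← Finset.sum_add_distrib]
      have h1 := (hw s).le_mean (V := fun a => M.c s a +
        wmean (M.prob s a) (M.optToGo (onStates fun _ => b) n)) (M.optToGo_succ_le _ n s)
      simpa only [wmean, mul_add] using h1
    · intro n s
      rw [hKmean n, ← Finset.sum_add_distrib]
      refine le_of_eq (Finset.sum_congr rfl fun a _ => by ring)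
  · rw [hKmean n]
    change _ ≤ ∑ a, (π s a).toReal * (1 + wmean (M.prob s a) (M.unitCost.randToGo π n))
    simp only [mul_add, Finset.sum_add_distrib, mul_one, (hw s).sum_eq]
    exact le_rfl
  · cases y with
    | none => cases n <;> simp [randToGo, onStates] <;> linarith
    | some s =>
      rw [mul_one]
      have := (M.unitCost.randToGo_le_value π n s).trans
        ((M.hitTime_eq_value_unitCost _ s).ge.trans (hπ s))
      exact (ENNReal.ofReal_le_ofReal_iff (by linarith)).1 this

end InfiniteHorizon

/-! ### Concentration -/

section Concentration

variable {Ω Y : Type*} [MeasurableSpace Ω] {μ : Measure Ω} [IsProbabilityMeasure μ] [Fintype Y]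

theorem integral_comp_eq_wmean {Z : Ω → Y} (hZ : Measurable[_, ⊤] Z) {p : Y → ℝ}
    (hp : ∀ y, μ.real (Z ⁻¹' {y}) = p y) (F : Y → ℝ) : ∫ ω, F (Z ω) ∂μ = wmean p F := by
  classical
  let _ : MeasurableSpace Y := ⊤
  have h : ∀ ω, F (Z ω) = ∑ y, (Z ⁻¹' {y}).indicator (fun _ => F y) ω := by
    intro ω
    rw [Finset.sum_eq_single (Z ω)]
    · simp
    · intro y _ hy
      exact Set.indicator_of_notMem (by simpa using hy.symm) _
    · simp
  simp_rw [h]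
  rw [integral_finsetSum]
  · refine Finset.sum_congr rfl fun y _ => ?_
    rw [integral_indicator_const _ (hZ trivial), hp, smul_eq_mul]
  · exact fun y _ => (integrable_const _).indicator (hZ trivial)

/-- This rests on `exp z ≤ 1 + z + z²` for `|z| ≤ 1`: the linear term vanishes because `g` is
centred. -/
theorem IsWeight.mean_exp_le {p : Y → ℝ} (hp : IsWeight p) {g : Y → ℝ} {v b l : ℝ}
    (hg : wmean p g = 0) (hv : wmean p (fun y => g y ^ 2) ≤ v) (hb : ∀ y, |g y| ≤ b)
    (hl : 0 ≤ l) (hlb : l * b ≤ 1) :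
    wmean p (fun y => Real.exp (l * g y)) ≤ Real.exp (l ^ 2 * v) := by
  have h1 : wmean p (fun y => Real.exp (l * g y)) ≤
      wmean p (fun y => (1 + l * g y) + l ^ 2 * g y ^ 2) := by
    refine hp.mean_mono fun y => ?_
    have h2 : |l * g y| ≤ 1 := by
      rw [abs_mul, abs_of_nonneg hl]
      exact (mul_le_mul_of_nonneg_left (hb y) hl).trans hlb
    have := (abs_le.1 (Real.abs_exp_sub_one_sub_id_le h2)).2
    linarith [mul_pow l (g y) 2]
  rw [wmean_add, wmean_add, wmean_const_mul, wmean_const_mul, hp.mean_const, hg] at h1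
  have h3 := mul_le_mul_of_nonneg_left hv (sq_nonneg l)
  linarith [Real.add_one_le_exp (l ^ 2 * v)]

/-- Bernstein's inequality for functions of independent samples, upper tail. -/
theorem bernstein {Z : ℕ → Ω → Y} (hZ : ∀ j, Measurable[_, ⊤] (Z j)) {p : Y → ℝ}
    (hp : IsWeight p) (hZp : ∀ j y, μ.real (Z j ⁻¹' {y}) = p y)
    (hind : iIndepFun (m := fun _ => ⊤) Z μ) {g : Y → ℝ} {v b x : ℝ} {n : ℕ} (hn : 0 < n)
    (hg : wmean p g = 0) (hv : wmean p (fun y => g y ^ 2) ≤ v) (hb : ∀ y, |g y| ≤ b)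
    (hb0 : 0 < b) (hv0 : 0 ≤ v) (hx : 0 ≤ x) :
    μ {ω | max (2 * √(v * x)) (2 * b * x) * n < ∑ j ∈ Finset.range n, g (Z j ω)} ≤
      ENNReal.ofReal (Real.exp (-(x * n))) := by
  let _ : MeasurableSpace Y := ⊤
  have hn0 : (0 : ℝ) < n := by exact_mod_cast hn
  set t := max (2 * √(v * x)) (2 * b * x) with ht
  -- The Chernoff parameter. The choice `l = √(x/v)` balances the exponent unless it violates `l * b
  -- ≤ 1`; then `v ≤ b² * x`, and `l = 1/b` works with the second branch of the maximum.
  obtain ⟨l, hl0, hlb, hlt⟩ : ∃ l : ℝ, 0 ≤ l ∧ l * b ≤ 1 ∧ x ≤ l * t - l ^ 2 * v := by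
    rcases hx.eq_or_lt with rfl | hx0
    · exact ⟨0, le_rfl, by simp, by simp⟩
    rcases le_or_gt v (b ^ 2 * x) with hc | hc
    · refine ⟨1 / b, by positivity, by field_simp; exact le_rfl, ?_⟩
      have h1 : 1 / b * (2 * b * x) ≤ 1 / b * t :=
        mul_le_mul_of_nonneg_left (le_max_right _ _) (by positivity)
      have h2 : 1 / b * (2 * b * x) = 2 * x := by field_simp
      have h3 : (1 / b) ^ 2 * v ≤ x := by
        rw [one_div, inv_pow, inv_mul_le_iff₀ (by positivity)]; exact hc
      linarith
    · have hvp : 0 < v := lt_of_le_of_lt (by positivity) hc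
      have h1 : √(v * x) ^ 2 = v * x := Real.sq_sqrt (by positivity)
      refine ⟨√(v * x) / v, by positivity, ?_, ?_⟩
      · rw [div_mul_eq_mul_div, div_le_one hvp]
        refine (pow_le_pow_iff_left₀ (by positivity) hvp.le two_ne_zero).1 ?_
        rw [mul_pow, h1]
        nlinarith [mul_lt_mul_of_pos_left hc hvp]
      · have h2 : √(v * x) / v * (2 * √(v * x)) ≤ √(v * x) / v * t :=
          mul_le_mul_of_nonneg_left (le_max_left _ _) (by positivity)
        have h3 : √(v * x) / v * (2 * √(v * x)) = 2 * x := by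
          rw [show √(v * x) / v * (2 * √(v * x)) = 2 * √(v * x) ^ 2 / v by ring, h1]
          field_simp
        have h4 : (√(v * x) / v) ^ 2 * v = x := by
          rw [div_pow, h1]; field_simp
        linarith
  have hmeas : ∀ j, Measurable (fun ω => g (Z j ω)) := fun j => (measurable_from_top).comp (hZ j)
  have hind' : iIndepFun (fun j ω => g (Z j ω)) μ :=
    hind.comp (fun _ => g) (fun _ => measurable_from_top)
  have hmgf : ∀ j, mgf (fun ω => g (Z j ω)) μ l ≤ Real.exp (l ^ 2 * v) := by
    intro j
    rw [mgf, integral_comp_eq_wmean (hZ j) (hZp j) (fun y => Real.exp (l * g y))]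
    exact hp.mean_exp_le hg hv hb hl0 hlb
  have hbd : ∀ ω, |(∑ j ∈ Finset.range n, fun ω => g (Z j ω)) ω| ≤ n * b := by
    intro ω
    rw [Finset.sum_apply]
    refine (Finset.abs_sum_le_sum_abs _ _).trans ?_
    calc _ ≤ ∑ j ∈ Finset.range n, b := Finset.sum_le_sum fun j _ => hb _
      _ = _ := by simp
  have hsm : Measurable (∑ j ∈ Finset.range n, fun ω => g (Z j ω)) := by fun_prop
  have hint : Integrable
      (fun ω => Real.exp (l * (∑ j ∈ Finset.range n, fun ω => g (Z j ω)) ω)) μ := by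
    refine Integrable.of_bound (C := Real.exp (l * (n * b)))
      (by fun_prop) (Filter.Eventually.of_forall fun ω => ?_)
    rw [Real.norm_eq_abs, abs_of_pos (Real.exp_pos _), Real.exp_le_exp]
    exact mul_le_mul_of_nonneg_left ((le_abs_self _).trans (hbd ω)) hl0
  have hch := measure_ge_le_exp_mul_mgf (μ := μ)
    (X := ∑ j ∈ Finset.range n, fun ω => g (Z j ω)) (t * n) hl0 hint
  rw [hind'.mgf_sum hmeas] at hch
  have hprod : ∏ j ∈ Finset.range n, mgf (fun ω => g (Z j ω)) μ l ≤
      Real.exp (l ^ 2 * v) ^ n := by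
    refine (Finset.prod_le_prod (fun j _ => mgf_nonneg) fun j _ => hmgf j).trans (le_of_eq ?_)
    simp
  have hfin : Real.exp (-l * (t * n)) * ∏ j ∈ Finset.range n, mgf (fun ω => g (Z j ω)) μ l ≤
      Real.exp (-(x * n)) := by
    refine (mul_le_mul_of_nonneg_left hprod (Real.exp_pos _).le).trans ?_
    rw [← Real.exp_nat_mul, ← Real.exp_add, Real.exp_le_exp]
    nlinarith [mul_le_mul_of_nonneg_right hlt hn0.le]
  calc μ {ω | t * n < ∑ j ∈ Finset.range n, g (Z j ω)}
      ≤ μ {ω | t * n ≤ (∑ j ∈ Finset.range n, fun ω => g (Z j ω)) ω} := by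
        refine measure_mono fun ω hω => ?_
        simp only [Set.mem_ofPred_eq, Finset.sum_apply] at hω ⊢
        exact hω.le
    _ = ENNReal.ofReal (μ.real _) := (ofReal_measureReal).symm
    _ ≤ _ := ENNReal.ofReal_le_ofReal (hch.trans hfin)

/-- Bernstein's inequality for functions of independent samples, two-sided. -/
theorem bernstein_abs {Z : ℕ → Ω → Y} (hZ : ∀ j, Measurable[_, ⊤] (Z j)) {p : Y → ℝ}
    (hp : IsWeight p) (hZp : ∀ j y, μ.real (Z j ⁻¹' {y}) = p y)
    (hind : iIndepFun (m := fun _ => ⊤) Z μ) {f : Y → ℝ} {v b x : ℝ} {n : ℕ} (hn : 0 < n)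
    (hv : wvar p f ≤ v) (hb : ∀ y, |f y - wmean p f| ≤ b) (hb0 : 0 < b) (hx : 0 ≤ x) :
    μ {ω | max (2 * √(v * x)) (2 * b * x) <
        |(∑ j ∈ Finset.range n, f (Z j ω)) / n - wmean p f|} ≤
      ENNReal.ofReal (2 * Real.exp (-(x * n))) := by
  have hn0 : (0 : ℝ) < n := by exact_mod_cast hn
  have hv0 : 0 ≤ v := (hp.var_nonneg f).trans hv
  have h1 := bernstein (μ := μ) hZ hp hZp hind (g := fun y => f y - wmean p f) hn
    (by rw [wmean_sub, hp.mean_const, sub_self]) hv hb hb0 hv0 hx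
  have h2 := bernstein (μ := μ) hZ hp hZp hind (g := fun y => wmean p f - f y) hn
    (by rw [wmean_sub, hp.mean_const, sub_self])
    (by refine le_trans (le_of_eq ?_) hv
        exact Finset.sum_congr rfl fun y _ => by ring) (fun y => by rw [abs_sub_comm]; exact hb y)
    hb0 hv0 hx
  rw [two_mul (Real.exp _), ENNReal.ofReal_add (Real.exp_pos _).le (Real.exp_pos _).le]
  refine le_trans (measure_mono ?_) ((measure_union_le _ _).trans (add_le_add h1 h2))
  intro ω hω
  simp only [Set.mem_ofPred_eq, Set.mem_union, Finset.sum_sub_distrib, Finset.sum_const,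
    Finset.card_range, nsmul_eq_mul] at hω ⊢
  have h3 : ∑ j ∈ Finset.range n, f (Z j ω) =
      n * ((∑ j ∈ Finset.range n, f (Z j ω)) / n) := by field_simp
  rw [h3]
  rcases lt_abs.1 hω with h | h
  · left; nlinarith
  · right; nlinarith

end Concentration

/-! ### Concentration of the empirical transition functions -/

section Batch

variable {S A Ω : Type*} [Fintype S] [Fintype A]

omit [Fintype A] in
theorem sum_counter_mul (x : ℕ → S → A → Option S) (k n : ℕ) (s : S) (a : A) (f : Option S → ℝ) :
    ∑ y, (counter x k n s a y : ℝ) * f y = ∑ j ∈ Finset.range n, f (x (k + j) s a) := by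
  classical
  rw [← Finset.sum_fiberwise (Finset.range n) (fun j => x (k + j) s a)
    (fun j => f (x (k + j) s a))]
  refine Finset.sum_congr rfl fun y _ => ?_
  rw [Finset.sum_congr rfl (g := fun _ => f y) fun j hj => by rw [(Finset.mem_filter.1 hj).2],
    Finset.sum_const, nsmul_eq_mul]
  congr!

theorem visits_counter (x : ℕ → S → A → Option S) (k n : ℕ) (s : S) (a : A) :
    visits (counter x k n) s a = n := by
  have := sum_counter_mul x k n s a (fun _ => 1)
  simp only [mul_one, Finset.sum_const, Finset.card_range, nsmul_eq_mul] at this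
  exact_mod_cast this

theorem wmean_empP_counter (x : ℕ → S → A → Option S) (k : ℕ) {n : ℕ} (hn : 0 < n) (s : S) (a : A)
    (f : Option S → ℝ) : wmean (empP (counter x k n) s a) f =
      (∑ j ∈ Finset.range n, f (x (k + j) s a)) / n := by
  have h : visitsPlus (counter x k n) s a = n := by rw [visitsPlus, visits_counter]; omega
  simp only [wmean, empP, h]
  rw [← sum_counter_mul, Finset.sum_div]
  exact Finset.sum_congr rfl fun y _ => by ring

variable [MeasurableSpace Ω] {μ : Measure Ω} [IsProbabilityMeasure μ] {M : SSP S A}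
  {X : ℕ → S → A → Ω → Option S}

theorem IsGenerativeModel.measure_deviation_le (hX : M.IsGenerativeModel μ X) (k : ℕ) {n : ℕ}
    (hn : 0 < n) (s : S) (a : A) {f : Option S → ℝ} {v b x : ℝ}
    (hv : wvar (M.prob s a) f ≤ v) (hb : ∀ y, |f y - wmean (M.prob s a) f| ≤ b) (hb0 : 0 < b)
    (hx : 0 ≤ x) :
    μ {ω | max (2 * √(v * x)) (2 * b * x) <
        |wmean (empP (counter (fun t s a => X t s a ω) k n) s a) f - wmean (M.prob s a) f|} ≤
      ENNReal.ofReal (2 * Real.exp (-(x * n))) := by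
  simp only [wmean_empP_counter _ _ hn]
  refine bernstein_abs (Z := fun j => X (k + j) s a) (fun j => hX.1 _ _ _) (M.isWeight_prob s a)
    (fun j y => ?_) ?_ hn hv hb hb0 hx
  · rw [Measure.real, hX.2.1]; rfl
  · exact hX.2.2.precomp (g := fun j : ℕ => (k + j, s, a)) fun i j h => by simpa using h

theorem IsGenerativeModel.measure_exists_deviation_le (hX : M.IsGenerativeModel μ X) (k : ℕ)
    {n : ℕ} (hn : 0 < n) {J : Type*} [Fintype J] {f : J → S → A → Option S → ℝ}
    {v b : J → S → A → ℝ} {x : ℝ}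
    (hv : ∀ j s a, wvar (M.prob s a) (f j s a) ≤ v j s a)
    (hb : ∀ j s a y, |f j s a y - wmean (M.prob s a) (f j s a)| ≤ b j s a)
    (hb0 : ∀ j s a, 0 < b j s a) (hx : 0 ≤ x) :
    μ {ω | ∃ q : J × S × A, max (2 * √(v q.1 q.2.1 q.2.2 * x)) (2 * b q.1 q.2.1 q.2.2 * x) <
        |wmean (empP (counter (fun t s a => X t s a ω) k n) q.2.1 q.2.2) (f q.1 q.2.1 q.2.2)
          - wmean (M.prob q.2.1 q.2.2) (f q.1 q.2.1 q.2.2)|} ≤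
      ENNReal.ofReal (Fintype.card J * Fintype.card S * Fintype.card A *
        (2 * Real.exp (-(x * n)))) := by
  rw [Set.ofPred_exists]
  refine (measure_iUnion_fintype_le μ _).trans ((Finset.sum_le_sum fun q _ =>
    hX.measure_deviation_le k hn q.2.1 q.2.2 (hv _ _ _) (hb _ _ _) (hb0 _ _ _) hx).trans ?_)
  rw [Finset.sum_const, nsmul_eq_mul, Finset.card_univ, Fintype.card_prod, Fintype.card_prod,
    ← mul_assoc, ← ENNReal.ofReal_natCast, ← ENNReal.ofReal_mul (Nat.cast_nonneg _)]
  push_cast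
  exact le_rfl

/-- The estimates that hold with high probability for a batch of samples. -/
structure BatchGood (M : SSP S A) (f : Option S → ℝ) (H : ℕ) (B x : ℝ)
    (N : S → A → Option S → ℕ) : Prop where
  entry : ∀ s a, EntryClose (M.prob s a) (empP N s a) x
  mean : ∀ m < H, ∀ s a, (∀ y, M.optToGo f m y ≤ B) →
    |wmean (empP N s a) (M.optToGo f m) - wmean (M.prob s a) (M.optToGo f m)| ≤
      max (2 * √(wvar (M.prob s a) (M.optToGo f m) * x)) (2 * B * x)
  sq : ∀ m < H, ∀ s a, (∀ y, M.optToGo f m y ≤ B) →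
    |wmean (empP N s a) (fun y => (M.optToGo f m y - wmean (M.prob s a) (M.optToGo f m)) ^ 2) -
      wmean (M.prob s a) (fun y => (M.optToGo f m y - wmean (M.prob s a) (M.optToGo f m)) ^ 2)| ≤
      max (2 * √(B ^ 2 * wvar (M.prob s a) (M.optToGo f m) * x)) (2 * B ^ 2 * x)

theorem IsWeight.abs_sub_mean_le {Y : Type*} [Fintype Y] {p : Y → ℝ} (hp : IsWeight p) {V : Y → ℝ}
    {B : ℝ} (h0 : ∀ y, 0 ≤ V y) (hB : ∀ y, V y ≤ B) (y : Y) : |V y - wmean p V| ≤ B :=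
  abs_le.2 ⟨by linarith [h0 y, hp.mean_le hB], by linarith [hB y, hp.le_mean h0]⟩

theorem IsWeight.var_le_of_le {Y : Type*} [Fintype Y] {p : Y → ℝ} (hp : IsWeight p) {V : Y → ℝ}
    {B : ℝ} (h0 : ∀ y, 0 ≤ V y) (hB : ∀ y, V y ≤ B) : wvar p V ≤ B * wmean p V := by
  rw [hp.var_eq, ← wmean_const_mul]
  have : wmean p (fun y => V y ^ 2) ≤ wmean p (fun y => B * V y) :=
    hp.mean_mono fun y => by nlinarith [h0 y, hB y]
  linarith [sq_nonneg (wmean p V)]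

theorem wmean_ite_eq {Y : Type*} [Fintype Y] [DecidableEq Y] (p : Y → ℝ) (y : Y) :
    wmean p (fun z => if z = y then 1 else 0) = p y := by
  simp [wmean]

theorem IsGenerativeModel.measure_not_batchGood_le [Nonempty A]
    (hX : M.IsGenerativeModel μ X) (k : ℕ)
    {n : ℕ} (hn : 0 < n) {f : Option S → ℝ} (hf : ∀ y, 0 ≤ f y) {B x : ℝ} (hB : 0 < B)
    (hx : 0 ≤ x) (H : ℕ) :
    μ {ω | ¬ M.BatchGood f H B x (counter (fun t s a => X t s a ω) k n)} ≤
      ENNReal.ofReal ((Fintype.card S + 1 + 2 * H) * Fintype.card S * Fintype.card A *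
        (2 * Real.exp (-(x * n)))) := by
  classical
  -- Truncation at `B` makes the range bounds unconditional, and it changes nothing where
  -- `BatchGood` makes a claim. The three families below are the indicators of single states, the
  -- values and their squared deviations.
  set V : ℕ → Option S → ℝ := fun m y => min (M.optToGo f m y) B with hV
  have hV0 : ∀ m y, 0 ≤ V m y := fun m y => le_min (M.optToGo_nonneg hf m y) hB.le
  have hVB : ∀ m y, V m y ≤ B := fun m y => min_le_right _ _
  let F : Option S ⊕ (Fin H ⊕ Fin H) → S → A → Option S → ℝ
    | .inl y, _, _ => fun z => if z = y then 1 else 0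
    | .inr (.inl m), _, _ => V m
    | .inr (.inr m), s, a => fun y => (V m y - wmean (M.prob s a) (V m)) ^ 2
  let v : Option S ⊕ (Fin H ⊕ Fin H) → S → A → ℝ
    | .inl y, s, a => M.prob s a y
    | .inr (.inl m), s, a => wvar (M.prob s a) (V m)
    | .inr (.inr m), s, a => B ^ 2 * wvar (M.prob s a) (V m)
  let b : Option S ⊕ (Fin H ⊕ Fin H) → S → A → ℝ
    | .inl _, _, _ => 1
    | .inr (.inl _), _, _ => B
    | .inr (.inr _), _, _ => B ^ 2
  have hsq : ∀ m s a y, (V m y - wmean (M.prob s a) (V m)) ^ 2 ≤ B ^ 2 := fun m s a y => by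
    have := (M.isWeight_prob s a).abs_sub_mean_le (hV0 m) (hVB m) y
    rw [← sq_abs]
    exact pow_le_pow_left₀ (abs_nonneg _) this 2
  have h01 : ∀ y z : Option S, (0 : ℝ) ≤ if z = y then 1 else 0 := fun y z => by split_ifs <;> simp
  have h11 : ∀ y z : Option S, (if z = y then (1 : ℝ) else 0) ≤ 1 :=
    fun y z => by split_ifs <;> simp
  have key := hX.measure_exists_deviation_le k hn (f := F) (v := v) (b := b) (x := x) ?_ ?_ ?_ hx
  · refine (measure_mono ?_).trans (key.trans (le_of_eq ?_))
    · intro ω hω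
      by_contra hne
      simp only [Set.mem_ofPred_eq, not_exists, not_lt] at hne
      have hcl : ∀ m, (∀ y, M.optToGo f m y ≤ B) → V m = M.optToGo f m := fun m h => by
        funext y; exact min_eq_left (h y)
      refine hω ⟨fun s a y => ?_, fun m hm s a h => ?_, fun m hm s a h => ?_⟩
      · have := hne (.inl y, s, a)
        simpa only [F, v, b, wmean_ite_eq, mul_one] using this
      · have := hne (.inr (.inl ⟨m, hm⟩), s, a)
        simpa only [F, v, b, hcl m h] using this
      · have := hne (.inr (.inr ⟨m, hm⟩), s, a)
        simpa only [F, v, b, hcl m h] using this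
    · simp only [Fintype.card_sum, Fintype.card_option, Fintype.card_fin]
      push_cast
      ring_nf
  · rintro (y | m | m) s a
    · have := (M.isWeight_prob s a).var_le_of_le (h01 y) (h11 y)
      rwa [wmean_ite_eq, one_mul] at this
    · exact le_rfl
    · exact (M.isWeight_prob s a).var_le_of_le (fun y => sq_nonneg _) (hsq m s a)
  · rintro (y | m | m) s a z
    · exact (M.isWeight_prob s a).abs_sub_mean_le (h01 y) (h11 y) z
    · exact (M.isWeight_prob s a).abs_sub_mean_le (hV0 m) (hVB m) z
    · exact (M.isWeight_prob s a).abs_sub_mean_le (fun y => sq_nonneg _) (hsq m s a) z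
  · rintro (y | m | m) s a <;> simp only [b] <;> positivity

theorem iota_counter (x : ℕ → S → A → Option S) (k n H : ℕ) (δ : ℝ) :
    iota (counter x k n) H δ = Real.log (2 * Fintype.card S * Fintype.card A * H *
      (Fintype.card S * (Fintype.card A * n)) / δ) := by
  simp only [iota, visits_counter, Finset.sum_const, Finset.card_univ, smul_eq_mul]
  push_cast
  rfl

/-- A batch is good with high probability. -/
theorem IsGenerativeModel.measure_not_batchGood_iota_le [Nonempty S] [Nonempty A]
    (hX : M.IsGenerativeModel μ X) (k : ℕ) {n : ℕ} (hn : 0 < n) {f : Option S → ℝ}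
    (hf : ∀ y, 0 ≤ f y) {B δ : ℝ} (hB : 0 < B) (hδ : 0 < δ) (hδ1 : δ ≤ 1) {H : ℕ} (hH : 0 < H) :
    μ {ω | ¬ M.BatchGood f H B (iota (counter (fun t s a => X t s a ω) k n) H δ / n)
      (counter (fun t s a => X t s a ω) k n)} ≤ ENNReal.ofReal (4 * δ) := by
  simp only [iota_counter]
  have hS : (1 : ℝ) ≤ Fintype.card S := by exact_mod_cast Fintype.card_pos
  have hA : (1 : ℝ) ≤ Fintype.card A := by exact_mod_cast Fintype.card_pos
  have hn1 : (1 : ℝ) ≤ n := by exact_mod_cast hn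
  have hH1 : (1 : ℝ) ≤ H := by exact_mod_cast hH
  set s : ℝ := (Fintype.card S : ℝ)
  set a : ℝ := (Fintype.card A : ℝ)
  set E : ℝ := 2 * s * a * H * (s * (a * n)) / δ with hE
  have e1 : 1 ≤ a * n := one_le_mul_of_one_le_of_one_le hA hn1
  have e2 : 1 ≤ s * (a * n) := one_le_mul_of_one_le_of_one_le hS e1
  have e3 : 1 ≤ s * a * H :=
    one_le_mul_of_one_le_of_one_le (one_le_mul_of_one_le_of_one_le hS hA) hH1
  have hE1 : 1 ≤ E := by
    rw [hE, le_div_iff₀ hδ]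
    nlinarith
  have hE0 : 0 < E := by linarith
  have hL := Real.log_nonneg hE1
  refine (hX.measure_not_batchGood_le k hn hf hB (div_nonneg hL (by linarith)) H).trans
    (ENNReal.ofReal_le_ofReal ?_)
  rw [div_mul_cancel₀ _ (by linarith), Real.exp_neg, Real.exp_log hE0, hE]
  -- The exponential of the logarithmic factor cancels the union bound; the remaining ratio is at
  -- most `4`.
  have e4 : (s + 1 + 2 * H) * s * a * (2 * (2 * s * a * H * (s * (a * n)) / δ)⁻¹)
      = (s + 1 + 2 * H) / (H * (s * (a * n))) * δ := by
    field_simp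
  rw [e4]
  refine mul_le_mul_of_nonneg_right ?_ hδ.le
  rw [div_le_iff₀ (by positivity)]
  have e5 : s ≤ s * (a * n) := le_mul_of_one_le_right (by linarith) e1
  have e6 : s * (a * n) ≤ H * (s * (a * n)) := le_mul_of_one_le_left (by linarith) hH1
  have e7 : (H : ℝ) ≤ H * (s * (a * n)) := le_mul_of_one_le_right (by linarith) e2
  linarith

end Batch

/-! ### Batch sizes -/

/-- The logarithmic factor of the bonus is small compared to the batch size. -/
theorem log_div_ceil_le {κ η m E Q : ℝ} (hκ : 1 ≤ κ) (hη : 5 + Real.log (2 * κ) ≤ κ * η)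
    (hm : 1 ≤ m) (hE : 3 ≤ E) (hmE : m ≤ E ^ 2) (hQ : 0 < Q) (hQE : Q ≤ E ^ 2) :
    Real.log (Q * ⌈κ * m * Real.log E⌉₊) / ⌈κ * m * Real.log E⌉₊ * m ≤ η := by
  have hE0 : 0 < E := by linarith
  have hl1 : 1 ≤ Real.log E := by
    rw [Real.le_log_iff_exp_le hE0]
    linarith [Real.exp_one_lt_d9]
  set l := Real.log E with hl
  have hlE : l ≤ E := (Real.log_le_sub_one_of_pos hE0).trans (by linarith)
  have hκm : 1 ≤ κ * m := one_le_mul_of_one_le_of_one_le hκ hm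
  have hκml : 1 ≤ κ * m * l := one_le_mul_of_one_le_of_one_le hκm hl1
  set N : ℝ := (⌈κ * m * l⌉₊ : ℝ) with hN
  have hN1 : κ * m * l ≤ N := Nat.le_ceil _
  have hN2 : N ≤ 2 * (κ * m * l) := by
    have := (Nat.ceil_lt_add_one (by linarith : 0 ≤ κ * m * l)).le
    linarith
  have hN0 : 0 < N := by linarith
  have hlE2 : Real.log (E ^ 2 * E) = 3 * l := by
    rw [← pow_succ, Real.log_pow]; push_cast; ring
  -- The batch size enters its own logarithm, but `N ≤ 2κE³` and `Q ≤ E²`, so only a multiple of `l`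
  -- and a constant arise; `N ≥ κ * m * l` then cancels `l`.
  have hlogN : Real.log (Q * N) ≤ 5 * l + Real.log (2 * κ) := by
    have h1 : Q * N ≤ E ^ 2 * (2 * κ * (E ^ 2 * E)) := by
      have : N ≤ 2 * κ * (E ^ 2 * E) := by
        refine hN2.trans ?_
        rw [show 2 * (κ * m * l) = 2 * κ * (m * l) by ring]
        gcongr
      gcongr
    have h2 := Real.log_le_log (by positivity) h1
    rw [Real.log_mul (by positivity) (by positivity), Real.log_mul (by positivity) (by positivity),
      Real.log_mul (by positivity) (by positivity), hlE2, Real.log_pow] at h2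
    rw [Real.log_mul (by positivity) (by positivity)]
    push_cast at h2
    linarith
  have hlog0 : 0 ≤ Real.log (2 * κ) := Real.log_nonneg (by linarith)
  have h3 : Real.log (Q * N) ≤ κ * η * l := by
    refine hlogN.trans (le_trans ?_ (mul_le_mul_of_nonneg_right hη (by linarith)))
    nlinarith
  rw [div_mul_eq_mul_div, div_le_iff₀ hN0]
  have hη0 : 0 ≤ η := by
    by_contra! hneg
    nlinarith
  calc Real.log (Q * N) * m ≤ κ * η * l * m := mul_le_mul_of_nonneg_right h3 (by linarith)
    _ = η * (κ * m * l) := by ring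
    _ ≤ η * N := mul_le_mul_of_nonneg_left hN1 hη0

/-- The constant in the batch sizes. -/
noncomputable def batchConst : ℝ := 2 ^ 34

/-- The hypotheses of `log_div_ceil_le` with `η = 10⁻⁸`. There is ample room, as the left side of
the second one is below `30` and its right side above `170`. -/
theorem batchConst_spec : 1 ≤ batchConst ∧ 5 + Real.log (2 * batchConst) ≤ batchConst * (1 / 10 ^ 8) := by
  constructor
  · norm_num [batchConst]
  · have : (2 : ℝ) * batchConst = 2 ^ 35 := by norm_num [batchConst]
    rw [this, Real.log_pow]
    have := Real.log_two_lt_d9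
    norm_num [batchConst]
    linarith

/-- The hypotheses of `log_div_ceil_le` for the fine batch, in the dimensionless quantities `r = B /
ε` and `D = 1 / δ_i`; the common expression `4 * (s * a * H) * r * D` is the argument of the
logarithm in the batch size. -/
theorem fine_arith {s a H r D : ℝ} (hs : 1 ≤ s) (ha : 1 ≤ a) (hH : 1 ≤ H) (hr : 2 ≤ r)
    (hD : 1 ≤ D) : 3 ≤ 4 * (s * a * H) * r * D ∧
      1 ≤ 4 * r ^ 2 * H + 2 * s * r * H + s * H ^ 2 ∧
      4 * r ^ 2 * H + 2 * s * r * H + s * H ^ 2 ≤ (4 * (s * a * H) * r * D) ^ 2 ∧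
      2 * s * a * H * (s * a) * D ≤ (4 * (s * a * H) * r * D) ^ 2 := by
  have hsa : 1 ≤ s * a := one_le_mul_of_one_le_of_one_le hs ha
  have hsaH : 1 ≤ s * a * H := one_le_mul_of_one_le_of_one_le hsa hH
  have hsH2 : 1 ≤ s * H ^ 2 := one_le_mul_of_one_le_of_one_le hs (one_le_pow₀ hH)
  have hE : 4 * (s * a * H) * r ≤ 4 * (s * a * H) * r * D :=
    le_mul_of_one_le_right (by positivity) hD
  have hr1 : 1 ≤ r ^ 2 := one_le_pow₀ (by linarith)
  have h1 : H ≤ (s * a * H) ^ 2 := by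
    calc H = 1 * H := (one_mul H).symm
      _ ≤ s * a * H := by gcongr
      _ ≤ (s * a * H) ^ 2 := by rw [sq]; exact le_mul_of_one_le_right (by positivity) hsaH
  have h2 : s * H ^ 2 ≤ (s * a * H) ^ 2 := by
    calc s * H ^ 2 = s * 1 * H ^ 2 := by ring
      _ ≤ s * (s * a * a) * H ^ 2 := by
          gcongr
          exact one_le_mul_of_one_le_of_one_le hsa ha
      _ = (s * a * H) ^ 2 := by ring
  have h3 : s * H ≤ (s * a * H) ^ 2 := by
    refine le_trans ?_ h2
    have : H ≤ H ^ 2 := by rw [sq]; exact le_mul_of_one_le_right (by linarith) hH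
    gcongr
  refine ⟨?_, ?_, ?_, ?_⟩
  · refine le_trans ?_ hE
    nlinarith
  · have : 0 ≤ 4 * r ^ 2 * H + 2 * s * r * H := by positivity
    linarith
  · have e1 : 4 * r ^ 2 * H ≤ 4 * r ^ 2 * (s * a * H) ^ 2 := by gcongr
    have e2 : 2 * s * r * H ≤ r ^ 2 * (s * a * H) ^ 2 := by
      calc 2 * s * r * H = (2 * r) * (s * H) := by ring
        _ ≤ r ^ 2 * (s * a * H) ^ 2 := by gcongr; nlinarith
    have e3 : s * H ^ 2 ≤ r ^ 2 * (s * a * H) ^ 2 :=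
      h2.trans (le_mul_of_one_le_left (by positivity) hr1)
    calc _ ≤ 6 * (r ^ 2 * (s * a * H) ^ 2) := by linarith
      _ ≤ 16 * (r ^ 2 * (s * a * H) ^ 2) := by gcongr; norm_num
      _ = (4 * (s * a * H) * r) ^ 2 := by ring
      _ ≤ _ := pow_le_pow_left₀ (by positivity) hE 2
  · have e1 : s * a ≤ s * a * H := le_mul_of_one_le_right (by positivity) hH
    calc 2 * s * a * H * (s * a) * D = 2 * (s * a * H) * (s * a) * D * 1 := by ring
      _ ≤ 2 * (s * a * H) * (s * a * H) * D * (r ^ 2 * D) := by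
          gcongr; exact one_le_mul_of_one_le_of_one_le hr1 hD
      _ ≤ 16 * (s * a * H) * (s * a * H) * D * (r ^ 2 * D) := by gcongr; norm_num
      _ = _ := by ring

theorem one_le_log_arg {s a H d N : ℝ} (hs : 1 ≤ s) (ha : 1 ≤ a) (hH : 1 ≤ H) (hd : 0 < d)
    (hd1 : d ≤ 1) (hN : 1 ≤ N) : 1 ≤ 2 * s * a * H * (s * a) / d * N := by
  have hsa : 1 ≤ s * a := one_le_mul_of_one_le_of_one_le hs ha
  have h2 := one_le_mul_of_one_le_of_one_le (one_le_mul_of_one_le_of_one_le hsa hH) hsa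
  refine one_le_mul_of_one_le_of_one_le ?_ hN
  rw [le_div_iff₀ hd]
  linarith

/-! ### Parameters of one iteration and smallness of its error terms. -/

section Iteration

variable {S A : Type*} [Fintype S] [Fintype A] [Nonempty S] [Nonempty A]

theorem two_le_Bi {i : ℕ} (hi : 1 ≤ i) : 2 ≤ Bi i := by
  calc (2 : ℝ) = 2 ^ 1 := by norm_num
    _ ≤ 2 ^ i := pow_le_pow_right₀ (by norm_num) hi

theorem deltai_pos {δ : ℝ} (hδ : 0 < δ) {i : ℕ} (hi : 1 ≤ i) : 0 < deltai δ i := by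
  have : (0 : ℝ) < i := by exact_mod_cast hi
  unfold deltai; positivity

theorem deltai_le_one {δ : ℝ} (hδ1 : δ ≤ 1) {i : ℕ} (hi : 1 ≤ i) : deltai δ i ≤ 1 := by
  have : (1 : ℝ) ≤ (i : ℝ) ^ 2 := one_le_pow₀ (by exact_mod_cast hi)
  unfold deltai
  rw [div_le_one (by positivity)]
  linarith

variable (M : SSP S A)

theorem cmin_le (s : S) (a : A) : M.cmin ≤ M.c s a :=
  ciInf_le (f := fun p : S × A => M.c p.1 p.2) (Set.finite_range _).bddBelow (s, a)

theorem cmin_nonneg : 0 ≤ M.cmin := le_ciInf fun p => M.c_nonneg p.1 p.2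

theorem cmin_le_one : M.cmin ≤ 1 :=
  (M.cmin_le (Classical.arbitrary S) (Classical.arbitrary A)).trans (M.c_le_one _ _)

/-- `min {B_i / c_min, T}` -/
noncomputable def Ri (T : ℝ) (i : ℕ) : ℝ := if M.cmin = 0 then T else min (Bi i / M.cmin) T

theorem one_le_Ri {T : ℝ} (hT : 1 ≤ T) {i : ℕ} (hi : 1 ≤ i) : 1 ≤ M.Ri T i := by
  unfold Ri
  split_ifs with h
  · exact hT
  · refine le_min ?_ hT
    have h0 : 0 < M.cmin := lt_of_le_of_ne M.cmin_nonneg (Ne.symm h)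
    rw [le_div_iff₀ h0]
    linarith [two_le_Bi hi, M.cmin_le_one]

theorem Ri_le (T : ℝ) (i : ℕ) : M.Ri T i ≤ T := by
  unfold Ri
  split_ifs
  · exact le_rfl
  · exact min_le_right _ _

theorem one_le_log {ε : ℝ} (hε : 0 < ε) (hε1 : ε ≤ 1) {i : ℕ} (hi : 1 ≤ i) :
    1 ≤ Real.log (48 * Bi i / ε) := by
  have h2 := two_le_Bi hi
  have h3 : 3 ≤ 48 * Bi i / ε := by rw [le_div_iff₀ hε]; linarith
  rw [Real.le_log_iff_exp_le (by linarith)]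
  linarith [Real.exp_one_lt_d9]

theorem le_Hi (T ε : ℝ) (i : ℕ) : 4 * M.Ri T i * Real.log (48 * Bi i / ε) ≤ M.Hi T ε i :=
  Nat.le_ceil _

variable {T ε δ : ℝ} (hT : 1 ≤ T) (hε : 0 < ε) (hε1 : ε ≤ 1) (hδ : 0 < δ) (hδ1 : δ ≤ 1)
  {i : ℕ} (hi : 1 ≤ i)

include hT hε hε1 hi in
theorem one_le_Hi : (1 : ℝ) ≤ M.Hi T ε i := by
  have h1 := M.le_Hi T ε i
  have := one_le_mul_of_one_le_of_one_le (M.one_le_Ri hT hi) (one_le_log hε hε1 hi)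
  linarith

theorem cfi_eq (i : ℕ) : (cfi i : Option S → ℝ) = onStates fun _ => 0.6 * Bi i := by
  funext y; cases y <;> rfl

include hi in
theorem cfi_nonneg (y : Option S) : 0 ≤ cfi i y := by
  have := two_le_Bi hi
  cases y
  · exact le_rfl
  · simp only [cfi]; linarith

-- The constant `48` in the horizon serves this purpose: the terminal cost times the probability of
-- missing the goal is a small fraction of `ε`.
include hε hi in
theorem cfi_mul_exp : 0.6 * Bi i * Real.exp (-Real.log (48 * Bi i / ε)) = ε / 80 := by
  have := two_le_Bi hi
  rw [Real.exp_neg, Real.exp_log (by positivity)]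
  field_simp
  norm_num

theorem card_option_le : (Fintype.card (Option S) : ℝ) ≤ 2 * Fintype.card S := by
  have hS : (1 : ℝ) ≤ Fintype.card S := by exact_mod_cast Fintype.card_pos
  rw [Fintype.card_option]; push_cast; linarith

-- At accuracy `0.1 * Bi i` the scale `Bi i` cancels, and the polynomial in the batch size becomes
-- `110 * S * H`.
include hT hε hε1 hδ hδ1 hi in
theorem searchN_spec (x : ℕ → S → A → Option S) (k : ℕ) :
    0 < M.searchN batchConst T ε δ i ∧
    0 ≤ iota (counter x k (M.searchN batchConst T ε δ i)) (M.Hi T ε i) (deltai δ i)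
      / M.searchN batchConst T ε δ i ∧
    Fintype.card (Option S) * M.Hi T ε i *
      (iota (counter x k (M.searchN batchConst T ε δ i)) (M.Hi T ε i) (deltai δ i)
        / M.searchN batchConst T ε δ i) ≤ 1 / 1000000 := by
  have hB := two_le_Bi hi
  have hH := M.one_le_Hi hT hε hε1 hi
  have hS : (1 : ℝ) ≤ Fintype.card S := by exact_mod_cast Fintype.card_pos
  have hA : (1 : ℝ) ≤ Fintype.card A := by exact_mod_cast Fintype.card_pos
  have hd := deltai_pos hδ hi
  have hd1 := deltai_le_one hδ1 hi
  have hcard := card_option_le (S := S)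
  rw [iota_counter]
  set s : ℝ := (Fintype.card S : ℝ)
  set a : ℝ := (Fintype.card A : ℝ)
  set H : ℝ := (M.Hi T ε i : ℝ)
  set d := deltai δ i
  set E : ℝ := 20 * s * a * H / d with hE
  have hsH : 1 ≤ s * H := one_le_mul_of_one_le_of_one_le hS hH
  have hsaH : 1 ≤ s * a * H :=
    one_le_mul_of_one_le_of_one_le (one_le_mul_of_one_le_of_one_le hS hA) hH
  have hN : M.searchN batchConst T ε δ i = ⌈batchConst * (110 * s * H) * Real.log E⌉₊ := by
    rw [show M.searchN batchConst T ε δ i = ⌈batchConst * (Bi i ^ 2 * s * H / (0.1 * Bi i) ^ 2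
      + s * Bi i * H / (0.1 * Bi i)) * Real.log (2 * s * a * Bi i * H / (0.1 * Bi i * d))⌉₊ from rfl]
    have e1 : Bi i ^ 2 * s * H / (0.1 * Bi i) ^ 2 + s * Bi i * H / (0.1 * Bi i) = 110 * s * H := by
      field_simp; norm_num
    have e2 : 2 * s * a * Bi i * H / (0.1 * Bi i * d) = E := by
      rw [hE]; field_simp; norm_num
    rw [e1, e2]
  have hE20 : 20 * (s * a * H) ≤ E := by
    rw [hE, le_div_iff₀ hd]
    nlinarith
  have hm1 : 1 ≤ 110 * s * H := by linarith
  have hmE : 110 * s * H ≤ E ^ 2 := by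
    have h1 : s * H ≤ s * a * H := by nlinarith
    nlinarith
  have hQE : 2 * s * a * H * (s * a) / d ≤ E ^ 2 := by
    have h1 : E ^ 2 = (20 * (s * a * H) * 20) * (s * a * H / d) * (1 / d) := by
      rw [hE]; field_simp
    have h2 : 2 * s * a * H * (s * a) / d = (2 * (s * a)) * (s * a * H / d) * 1 := by field_simp
    rw [h1, h2]
    have h3 : 1 ≤ 1 / d := by rw [le_div_iff₀ hd]; linarith
    have h4 : s * a ≤ s * a * H := le_mul_of_one_le_right (by positivity) hH
    have h5 : 2 * (s * a) ≤ 20 * (s * a * H) * 20 := by linarith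
    gcongr
  have hpos : 0 < M.searchN batchConst T ε δ i := by
    rw [hN, Nat.ceil_pos]
    have : 0 < Real.log E := Real.log_pos (by linarith)
    have := batchConst_spec.1
    positivity
  have key := log_div_ceil_le batchConst_spec.1 batchConst_spec.2 hm1 (by linarith) hmE
    (by positivity) hQE
  rw [← hN] at key
  set N : ℝ := (M.searchN batchConst T ε δ i : ℝ) with hNdef
  have hN1 : 1 ≤ N := Nat.one_le_cast.2 hpos
  have hrw : 2 * s * a * H * (s * (a * N)) / d = 2 * s * a * H * (s * a) / d * N := by ring
  rw [hrw]
  have hx0 : 0 ≤ Real.log (2 * s * a * H * (s * a) / d * N) / N :=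
     div_nonneg (Real.log_nonneg (one_le_log_arg hS hA hH hd hd1 hN1)) (by linarith)
  refine ⟨hpos, hx0, ?_⟩
  set x := Real.log (2 * s * a * H * (s * a) / d * N) / N
  have : (Fintype.card (Option S) : ℝ) * H * x ≤ 2 * s * H * x := by gcongr
  nlinarith

include hT hε hε1 hδ hδ1 hi in
theorem finalN_spec (x : ℕ → S → A → Option S) (k : ℕ) :
    0 < M.finalN batchConst T ε δ i ∧
    0 ≤ iota (counter x k (M.finalN batchConst T ε δ i)) (M.Hi T ε i) (deltai δ i)
      / M.finalN batchConst T ε δ i ∧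
    Fintype.card (Option S) * M.Hi T ε i *
      (iota (counter x k (M.finalN batchConst T ε δ i)) (M.Hi T ε i) (deltai δ i)
        / M.finalN batchConst T ε δ i) ≤ 1 / 1000000 ∧
    Bi i ^ 2 * M.Hi T ε i *
      (iota (counter x k (M.finalN batchConst T ε δ i)) (M.Hi T ε i) (deltai δ i)
        / M.finalN batchConst T ε δ i) ≤ ε ^ 2 / 1000000 ∧
    Fintype.card (Option S) * Bi i * M.Hi T ε i *
      (iota (counter x k (M.finalN batchConst T ε δ i)) (M.Hi T ε i) (deltai δ i)
        / M.finalN batchConst T ε δ i) ≤ ε / 1000000 := by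
  have hB := two_le_Bi hi
  have hH := M.one_le_Hi hT hε hε1 hi
  have hS : (1 : ℝ) ≤ Fintype.card S := by exact_mod_cast Fintype.card_pos
  have hA : (1 : ℝ) ≤ Fintype.card A := by exact_mod_cast Fintype.card_pos
  have hd := deltai_pos hδ hi
  have hd1 := deltai_le_one hδ1 hi
  have hcard := card_option_le (S := S)
  rw [iota_counter]
  set s : ℝ := (Fintype.card S : ℝ)
  set a : ℝ := (Fintype.card A : ℝ)
  set H : ℝ := (M.Hi T ε i : ℝ)
  set d := deltai δ i
  set B := Bi i
  set E : ℝ := 2 * s * a * B * H / (ε / 2 * d) with hE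
  set m : ℝ := B ^ 2 * H / (ε / 2) ^ 2 + s * B * H / (ε / 2) + s * H ^ 2 with hm
  have hsaH : 1 ≤ s * a * H :=
    one_le_mul_of_one_le_of_one_le (one_le_mul_of_one_le_of_one_le hS hA) hH
  have hN : M.finalN batchConst T ε δ i = ⌈batchConst * m * Real.log E⌉₊ := rfl
  set r : ℝ := B / ε with hr
  have hr2 : 2 ≤ r := by rw [hr, le_div_iff₀ hε]; nlinarith
  have hEr : E = 4 * (s * a * H) * r * (1 / d) := by rw [hE, hr]; field_simp; norm_num
  have h1d : 1 ≤ 1 / d := by rw [le_div_iff₀ hd]; linarith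
  have hmr : m = 4 * r ^ 2 * H + 2 * s * r * H + s * H ^ 2 := by
    rw [hm, hr]; field_simp; ring
  obtain ⟨hE3, hm1, hmE, hQE⟩ := fine_arith hS hA hH hr2 h1d
  rw [← hEr, ← hmr] at hmE
  rw [← hEr] at hE3 hQE
  rw [← hmr] at hm1
  rw [mul_one_div] at hQE
  have hpos : 0 < M.finalN batchConst T ε δ i := by
    rw [hN, Nat.ceil_pos]
    have : 0 < Real.log E := Real.log_pos (by linarith)
    have := batchConst_spec.1
    positivity
  have key := log_div_ceil_le batchConst_spec.1 batchConst_spec.2 hm1 hE3 hmE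
    (by positivity) hQE
  rw [← hN] at key
  set N : ℝ := (M.finalN batchConst T ε δ i : ℝ) with hNdef
  have hN1 : 1 ≤ N := Nat.one_le_cast.2 hpos
  have hrw : 2 * s * a * H * (s * (a * N)) / d = 2 * s * a * H * (s * a) / d * N := by ring
  rw [hrw]
  have hx0 : 0 ≤ Real.log (2 * s * a * H * (s * a) / d * N) / N :=
     div_nonneg (Real.log_nonneg (one_le_log_arg hS hA hH hd hd1 hN1)) (by linarith)
  refine ⟨hpos, hx0, ?_⟩
  clear_value E m
  generalize Real.log (2 * s * a * H * (s * a) / d * N) / N = x at *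
  have t1 : 0 ≤ 4 * r ^ 2 * H * x := by positivity
  have t2 : 0 ≤ 2 * s * r * H * x := by positivity
  have t3 : 0 ≤ s * H ^ 2 * x := by positivity
  -- In this order, the three summands of the batch size yield the second, the third and the first
  -- of the claimed bounds.
  have hsum : 4 * r ^ 2 * H * x + 2 * s * r * H * x + s * H ^ 2 * x ≤ 1 / 10 ^ 8 := by
    rw [hmr] at key; linarith
  have hBr : B = r * ε := by rw [hr]; field_simp
  refine ⟨?_, ?_, ?_⟩
  · have h1 : (Fintype.card (Option S) : ℝ) * H * x ≤ 2 * s * H * x := by gcongr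
    have h2 : s * H * x ≤ s * H ^ 2 * x := by
      have : H ≤ H ^ 2 := by nlinarith
      gcongr
    linarith
  · rw [hBr]
    have h1 : 4 * r ^ 2 * H * x * ε ^ 2 ≤ 1 / 10 ^ 8 * ε ^ 2 := by
      gcongr; linarith
    rw [show (r * ε) ^ 2 * H * x = r ^ 2 * H * x * ε ^ 2 by ring]
    linarith [sq_nonneg ε]
  · have h1 : (Fintype.card (Option S) : ℝ) * B * H * x ≤ 2 * s * B * H * x := by gcongr
    have h2 : 2 * s * r * H * x * ε ≤ 1 / 10 ^ 8 * ε := by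
      gcongr; linarith
    rw [show 2 * s * B * H * x = 2 * s * r * H * x * ε by rw [hBr]; ring] at h1
    linarith

end Iteration

/-! ### One iteration of Search Horizon -/

section Iteration

variable {S A : Type*} [Fintype S] [Fintype A] [Nonempty S] [Nonempty A] (M : SSP S A)

theorem optToGo_mono_terminal {f g : Option S → ℝ} (h : ∀ y, f y ≤ g y) (m : ℕ) (y : Option S) :
    M.optToGo f m y ≤ M.optToGo g m y := by
  induction m generalizing y with
  | zero => exact h y
  | succ m ih =>
    cases y with
    | none => exact le_rfl
    | some s =>
      refine le_ciInf fun a => (M.optToGo_succ_le _ m s a).trans ?_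
      exact add_le_add le_rfl ((M.isWeight_prob s a).mean_mono ih)

theorem BatchGood.abs_le_bonus {f : Option S → ℝ} {H n : ℕ} {B x : ℝ} {N : S → A → Option S → ℕ}
    (h : M.BatchGood f H B x N) (hN : ∀ s a, visits N s a = n) (hn : 0 < n) (hx : 0 ≤ x)
    (hB : 0 ≤ B) (hf : ∀ y, 0 ≤ f y) (hVB : ∀ m ≤ H, ∀ y, M.optToGo f m y ≤ B)
    {m : ℕ} (hm : m < H) (s : S) (a : A) :
    |wmean (empP N s a) (M.optToGo f m) - wmean (M.prob s a) (M.optToGo f m)|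
      ≤ wbonus (empP N s a) B x (M.optToGo f m) :=
  abs_mean_sub_le_bonus (M.isWeight_prob s a) (isWeight_empP hN hn s a) hx
    (M.optToGo_nonneg hf m) (hVB m hm.le) hB (h.mean m hm s a (hVB m hm.le))
    (h.sq m hm s a (hVB m hm.le))

variable {T ε δ : ℝ} (hT : 1 ≤ T) (hε : 0 < ε) (hε1 : ε ≤ 1) (hδ : 0 < δ) (hδ1 : δ ≤ 1)
  {i : ℕ} (hi : 1 ≤ i) {x : ℕ → S → A → Option S} {k : ℕ}

/-- The coarse estimates of iteration `i` are accurate. -/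
def SearchGood (M : SSP S A) (T ε δ : ℝ) (x : ℕ → S → A → Option S) (i k : ℕ) : Prop :=
  M.BatchGood (cfi i) (M.Hi T ε i) (Bi i)
    (iota (counter x k (M.searchN batchConst T ε δ i)) (M.Hi T ε i) (deltai δ i)
      / M.searchN batchConst T ε δ i) (counter x k (M.searchN batchConst T ε δ i))

/-- The fine estimates of iteration `i` are accurate. -/
def FinalGood (M : SSP S A) (T ε δ : ℝ) (x : ℕ → S → A → Option S) (i k : ℕ) : Prop :=
  M.BatchGood (cfi i) (M.Hi T ε i) (Bi i)
    (iota (counter x k (M.finalN batchConst T ε δ i)) (M.Hi T ε i) (deltai δ i)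
      / M.finalN batchConst T ε δ i) (counter x k (M.finalN batchConst T ε δ i))

/-- The stopping test of iteration `i`. -/
def Stops (M : SSP S A) (T ε δ : ℝ) (x : ℕ → S → A → Option S) (i k : ℕ) : Prop :=
  StopTest (M.Hi T ε i) i (M.lcbviV (M.Hi T ε i) (counter x k (M.searchN batchConst T ε δ i))
    (Bi i) (cfi i) (deltai δ i))

/-- The estimates are nonnegative, so the absolute values disappear, and stage `h` is the one with
`H + 1 - h` stages to go. -/
theorem stopTest_iff {H i : ℕ} {N : S → A → Option S → ℕ} {δ' : ℝ} (hi : 1 ≤ i) :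
    StopTest H i (M.lcbviV H N (Bi i) (cfi i) δ') ↔
      (∀ y, M.lcbviToGo H N (Bi i) (cfi i) δ' H y ≤ 0.1 * Bi i) ∧
      ∀ m ≤ H, ∀ y, M.lcbviToGo H N (Bi i) (cfi i) δ' m y ≤ 0.7 * Bi i := by
  have habs : ∀ m y, |M.lcbviToGo H N (Bi i) (cfi i) δ' m y| =
      M.lcbviToGo H N (Bi i) (cfi i) δ' m y := fun m y =>
    abs_of_nonneg (M.lcbviToGo_nonneg (cfi_nonneg hi) m y)
  simp only [StopTest, lcbviV, habs, Finset.mem_Icc, Nat.add_sub_cancel]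
  refine and_congr Iff.rfl ⟨fun h m hm y => ?_, fun h m hm y => h _ (by omega) y⟩
  have := h (H + 1 - m) ⟨by omega, by omega⟩ y
  rwa [show H + 1 - (H + 1 - m) = m by omega] at this

include hT hε hε1 hδ hδ1 hi

/-- Soundness of the test. Only the entrywise estimates may be used: the others presuppose a bound
on `optToGo`, which is known only as a consequence of this lemma. -/
theorem optToGo_le_of_stops (hg : M.SearchGood T ε δ x i k) (hs : M.Stops T ε δ x i k)
    (y : Option S) : M.optToGo (cfi i) (M.Hi T ε i) y ≤ 0.2 * Bi i := by
  have hB := two_le_Bi hi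
  obtain ⟨h1, h2⟩ := (M.stopTest_iff hi).1 hs
  obtain ⟨hn, hx, hsm⟩ := M.searchN_spec hT hε hε1 hδ hδ1 hi x k
  exact (M.optToGo_le_detToGo _ _ _ y).trans
    (M.detToGo_le_of_lcbviToGo_le (visits_counter x k _) hn (by linarith) hx (cfi_nonneg hi)
      (fun m hm y => (h2 m hm y).trans (by linarith)) hg.entry hsm h1 y)

theorem optToGo_zero_le_of_stops (hg : M.SearchGood T ε δ x i k) (hs : M.Stops T ε δ x i k)
    {m : ℕ} (hm : m ≤ M.Hi T ε i) (y : Option S) :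
    M.optToGo (fun _ => 0) m y ≤ 0.2 * Bi i :=
  (M.optToGo_zero_mono hm y).trans ((M.optToGo_mono_terminal (cfi_nonneg hi) _ y).trans
    (M.optToGo_le_of_stops hT hε hε1 hδ hδ1 hi hg hs y))

/-- After a passed test, `optToGo` is at most `0.2 B_i + 0.6 B_i` at every stage, so the whole fine
analysis applies. The cost of a period is then below the terminal cost `0.6 B_i`, which is what
allows the periodic repetition. -/
theorem value_le_of_stops (hg : M.SearchGood T ε δ x i k) (hs : M.Stops T ε δ x i k) {k' : ℕ}
    (hg' : M.FinalGood T ε δ x i k') (s : S) :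
    M.value (ofDet (extend (M.Hi T ε i) (M.lcbviPi (M.Hi T ε i)
      (counter x k' (M.finalN batchConst T ε δ i)) (Bi i) (cfi i) (deltai δ i)))) s ≤
      ENNReal.ofReal (M.optToGo (cfi i) (M.Hi T ε i) (some s) + ε / 2) := by
  have hB := two_le_Bi hi
  have hH := M.one_le_Hi hT hε hε1 hi
  have hH0 : 0 < M.Hi T ε i := by
    have : (0 : ℝ) < M.Hi T ε i := by linarith
    exact_mod_cast this
  have hf : ∀ y : Option S, 0 ≤ cfi i y := cfi_nonneg hi
  have hVB : ∀ m ≤ M.Hi T ε i, ∀ y, M.optToGo (cfi i) m y ≤ Bi i := by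
    intro m hm y
    have h1 := optToGo_le_add (M := M) (M' := M) rfl (fun _ _ => le_rfl)
      (by linarith : 0 ≤ 0.6 * Bi i) m y
    rw [← cfi_eq] at h1
    linarith [M.optToGo_zero_le_of_stops hT hε hε1 hδ hδ1 hi hg hs hm y]
  obtain ⟨hn, hx, h1, h2, h3⟩ := M.finalN_spec hT hε hε1 hδ hδ1 hi x k'
  have hN := visits_counter x k' (M.finalN batchConst T ε δ i)
  have key := fun y => M.detToGo_le_add hN hn (by linarith) hx hf hε hε1 hVB
    (fun m hm y => M.lcbviToGo_le_optToGo hN hn (by linarith) hx hf hVB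
      (fun m hm s a => hg'.abs_le_bonus M hN hn hx (by linarith) hf hVB hm s a) hm y)
    (fun m hm s a => hg'.mean m hm s a (hVB m hm.le)) hg'.entry h1 h2 h3 y
  refine (M.value_periodic_le _ hH0 hf rfl (fun t s => M.lcbviPi_eq _ _ _ _ _ _ s) ?_ s).trans
    (ENNReal.ofReal_le_ofReal (key (some s)))
  intro y
  cases y with
  | none =>
    obtain ⟨h, hh⟩ := Nat.exists_eq_succ_of_ne_zero hH0.ne'
    rw [hh]; exact le_rfl
  | some s =>
    refine (key (some s)).trans ?_
    have := M.optToGo_le_of_stops hT hε hε1 hδ hδ1 hi hg hs (some s)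
    simp only [cfi]
    linarith

-- The goal is missed rarely for one of two reasons. If the horizon is based on `T`, the competitor
-- `π` itself is fast. If it is based on `B_i / c_min`, a policy optimal for terminal cost zero is
-- fast, since each step costs at least `c_min` and its total is at most `B_i`.
omit hδ hδ1 in
theorem optToGo_le_value_add (hU : M.Ri T i = T ∨ ∀ y, M.optToGo (fun _ => 0) (M.Hi T ε i) y ≤ Bi i)
    (π : S → PMF A) (hπ : ∀ s, M.hitTime (stationary π) s ≤ ENNReal.ofReal T) (s : S) :
    ENNReal.ofReal (M.optToGo (cfi i) (M.Hi T ε i) (some s)) ≤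
      M.value (stationary π) s + ENNReal.ofReal (ε / 80) := by
  have hB := two_le_Bi hi
  have hL := one_le_log hε hε1 hi
  have hH := M.le_Hi T ε i
  have hR := M.one_le_Ri hT hi
  have hb : 0 ≤ 0.6 * Bi i := by linarith
  rw [cfi_eq, ← cfi_mul_exp hε hi]
  by_cases hRT : M.Ri T i = T
  · rw [hRT] at hH
    exact M.optToGo_le_value_add_exp π hT hL hb hH hπ s
  have hc0 : M.cmin ≠ 0 := fun h => hRT (by simp [Ri, h])
  have hc : 0 < M.cmin := lt_of_le_of_ne M.cmin_nonneg (Ne.symm hc0)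
  have hRc : M.Ri T i = Bi i / M.cmin := by
    unfold Ri at hRT ⊢
    rw [if_neg hc0] at hRT ⊢
    exact (min_choice _ _).resolve_right hRT
  have h1 := optToGo_le_add_exp (M := M) (M' := M) rfl (fun _ _ => le_rfl) hb hc
    M.cmin_le hR hL hH (fun y => ?_) (some s)
  · refine (ENNReal.ofReal_le_ofReal h1).trans (ENNReal.ofReal_add_le.trans ?_)
    exact add_le_add (M.optToGo_le_value _ _ s) le_rfl
  · rw [hRc, div_mul_cancel₀ _ hc0]
    exact hU.resolve_left hRT y

/-- The output of the algorithm is nearly optimal. -/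
theorem isOptimalT_of_stops (hg : M.SearchGood T ε δ x i k) (hs : M.Stops T ε δ x i k) {k' : ℕ}
    (hg' : M.FinalGood T ε δ x i k') :
    M.IsOptimalT ε T (ofDet (extend (M.Hi T ε i) (M.lcbviPi (M.Hi T ε i)
      (counter x k' (M.finalN batchConst T ε δ i)) (Bi i) (cfi i) (deltai δ i)))) := by
  have hB := two_le_Bi hi
  intro s
  rw [optValueT, ENNReal.iInf_add]
  refine le_iInf fun π => ?_
  rw [ENNReal.iInf_add]
  refine le_iInf fun hπ => ?_
  refine (M.value_le_of_stops hT hε hε1 hδ hδ1 hi hg hs hg' s).trans ?_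
  refine ENNReal.ofReal_add_le.trans ?_
  have h1 := M.optToGo_le_value_add hT hε hε1 hi (Or.inr fun y =>
    (M.optToGo_zero_le_of_stops hT hε hε1 hδ hδ1 hi hg hs le_rfl y).trans (by linarith)) π hπ s
  calc _ ≤ M.value (stationary π) s + ENNReal.ofReal (ε / 80) + ENNReal.ofReal (ε / 2) :=
        add_le_add h1 le_rfl
    _ = M.value (stationary π) s + ENNReal.ofReal (ε / 80 + ε / 2) := by
        rw [add_assoc, ENNReal.ofReal_add (by linarith) (by linarith)]
    _ ≤ _ := by
        gcongr
        linarith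

/-- Completeness of the test: by optimism the estimates lie below `optToGo`, and the thresholds
`0.1` and `0.7` leave room because `B_i ≥ 2`. -/
theorem stops_of_optToGo_le (hg : M.SearchGood T ε δ x i k)
    (h1 : ∀ y, M.optToGo (cfi i) (M.Hi T ε i) y ≤ Bi i / 20 + ε / 80)
    (h2 : ∀ m ≤ M.Hi T ε i, ∀ y, M.optToGo (cfi i) m y ≤ Bi i / 20 + 0.6 * Bi i) :
    M.Stops T ε δ x i k := by
  have hB := two_le_Bi hi
  obtain ⟨hn, hx, -⟩ := M.searchN_spec hT hε hε1 hδ hδ1 hi x k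
  have hN := visits_counter x k (M.searchN batchConst T ε δ i)
  have hVB : ∀ m ≤ M.Hi T ε i, ∀ y, M.optToGo (cfi i) m y ≤ Bi i := fun m hm y =>
    (h2 m hm y).trans (by linarith)
  have hopt := fun m hm y => M.lcbviToGo_le_optToGo hN hn (by linarith) hx (cfi_nonneg hi) hVB
      (fun m hm s a => hg.abs_le_bonus M hN hn hx (by linarith) (cfi_nonneg hi) hVB hm s a)
      (m := m) hm y
  refine (M.stopTest_iff hi).2 ⟨fun y => (hopt _ le_rfl y).trans ((h1 y).trans (by linarith)),
    fun m hm y => (hopt m hm y).trans ((h2 m hm y).trans (by linarith))⟩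

/-- The stopping test is passed if a cheap relaxation with costs bounded below is small. -/
theorem stops_of_relaxation (hg : M.SearchGood T ε δ x i k) {M' : SSP S A} (hP : M'.P = M.P)
    (hc : ∀ s a, M.c s a ≤ M'.c s a) {θ : ℝ} (hθ : 0 < θ) (hθc : ∀ s a, θ ≤ M'.c s a)
    (hU : ∀ y, M'.optToGo (fun _ => 0) (M.Hi T ε i) y ≤ Bi i / 20)
    (hU' : ∀ y, M'.optToGo (fun _ => 0) (M.Hi T ε i) y ≤ M.Ri T i * θ) : M.Stops T ε δ x i k := by
  have hB := two_le_Bi hi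
  have hb : 0 ≤ 0.6 * Bi i := by linarith
  refine M.stops_of_optToGo_le hT hε hε1 hδ hδ1 hi hg (fun y => ?_) (fun m hm y => ?_)
  · have h1 := optToGo_le_add_exp hP hc hb hθ hθc (M.one_le_Ri hT hi) (one_le_log hε hε1 hi)
      (M.le_Hi T ε i) hU' y
    rw [← cfi_eq, cfi_mul_exp hε hi] at h1
    linarith [hU y]
  · have h1 := optToGo_le_add hP hc hb m y
    rw [← cfi_eq] at h1
    linarith [hU y, M'.optToGo_zero_mono hm y]

/-- The relaxation is the instance itself with `θ = c_min`; the horizon is then based on `B_i /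
c_min`. -/
theorem stops_of_Bstar_le (hg : M.SearchGood T ε δ x i k)
    (hB : M.Bstar ≤ ENNReal.ofReal (Bi i / 20)) (hc : M.cmin ≠ 0) (hR : Bi i / M.cmin ≤ T) :
    M.Stops T ε δ x i k := by
  have h2 := two_le_Bi hi
  have hc0 : 0 < M.cmin := lt_of_le_of_ne M.cmin_nonneg (Ne.symm hc)
  have hU : ∀ y, M.optToGo (fun _ => 0) (M.Hi T ε i) y ≤ Bi i / 20 := by
    intro y
    cases y with
    | none => rw [M.optToGo_none rfl]; linarith
    | some s =>
      refine (ENNReal.ofReal_le_ofReal_iff (by linarith)).1 (le_trans ?_ hB)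
      refine le_trans ?_ (le_iSup M.optValue s)
      exact le_iInf fun π => le_iInf fun _ => M.optToGo_le_value _ _ s
  have hRi : M.Ri T i = Bi i / M.cmin := by
    rw [Ri, if_neg hc, min_eq_left hR]
  refine M.stops_of_relaxation hT hε hε1 hδ hδ1 hi hg rfl (fun _ _ => le_rfl) hc0 M.cmin_le hU
    (fun y => (hU y).trans ?_)
  rw [hRi, div_mul_cancel₀ _ hc]
  linarith

/-- The relaxation is the unit-cost instance, whose finite-horizon optimal costs are bounded by the
diameter. As `c_min ≤ 1`, a value bound above `T` makes the horizon the one based on `T`. -/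
theorem stops_of_diam_le (hg : M.SearchGood T ε δ x i k)
    (hD : M.diam ≤ ENNReal.ofReal T) (hB : T ≤ Bi i / 20) : M.Stops T ε δ x i k := by
  have h2 := two_le_Bi hi
  have hU : ∀ y, M.unitCost.optToGo (fun _ => 0) (M.Hi T ε i) y ≤ T := by
    intro y
    cases y with
    | none => rw [optToGo_none _ rfl]; linarith
    | some s =>
      refine (ENNReal.ofReal_le_ofReal_iff (by linarith)).1 (le_trans ?_ hD)
      refine le_trans ?_ (le_iSup (fun s => ⨅ π : S → PMF A, M.hitTime (stationary π) s) s)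
      refine le_iInf fun π => ?_
      rw [hitTime_eq_value_unitCost]
      exact M.unitCost.optToGo_le_value _ _ s
  have hRi : M.Ri T i = T := by
    rw [Ri]
    split_ifs with hc
    · rfl
    · have hc0 : 0 < M.cmin := lt_of_le_of_ne M.cmin_nonneg (Ne.symm hc)
      refine min_eq_right ?_
      rw [le_div_iff₀ hc0]
      nlinarith [M.cmin_le_one]
  refine M.stops_of_relaxation hT hε hε1 hδ hδ1 hi hg (M' := M.unitCost) rfl M.c_le_one one_pos
    (fun _ _ => le_rfl) (fun y => (hU y).trans hB) (fun y => (hU y).trans ?_)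
  rw [hRi, mul_one]

omit hT hε hε1 hδ hδ1 hi in
theorem optValue_le_optValueT (T : ℝ) (s : S) : M.optValue s ≤ M.optValueT T s :=
  le_iInf fun π => le_iInf fun hπ =>
    iInf₂_le_of_le π (fun s => (hπ s).trans_lt ENNReal.ofReal_lt_top) le_rfl

omit hT hε hε1 hδ hδ1 hi in
theorem Bstar_le_BstarT (T : ℝ) : M.Bstar ≤ M.BstarT T :=
  iSup_mono fun s => M.optValue_le_optValueT T s

/-- If the horizon is based on `T`, the policies defining `B_{⋆,T}` reach the goal within it with
high probability. Otherwise `B_i / c_min ≤ T`, and the criterion for `B⋆ ≤ B_{⋆,T}` applies. -/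
theorem stops_of_BstarT_le (hg : M.SearchGood T ε δ x i k)
    (hB : M.BstarT T ≤ ENNReal.ofReal (Bi i / 20)) : M.Stops T ε δ x i k := by
  have h2 := two_le_Bi hi
  by_cases hRT : M.Ri T i = T
  · refine M.stops_of_optToGo_le hT hε hε1 hδ hδ1 hi hg (fun y => ?_) (fun m hm y => ?_)
    · cases y with
      | none => rw [M.optToGo_none rfl]; linarith
      | some s =>
        refine (ENNReal.ofReal_le_ofReal_iff (by linarith)).1 ?_
        rw [ENNReal.ofReal_add (by linarith) (by linarith)]
        refine le_trans ?_ (add_le_add hB le_rfl)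
        refine le_trans ?_ (add_le_add (le_iSup (M.optValueT T) s) le_rfl)
        rw [optValueT, ENNReal.iInf_add]
        refine le_iInf fun π => ?_
        rw [ENNReal.iInf_add]
        exact le_iInf fun hπ => M.optToGo_le_value_add hT hε hε1 hi (Or.inl hRT) π hπ s
    · have h1 := optToGo_le_add (M := M) (M' := M) rfl (fun _ _ => le_rfl)
        (by linarith : 0 ≤ 0.6 * Bi i) m y
      rw [← cfi_eq] at h1
      refine h1.trans (add_le_add ?_ le_rfl)
      cases y with
      | none => rw [M.optToGo_none rfl]; linarith
      | some s =>
        refine (ENNReal.ofReal_le_ofReal_iff (by linarith)).1 (le_trans ?_ hB)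
        refine le_trans ?_ (le_iSup (M.optValueT T) s)
        exact le_iInf fun π => le_iInf fun _ => M.optToGo_le_value _ _ s
  · have hc : M.cmin ≠ 0 := fun h => hRT (by simp [Ri, h])
    refine M.stops_of_Bstar_le hT hε hε1 hδ hδ1 hi hg ((M.Bstar_le_BstarT T).trans hB) hc ?_
    unfold Ri at hRT
    rw [if_neg hc] at hRT
    by_contra! h
    exact hRT (min_eq_right h.le)

end Iteration

/-! ### The run of Search Horizon -/

section Run

variable {S A : Type*} [Fintype S] [Fintype A] [Nonempty S] [Nonempty A] (M : SSP S A)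

/-- The number of calls at each state-action pair before iteration `i`, if it is reached. -/
noncomputable def offset (M : SSP S A) (T ε δ : ℝ) (i : ℕ) : ℕ :=
  ∑ j ∈ Finset.Ico 1 i, M.searchN batchConst T ε δ j

theorem offset_succ (T ε δ : ℝ) {i : ℕ} (hi : 1 ≤ i) :
    M.offset T ε δ (i + 1) = M.offset T ε δ i + M.searchN batchConst T ε δ i :=
  Finset.sum_Ico_succ_top hi _

/-- The run ends in iteration `i` with the result `r`. -/
def EndsAt (M : SSP S A) (T ε δ : ℝ) (x : ℕ → S → A → Option S) (i : ℕ) (r : Outcome S A) : Prop :=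
  1 ≤ i ∧ Bi i ≤ 40 * T ∧ (∀ j, 1 ≤ j → j < i → ¬ M.Stops T ε δ x j (M.offset T ε δ j)) ∧
  ((M.Stops T ε δ x i (M.offset T ε δ i) ∧
    r.output = some (extend (M.Hi T ε i) (M.lcbviPi (M.Hi T ε i)
      (counter x (M.offset T ε δ (i + 1)) (M.finalN batchConst T ε δ i))
      (Bi i) (cfi i) (deltai δ i))) ∧
    r.samples = Fintype.card S * Fintype.card A *
      (M.offset T ε δ (i + 1) + M.finalN batchConst T ε δ i)) ∨
  (¬ M.Stops T ε δ x i (M.offset T ε δ i) ∧ 40 * T < Bi (i + 1) ∧ r.output = none ∧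
    r.samples = Fintype.card S * Fintype.card A * M.offset T ε δ (i + 1)))

/-- Induction on a bound `n` for the termination measure of the loop; `n = 0` is impossible as long
as `B_i ≤ 40T`. -/
theorem searchLoop_endsAt {T ε δ : ℝ} (x : ℕ → S → A → Option S) (n : ℕ) :
    ∀ i, ⌊40 * T⌋₊ + 1 - 2 ^ i ≤ n → 1 ≤ i → Bi i ≤ 40 * T →
    (∀ j, 1 ≤ j → j < i → ¬ M.Stops T ε δ x j (M.offset T ε δ j)) →
    ∃ i', M.EndsAt T ε δ x i' (M.searchLoop batchConst T ε δ x i (M.offset T ε δ i)) := by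
  have hpow : ∀ i, Bi i ≤ 40 * T → 2 ^ i ≤ ⌊40 * T⌋₊ := fun i h => by
    apply Nat.le_floor
    simpa [Bi] using h
  induction n with
  | zero =>
    intro i hn _ hB _
    have := hpow i hB
    omega
  | succ n ih =>
    intro i hn hi hB hprev
    rw [searchLoop]
    split_ifs with h1 h2
    · refine ⟨i, hi, hB, hprev, Or.inl ⟨h1, ?_, ?_⟩⟩ <;> simp only [M.offset_succ T ε δ hi]
    · refine ⟨i, hi, hB, hprev, Or.inr ⟨h1, h2, rfl, ?_⟩⟩
      simp only [M.offset_succ T ε δ hi]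
    · rw [← M.offset_succ T ε δ hi]
      refine ih (i + 1) ?_ (by omega) (not_lt.1 h2) ?_
      · have := hpow i hB
        have h3 : 2 ^ i < 2 ^ (i + 1) := Nat.pow_lt_pow_right (by norm_num) (Nat.lt_succ_self i)
        omega
      · intro j hj hji
        rcases Nat.lt_succ_iff_lt_or_eq.1 hji with h | rfl
        · exact hprev j hj h
        · exact h1

theorem searchHorizon_endsAt {T ε δ : ℝ} (hT : 1 ≤ T) (x : ℕ → S → A → Option S) :
    ∃ i, M.EndsAt T ε δ x i (M.searchHorizon batchConst T ε δ x) := by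
  have := M.searchLoop_endsAt (ε := ε) (δ := δ) x _ 1 le_rfl le_rfl
    (by norm_num [Bi]; linarith : Bi 1 ≤ 40 * T) (fun j h1 h2 => absurd h1 (by omega))
  simpa [searchHorizon, offset] using this

/-- All estimates of the run are accurate. -/
def RunGood (M : SSP S A) (T ε δ : ℝ) (x : ℕ → S → A → Option S) : Prop :=
  ∀ i, 1 ≤ i → Bi i ≤ 40 * T → M.SearchGood T ε δ x i (M.offset T ε δ i) ∧
    M.FinalGood T ε δ x i (M.offset T ε δ (i + 1))

theorem sum_inv_sq_le (n : ℕ) : ∑ j ∈ Finset.range n, 1 / ((j : ℝ) + 1) ^ 2 ≤ 2 - 1 / (n : ℝ) := by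
  induction n with
  | zero => simp
  | succ n ih =>
    rw [Finset.sum_range_succ]
    rcases Nat.eq_zero_or_pos n with rfl | hn
    · norm_num
    have hn0 : (0 : ℝ) < n := by exact_mod_cast hn
    have : 1 / ((n : ℝ) + 1) ^ 2 ≤ 1 / n - 1 / (n + 1) := by
      rw [div_sub_div _ _ hn0.ne' (by positivity), div_le_div_iff₀ (by positivity) (by positivity)]
      nlinarith
    push_cast
    linarith

/-- The offsets do not depend on the answers, so the two batches of iteration `i` are fixed even if
the run stops earlier or later, and no conditioning is needed. Their failure probabilities add up to
`8δ_i = δ/(5i²)`, with sum at most `2δ/5`. -/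
theorem measure_not_runGood_le {Ω : Type*} [MeasurableSpace Ω] {μ : Measure Ω}
    [IsProbabilityMeasure μ] {X : ℕ → S → A → Ω → Option S} (hX : M.IsGenerativeModel μ X)
    {T ε δ : ℝ} (hT : 1 ≤ T) (hε : 0 < ε) (hε1 : ε ≤ 1) (hδ : 0 < δ) (hδ1 : δ ≤ 1) :
    μ {ω | ¬ M.RunGood T ε δ (fun t s a => X t s a ω)} ≤ ENNReal.ofReal δ := by
  set n := ⌊40 * T⌋₊ with hn
  have hone : ∀ j : ℕ, μ {ω | ¬ (M.SearchGood T ε δ (fun t s a => X t s a ω) (j + 1)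
      (M.offset T ε δ (j + 1)) ∧ M.FinalGood T ε δ (fun t s a => X t s a ω) (j + 1)
        (M.offset T ε δ (j + 1 + 1)))} ≤ ENNReal.ofReal (8 * deltai δ (j + 1)) := by
    intro j
    have hi : 1 ≤ j + 1 := by omega
    have hH : 0 < M.Hi T ε (j + 1) := by
      have := M.one_le_Hi hT hε hε1 hi
      exact_mod_cast (by linarith : (0 : ℝ) < M.Hi T ε (j + 1))
    have hd := deltai_pos hδ hi
    have hB : 0 < Bi (j + 1) := by linarith [two_le_Bi hi]
    -- An arbitrary sequence of answers: only the positivity of the batch sizes is needed, and it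
    -- does not involve the answers.
    have x₀ : ℕ → S → A → Option S := fun _ _ _ => none
    have h1 := hX.measure_not_batchGood_iota_le (M.offset T ε δ (j + 1))
      (M.searchN_spec hT hε hε1 hδ hδ1 hi x₀ 0).1 (cfi_nonneg hi) hB hd (deltai_le_one hδ1 hi) hH
    have h2 := hX.measure_not_batchGood_iota_le (M.offset T ε δ (j + 1 + 1))
      (M.finalN_spec hT hε hε1 hδ hδ1 hi x₀ 0).1 (cfi_nonneg hi) hB hd (deltai_le_one hδ1 hi) hH
    rw [show 8 * deltai δ (j + 1) = 4 * deltai δ (j + 1) + 4 * deltai δ (j + 1) by ring,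
      ENNReal.ofReal_add (by positivity) (by positivity)]
    refine (measure_mono fun ω hω => ?_).trans ((measure_union_le _ _).trans (add_le_add h1 h2))
    exact not_and_or.1 hω
  calc μ {ω | ¬ M.RunGood T ε δ (fun t s a => X t s a ω)}
      ≤ μ (⋃ j ∈ Finset.range n, {ω | ¬ (M.SearchGood T ε δ (fun t s a => X t s a ω) (j + 1)
        (M.offset T ε δ (j + 1)) ∧ M.FinalGood T ε δ (fun t s a => X t s a ω) (j + 1)
          (M.offset T ε δ (j + 1 + 1)))}) := by
        refine measure_mono fun ω hω => ?_
        by_contra hne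
        refine hω fun i hi hB => ?_
        obtain ⟨j, rfl⟩ := Nat.exists_eq_add_of_le' hi
        by_contra hbad
        refine hne (Set.mem_biUnion (x := j) ?_ hbad)
        have h1 : 2 ^ (j + 1) ≤ n := by
          apply Nat.le_floor
          simpa [Bi] using hB
        have h2 := Nat.lt_two_pow_self (n := j + 1)
        simp only [Finset.coe_range, Set.mem_Iio]
        omega
    _ ≤ ∑ j ∈ Finset.range n, ENNReal.ofReal (8 * deltai δ (j + 1)) :=
        (measure_biUnion_finset_le _ _).trans (Finset.sum_le_sum fun j _ => hone j)
    _ = ENNReal.ofReal (∑ j ∈ Finset.range n, 8 * deltai δ (j + 1)) :=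
        (ENNReal.ofReal_sum_of_nonneg fun j _ => by
          have := deltai_pos hδ (show 1 ≤ j + 1 by omega)
          positivity).symm
    _ ≤ _ := by
        refine ENNReal.ofReal_le_ofReal ?_
        have h1 : ∑ j ∈ Finset.range n, 8 * deltai δ (j + 1)
            = δ / 5 * ∑ j ∈ Finset.range n, 1 / ((j : ℝ) + 1) ^ 2 := by
          rw [Finset.mul_sum]
          refine Finset.sum_congr rfl fun j _ => ?_
          unfold deltai
          push_cast
          field_simp
          norm_num
        rw [h1]
        have h2 := sum_inv_sq_le n
        have h3 : (0 : ℝ) ≤ 1 / n := by positivity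
        nlinarith

/-! ### The number of samples -/

variable {T ε δ : ℝ} (hT : 1 ≤ T) (hε : 0 < ε) (hε1 : ε ≤ 1) (hδ : 0 < δ) (hδ1 : δ ≤ 1)

/-- The argument of the logarithm in the final bounds. -/
noncomputable def logArg (S A : Type*) [Fintype S] [Fintype A] (T ε δ : ℝ) : ℝ :=
  2 * Fintype.card S * Fintype.card A * T / (ε * δ)

include hT hε hε1 hδ hδ1 in
theorem logArg_spec : 2 ≤ logArg S A T ε δ ∧ T ≤ logArg S A T ε δ ∧ T / ε ≤ logArg S A T ε δ ∧
    Fintype.card S * Fintype.card A / (ε * δ) ≤ logArg S A T ε δ ∧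
    Fintype.card S * Fintype.card A / δ ≤ logArg S A T ε δ := by
  have hS : (1 : ℝ) ≤ Fintype.card S := by exact_mod_cast Fintype.card_pos
  have hA : (1 : ℝ) ≤ Fintype.card A := by exact_mod_cast Fintype.card_pos
  unfold logArg
  set s : ℝ := (Fintype.card S : ℝ)
  set a : ℝ := (Fintype.card A : ℝ)
  have hsa : 1 ≤ s * a := one_le_mul_of_one_le_of_one_le hS hA
  have hsaT : 1 ≤ s * a * T := one_le_mul_of_one_le_of_one_le hsa hT
  have hTs : T ≤ s * a * T := le_mul_of_one_le_left (by linarith) hsa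
  have hed : 0 < ε * δ := mul_pos hε hδ
  have hed1 : ε * δ ≤ 1 := mul_le_one₀ hε1 hδ.le hδ1
  have hedε : ε * δ ≤ ε := mul_le_of_le_one_right hε.le hδ1
  have hedδ : ε * δ ≤ δ := mul_le_of_le_one_left hδ.le hε1
  have h4 : s * a ≤ s * a * T := le_mul_of_one_le_right (by linarith) hT
  refine ⟨?_, ?_, ?_, ?_, ?_⟩
  · rw [le_div_iff₀ hed]; linarith
  · rw [le_div_iff₀ hed]; nlinarith
  · apply div_le_div₀ <;> first | positivity | linarith
  · apply div_le_div_of_nonneg_right _ hed.le; linarith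
  · apply div_le_div₀ <;> first | positivity | linarith

theorem Ri_mono {j i : ℕ} (h : j ≤ i) (T : ℝ) : M.Ri T j ≤ M.Ri T i := by
  unfold Ri
  split_ifs with hc
  · exact le_rfl
  · refine min_le_min (div_le_div_of_nonneg_right ?_ M.cmin_nonneg) le_rfl
    exact pow_le_pow_right₀ (by norm_num) h

/-- Since `2 ≤ G`, numerical constants are absorbed into multiples of `log G`. -/
theorem log_le_of_le_pow {G y : ℝ} {p q : ℕ} (hG : 2 ≤ G) (hy : 0 < y) (h : y ≤ 2 ^ p * G ^ q) :
    Real.log y ≤ (p + q) * Real.log G := by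
  have h1 := Real.log_le_log hy h
  rw [Real.log_mul (by positivity) (by positivity), Real.log_pow, Real.log_pow] at h1
  have h2 : Real.log 2 ≤ Real.log G := Real.log_le_log (by norm_num) hG
  have h3 : (p : ℝ) * Real.log 2 ≤ p * Real.log G := by gcongr
  linarith

include hT hε hε1 hδ hδ1

/-- From `1920 ≤ 2^11` the logarithm in the horizon is at most `12` times the final one; rounding up
turns the factor `4` into `5`. -/
theorem Hi_le {i : ℕ} (hi : 1 ≤ i) (hB : Bi i ≤ 40 * T) :
    (M.Hi T ε i : ℝ) ≤ 60 * M.Ri T i * Real.log (logArg S A T ε δ) := by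
  obtain ⟨hG, -, hTε, -⟩ := logArg_spec (S := S) (A := A) hT hε hε1 hδ hδ1
  have hR := M.one_le_Ri hT hi
  have hL1 := one_le_log hε hε1 hi
  have hB2 := two_le_Bi hi
  have hL : Real.log (48 * Bi i / ε) ≤ 12 * Real.log (logArg S A T ε δ) := by
    have := log_le_of_le_pow (p := 11) (q := 1) hG (y := 48 * Bi i / ε) (by positivity) (by
      calc 48 * Bi i / ε ≤ 48 * (40 * T) / ε := by gcongr
        _ = 1920 * (T / ε) := by ring
        _ ≤ 2 ^ 11 * logArg S A T ε δ ^ 1 := by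
            rw [pow_one]
            gcongr
            norm_num)
    norm_num at this
    exact this
  have hRL := one_le_mul_of_one_le_of_one_le hR hL1
  have h1 : (M.Hi T ε i : ℝ) ≤ 4 * M.Ri T i * Real.log (48 * Bi i / ε) + 1 :=
    (Nat.ceil_lt_add_one (by positivity : 0 ≤ 4 * M.Ri T i * Real.log (48 * Bi i / ε))).le
  have h2 := mul_le_mul_of_nonneg_left hL (by linarith : 0 ≤ M.Ri T i)
  linarith

theorem Hi_le_sq {i : ℕ} (hi : 1 ≤ i) (hB : Bi i ≤ 40 * T) :
    (M.Hi T ε i : ℝ) ≤ 60 * logArg S A T ε δ ^ 2 := by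
  obtain ⟨hG, hTG, -⟩ := logArg_spec (S := S) (A := A) hT hε hε1 hδ hδ1
  have h1 : Real.log (logArg S A T ε δ) ≤ logArg S A T ε δ :=
    (Real.log_le_sub_one_of_pos (by linarith)).trans (by linarith)
  have h0 : 0 ≤ Real.log (logArg S A T ε δ) := Real.log_nonneg (by linarith)
  calc (M.Hi T ε i : ℝ) ≤ 60 * M.Ri T i * Real.log (logArg S A T ε δ) :=
        M.Hi_le hT hε hε1 hδ hδ1 hi hB
    _ ≤ 60 * logArg S A T ε δ * logArg S A T ε δ := by
        gcongr
        exact (M.Ri_le T i).trans hTG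
    _ = _ := by ring

omit hT hε hε1 hδ hδ1 in
theorem cast_le_Bi (i : ℕ) : (i : ℝ) ≤ Bi i := by
  have := (Nat.lt_two_pow_self (n := i)).le
  unfold Bi
  exact_mod_cast this

/-- The value bounds double, so the number of iterations is logarithmic in `T`. -/
theorem cast_le_log {i : ℕ} (hB : Bi i ≤ 40 * T) :
    (i : ℝ) ≤ 11 * Real.log (logArg S A T ε δ) := by
  obtain ⟨hG, hTG, -⟩ := logArg_spec (S := S) (A := A) hT hε hε1 hδ hδ1
  have h1 := log_le_of_le_pow (p := 6) (q := 1) hG (y := Bi i) (by unfold Bi; positivity) (by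
    rw [pow_one]; norm_num; linarith)
  rw [Bi, Real.log_pow] at h1
  have h2 := Real.log_two_gt_d9
  have h3 : (i : ℝ) * 0.69 ≤ i * Real.log 2 := by gcongr; linarith
  have h0 : 0 ≤ Real.log (logArg S A T ε δ) := Real.log_nonneg (by linarith)
  norm_num at h1
  linarith

theorem logFactor_coarse_le {i : ℕ} (hi : 1 ≤ i) (hB : Bi i ≤ 40 * T) :
    logFactor (Fintype.card S) (Fintype.card A) (Bi i) (M.Hi T ε i) (0.1 * Bi i) (deltai δ i) ≤
      36 * Real.log (logArg S A T ε δ) := by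
  obtain ⟨hG, hTG, -, -, hsa⟩ := logArg_spec (S := S) (A := A) hT hε hε1 hδ hδ1
  have hH1 := M.one_le_Hi hT hε hε1 hi
  have hH := M.Hi_le_sq hT hε hε1 hδ hδ1 hi hB
  have hS : (1 : ℝ) ≤ Fintype.card S := by exact_mod_cast Fintype.card_pos
  have hA : (1 : ℝ) ≤ Fintype.card A := by exact_mod_cast Fintype.card_pos
  have hB2 := two_le_Bi hi
  have hi0 : (0 : ℝ) < i := by exact_mod_cast hi
  have hiG : (i : ℝ) ≤ 40 * logArg S A T ε δ := (cast_le_Bi i).trans (hB.trans (by linarith))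
  have hd := deltai_pos hδ hi
  have h0 : 0 ≤ Real.log (logArg S A T ε δ) := Real.log_nonneg (by linarith)
  set G := logArg S A T ε δ
  unfold logFactor
  have := log_le_of_le_pow (p := 27) (q := 5) hG
    (y := 2 * Fintype.card S * Fintype.card A * Bi i * M.Hi T ε i / (0.1 * Bi i * deltai δ i))
    (by positivity) (by
      calc _ = 800 * (Fintype.card S * Fintype.card A / δ) * M.Hi T ε i * (i : ℝ) ^ 2 := by
            unfold deltai; field_simp; norm_num
        _ ≤ 800 * G * (60 * G ^ 2) * (40 * G) ^ 2 := by gcongr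
        _ = 76800000 * G ^ 5 := by ring
        _ ≤ _ := by gcongr; norm_num)
  norm_num at this ⊢
  linarith

theorem logFactor_fine_le {i : ℕ} (hi : 1 ≤ i) (hB : Bi i ≤ 40 * T) :
    logFactor (Fintype.card S) (Fintype.card A) (Bi i) (M.Hi T ε i) (ε / 2) (deltai δ i) ≤
      36 * Real.log (logArg S A T ε δ) := by
  obtain ⟨hG, hTG, -, hsa, -⟩ := logArg_spec (S := S) (A := A) hT hε hε1 hδ hδ1
  have hH1 := M.one_le_Hi hT hε hε1 hi
  have hH := M.Hi_le_sq hT hε hε1 hδ hδ1 hi hB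
  have hS : (1 : ℝ) ≤ Fintype.card S := by exact_mod_cast Fintype.card_pos
  have hA : (1 : ℝ) ≤ Fintype.card A := by exact_mod_cast Fintype.card_pos
  have hB2 := two_le_Bi hi
  have hi0 : (0 : ℝ) < i := by exact_mod_cast hi
  have hiG : (i : ℝ) ≤ 40 * logArg S A T ε δ := (cast_le_Bi i).trans (hB.trans (by linarith))
  have hBG : Bi i ≤ 40 * logArg S A T ε δ := hB.trans (by linarith)
  have hd := deltai_pos hδ hi
  set G := logArg S A T ε δ
  unfold logFactor
  have := log_le_of_le_pow (p := 30) (q := 6) hG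
    (y := 2 * Fintype.card S * Fintype.card A * Bi i * M.Hi T ε i / (ε / 2 * deltai δ i))
    (by positivity) (by
      calc _ = 160 * (Fintype.card S * Fintype.card A / (ε * δ)) * Bi i * M.Hi T ε i
              * (i : ℝ) ^ 2 := by
            unfold deltai; field_simp; norm_num
        _ ≤ 160 * G * (40 * G) * (60 * G ^ 2) * (40 * G) ^ 2 := by gcongr
        _ = 614400000 * G ^ 6 := by ring
        _ ≤ _ := by gcongr; norm_num)
  norm_num at this ⊢
  linarith

omit hT hε hε1 hδ hδ1 in
theorem natCeil_le_two_mul {y z : ℝ} (hy : y ≤ z) (hz : 1 ≤ z) : (⌈y⌉₊ : ℝ) ≤ 2 * z := by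
  have h1 : (⌈y⌉₊ : ℝ) ≤ ⌈z⌉₊ := by exact_mod_cast Nat.ceil_mono hy
  have h2 := (Nat.ceil_lt_add_one (by linarith : 0 ≤ z)).le
  linarith

theorem log_logArg_ge : 0.69 ≤ Real.log (logArg S A T ε δ) := by
  obtain ⟨hG, -⟩ := logArg_spec (S := S) (A := A) hT hε hε1 hδ hδ1
  have := Real.log_le_log (by norm_num) hG
  linarith [Real.log_two_gt_d9]

theorem searchN_le {i : ℕ} (hi : 1 ≤ i) (hB : Bi i ≤ 40 * T) :
    (M.searchN batchConst T ε δ i : ℝ) ≤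
      480000 * batchConst * Fintype.card S * M.Ri T i * Real.log (logArg S A T ε δ) ^ 2 := by
  have hH1 := M.one_le_Hi hT hε hε1 hi
  have hH := M.Hi_le hT hε hε1 hδ hδ1 hi hB
  have hl := M.logFactor_coarse_le hT hε hε1 hδ hδ1 hi hB
  have hS : (1 : ℝ) ≤ Fintype.card S := by exact_mod_cast Fintype.card_pos
  have hΛ := log_logArg_ge (S := S) (A := A) hT hε hε1 hδ hδ1
  have hκ := batchConst_spec.1
  have hB2 := two_le_Bi hi
  have hR := M.one_le_Ri hT hi
  set Λ := Real.log (logArg S A T ε δ)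
  set s : ℝ := (Fintype.card S : ℝ)
  have e1 : Bi i ^ 2 * s * M.Hi T ε i / (0.1 * Bi i) ^ 2 + s * Bi i * M.Hi T ε i / (0.1 * Bi i)
      = 110 * s * M.Hi T ε i := by
    field_simp; norm_num
  have key : batchConst * (110 * s * M.Hi T ε i) * logFactor (Fintype.card S) (Fintype.card A)
      (Bi i) (M.Hi T ε i) (0.1 * Bi i) (deltai δ i) ≤
        240000 * batchConst * s * M.Ri T i * Λ ^ 2 := by
    calc _ ≤ batchConst * (110 * s * M.Hi T ε i) * (36 * Λ) := by gcongr
      _ ≤ batchConst * (110 * s * (60 * M.Ri T i * Λ)) * (36 * Λ) := by gcongr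
      _ = 237600 * (batchConst * s * M.Ri T i * Λ ^ 2) := by ring
      _ ≤ 240000 * (batchConst * s * M.Ri T i * Λ ^ 2) := by gcongr; norm_num
      _ = _ := by ring
  have h1 : 1 ≤ 240000 * batchConst * s * M.Ri T i * Λ ^ 2 := by
    have h2 : 1 ≤ batchConst * s * M.Ri T i :=
      one_le_mul_of_one_le_of_one_le (one_le_mul_of_one_le_of_one_le hκ hS) hR
    have h3 : 0.4 ≤ Λ ^ 2 := by nlinarith
    have h4 : 1 * 0.4 ≤ batchConst * s * M.Ri T i * Λ ^ 2 := by gcongr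
    linarith
  have h2 := natCeil_le_two_mul key h1
  have h3 : (M.searchN batchConst T ε δ i : ℝ) = (⌈batchConst * (110 * s * M.Hi T ε i) *
      logFactor (Fintype.card S) (Fintype.card A)
      (Bi i) (M.Hi T ε i) (0.1 * Bi i) (deltai δ i)⌉₊ : ℝ) := by
    rw [searchN, coarseN, e1]
  rw [h3]
  linarith

/-- The horizons increase with the iteration, so the last batch dominates each earlier one, and the
number of batches only adds a logarithmic factor. -/
theorem offset_le {i : ℕ} (hi : 1 ≤ i) (hB : Bi i ≤ 40 * T) :
    (M.offset T ε δ (i + 1) : ℝ) ≤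
      5280000 * batchConst * Fintype.card S * M.Ri T i * Real.log (logArg S A T ε δ) ^ 3 := by
  have hi11 := cast_le_log (S := S) (A := A) hT hε hε1 hδ hδ1 hB
  have hΛ := log_logArg_ge (S := S) (A := A) hT hε hε1 hδ hδ1
  have hR := M.one_le_Ri hT hi
  have hκ := batchConst_spec.1
  set Λ := Real.log (logArg S A T ε δ)
  have h1 : (M.offset T ε δ (i + 1) : ℝ) ≤
      ∑ j ∈ Finset.Ico 1 (i + 1), 480000 * batchConst * Fintype.card S * M.Ri T i * Λ ^ 2 := by
    unfold offset
    push_cast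
    refine Finset.sum_le_sum fun j hj => ?_
    rw [Finset.mem_Ico] at hj
    refine (M.searchN_le hT hε hε1 hδ hδ1 hj.1 (le_trans ?_ hB)).trans ?_
    · exact pow_le_pow_right₀ (by norm_num) (by omega)
    · gcongr
      exact M.Ri_mono (by omega) T
  rw [Finset.sum_const, Nat.card_Ico, nsmul_eq_mul, Nat.add_sub_cancel] at h1
  refine h1.trans ?_
  calc _ ≤ 11 * Λ * (480000 * batchConst * Fintype.card S * M.Ri T i * Λ ^ 2) := by gcongr
    _ = _ := by ring

theorem finalN_le {i : ℕ} (hi : 1 ≤ i) (hB : Bi i ≤ 40 * T) :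
    (M.finalN batchConst T ε δ i : ℝ) ≤ 260000 * batchConst *
      (Bi i ^ 2 * M.Ri T i / ε ^ 2 + Fintype.card S * Bi i * M.Ri T i / ε
        + Fintype.card S * M.Ri T i ^ 2) * Real.log (logArg S A T ε δ) ^ 3 := by
  have hH1 := M.one_le_Hi hT hε hε1 hi
  have hH := M.Hi_le hT hε hε1 hδ hδ1 hi hB
  have hl := M.logFactor_fine_le hT hε hε1 hδ hδ1 hi hB
  have hS : (1 : ℝ) ≤ Fintype.card S := by exact_mod_cast Fintype.card_pos
  have hΛ := log_logArg_ge (S := S) (A := A) hT hε hε1 hδ hδ1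
  have hκ := batchConst_spec.1
  have hB2 := two_le_Bi hi
  have hR := M.one_le_Ri hT hi
  set Λ := Real.log (logArg S A T ε δ)
  set s : ℝ := (Fintype.card S : ℝ)
  set H : ℝ := (M.Hi T ε i : ℝ)
  set R := M.Ri T i
  set B := Bi i
  set Q := B ^ 2 * R / ε ^ 2 + s * B * R / ε + s * R ^ 2 with hQ
  have hQ1 : 1 ≤ Q := by
    have h1 : 1 ≤ s * R ^ 2 := one_le_mul_of_one_le_of_one_le hS (one_le_pow₀ hR)
    have h2 : 0 ≤ B ^ 2 * R / ε ^ 2 := by positivity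
    have h3 : 0 ≤ s * B * R / ε := by positivity
    linarith
  have hm : B ^ 2 * H / (ε / 2) ^ 2 + s * B * H / (ε / 2) + s * H ^ 2 ≤ 3600 * Q * Λ ^ 2 := by
    have hΛ2 : Λ ≤ 1.5 * Λ ^ 2 := by nlinarith
    calc B ^ 2 * H / (ε / 2) ^ 2 + s * B * H / (ε / 2) + s * H ^ 2
        ≤ B ^ 2 * (60 * R * Λ) / (ε / 2) ^ 2 + s * B * (60 * R * Λ) / (ε / 2)
          + s * (60 * R * Λ) ^ 2 := by gcongr
      _ = 240 * (B ^ 2 * R / ε ^ 2) * Λ + 120 * (s * B * R / ε) * Λ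
          + 3600 * (s * R ^ 2) * Λ ^ 2 := by field_simp; ring
      _ ≤ 240 * (B ^ 2 * R / ε ^ 2) * (1.5 * Λ ^ 2) + 120 * (s * B * R / ε) * (1.5 * Λ ^ 2)
          + 3600 * (s * R ^ 2) * Λ ^ 2 := by gcongr
      _ = 360 * (B ^ 2 * R / ε ^ 2) * Λ ^ 2 + 180 * (s * B * R / ε) * Λ ^ 2
          + 3600 * (s * R ^ 2) * Λ ^ 2 := by ring
      _ ≤ 3600 * (B ^ 2 * R / ε ^ 2) * Λ ^ 2 + 3600 * (s * B * R / ε) * Λ ^ 2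
          + 3600 * (s * R ^ 2) * Λ ^ 2 := by gcongr <;> norm_num
      _ = _ := by rw [hQ]; ring
  have key : batchConst * (B ^ 2 * H / (ε / 2) ^ 2 + s * B * H / (ε / 2) + s * H ^ 2) *
      logFactor (Fintype.card S) (Fintype.card A) B (M.Hi T ε i) (ε / 2) (deltai δ i) ≤
        130000 * batchConst * Q * Λ ^ 3 := by
    calc _ ≤ batchConst * (B ^ 2 * H / (ε / 2) ^ 2 + s * B * H / (ε / 2) + s * H ^ 2)
          * (36 * Λ) := by gcongr
      _ ≤ batchConst * (3600 * Q * Λ ^ 2) * (36 * Λ) := by gcongr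
      _ = 129600 * (batchConst * Q * Λ ^ 3) := by ring
      _ ≤ 130000 * (batchConst * Q * Λ ^ 3) := by gcongr; norm_num
      _ = _ := by ring
  have h1 : 1 ≤ 130000 * batchConst * Q * Λ ^ 3 := by
    have h2 : 1 ≤ batchConst * Q := one_le_mul_of_one_le_of_one_le hκ hQ1
    have h3 : 0.69 ^ 3 ≤ Λ ^ 3 := by gcongr
    have h4 : 1 * 0.69 ^ 3 ≤ batchConst * Q * Λ ^ 3 := by gcongr
    norm_num at h4
    linarith
  have h2 := natCeil_le_two_mul key h1
  refine le_trans (le_of_eq rfl) (h2.trans (le_of_eq ?_))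
  ring

end Run

/-! ### The sample complexity -/

section Main

variable {S A : Type*} [Fintype S] [Fintype A] [Nonempty S] [Nonempty A] (M : SSP S A)
  {T ε δ : ℝ} (hT : 1 ≤ T) (hε : 0 < ε) (hε1 : ε ≤ 1) (hδ : 0 < δ) (hδ1 : δ ≤ 1)
  {x : ℕ → S → A → Option S}

/-! ### Size of the last value bound and of the last horizon. -/

theorem exists_Bi_near {b : ℝ} (hb : 1 ≤ b) : ∃ j, 1 ≤ j ∧ b ≤ Bi j / 20 ∧ Bi j ≤ 40 * b := by
  obtain ⟨n, h1, h2⟩ := exists_nat_pow_near (by linarith : 1 ≤ 20 * b) (one_lt_two : (1 : ℝ) < 2)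
  refine ⟨n + 1, by omega, ?_, ?_⟩
  · unfold Bi; linarith
  · unfold Bi; rw [pow_succ]; linarith

theorem Bi_mono {i j : ℕ} (h : i ≤ j) : Bi i ≤ Bi j := pow_le_pow_right₀ (by norm_num) h

include hT hε hε1 hδ hδ1

/-- The last value bound is at most of the order of the optimal value. -/
theorem Bi_le_of_endsAt (hg : M.RunGood T ε δ x) {i : ℕ} {r : Outcome S A}
    (h : M.EndsAt T ε δ x i r) {b : ℝ} (hb : 1 ≤ b) (hBT : M.BstarT T ≤ ENNReal.ofReal b) :
    Bi i ≤ 40 * b := by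
  -- A run that goes beyond iteration `j` failed the test there, although `b ≤ Bi j / 20` forces it
  -- to be passed.
  obtain ⟨j, hj, h1, h2⟩ := exists_Bi_near hb
  rcases le_or_gt i j with hij | hij
  · exact (Bi_mono hij).trans h2
  · exact absurd (M.stops_of_BstarT_le hT hε hε1 hδ hδ1 hj
      (hg j hj ((Bi_mono hij.le).trans h.2.1)).1
      (hBT.trans (ENNReal.ofReal_le_ofReal h1))) (h.2.2.1 j hj hij)

/-- The last horizon is at most of the order of the effective horizon. -/
theorem Ri_le_of_endsAt (hg : M.RunGood T ε δ x) {i : ℕ} {r : Outcome S A}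
    (h : M.EndsAt T ε δ x i r) {b : ℝ} (hb : 1 ≤ b) (hBs : M.Bstar ≤ ENNReal.ofReal b) :
    M.Ri T i ≤ 40 * if M.cmin = 0 then T else min (b / M.cmin) T := by
  by_cases hc : M.cmin = 0
  · rw [if_pos hc]; linarith [M.Ri_le T i]
  have hc0 : 0 < M.cmin := lt_of_le_of_ne M.cmin_nonneg (Ne.symm hc)
  rw [if_neg hc]
  obtain ⟨j, hj, h1, h2⟩ := exists_Bi_near hb
  have h3 : Bi j / M.cmin ≤ 40 * (b / M.cmin) := by
    rw [← mul_div_assoc]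
    exact div_le_div_of_nonneg_right h2 hc0.le
  have key : min (Bi i / M.cmin) T ≤ 40 * (b / M.cmin) := by
    rcases le_or_gt i j with hij | hij
    · exact (min_le_left _ _).trans
        ((div_le_div_of_nonneg_right (Bi_mono hij) hc0.le).trans h3)
    -- Iteration `j` was left without stopping, so `Bi j / c_min` cannot be below `T`; hence `T`
    -- itself is of the order of `b / c_min`.
    · refine (min_le_right _ _).trans (le_trans ?_ h3)
      by_contra! hlt
      exact h.2.2.1 j hj hij (M.stops_of_Bstar_le hT hε hε1 hδ hδ1 hj
        (hg j hj ((Bi_mono hij.le).trans h.2.1)).1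
        (hBs.trans (ENNReal.ofReal_le_ofReal h1)) hc hlt.le)
  rw [Ri, if_neg hc, mul_min_of_nonneg _ _ (by norm_num)]
  exact le_min key ((min_le_right _ _).trans (by linarith))

theorem polylog_pos {C : ℝ} (hC : 0 < C) (k : ℕ) :
    0 < polylog C k (Fintype.card S) (Fintype.card A) T ε δ := by
  have := log_logArg_ge (S := S) (A := A) hT hε hε1 hδ hδ1
  exact mul_pos hC (pow_pos (by unfold logArg at this; linarith) k)

/-- The constant in the final bounds. -/
noncomputable def finalConst : ℝ := 10 ^ 12 * batchConst

omit hT hε hε1 hδ hδ1 in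
theorem finalConst_pos : 0 < finalConst := by
  have := batchConst_spec.1
  unfold finalConst; positivity

/-- The bound for the number of samples when the algorithm returns no policy. -/
theorem samples_le_of_none {i : ℕ} (hi : 1 ≤ i) (hB : Bi i ≤ 40 * T) :
    ((Fintype.card S * Fintype.card A * M.offset T ε δ (i + 1) : ℕ) : ℝ) ≤
      polylog finalConst 3 (Fintype.card S) (Fintype.card A) T ε δ *
        ((Fintype.card S : ℝ) ^ 2 * Fintype.card A * T) := by
  have h1 := M.offset_le hT hε hε1 hδ hδ1 hi hB
  have hΛ := log_logArg_ge (S := S) (A := A) hT hε hε1 hδ hδ1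
  have hκ := batchConst_spec.1
  have hR := M.Ri_le T i
  have hR1 := M.one_le_Ri hT hi
  rw [show polylog finalConst 3 (Fintype.card S) (Fintype.card A) T ε δ =
    10 ^ 12 * batchConst * Real.log (logArg S A T ε δ) ^ 3 from rfl]
  set Λ := Real.log (logArg S A T ε δ)
  set s : ℝ := (Fintype.card S : ℝ)
  set a : ℝ := (Fintype.card A : ℝ)
  push_cast
  calc s * a * M.offset T ε δ (i + 1) ≤ s * a * (5280000 * batchConst * s * M.Ri T i * Λ ^ 3) := by
        gcongr
    _ ≤ s * a * (10 ^ 12 * batchConst * s * T * Λ ^ 3) := by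
        gcongr; norm_num
    _ = _ := by ring

/-- The bound for the number of samples when the algorithm returns a policy. -/
theorem samples_le_of_some {i : ℕ} (hi : 1 ≤ i) (hB : Bi i ≤ 40 * T) {b ρ : ℝ} (hb : 1 ≤ b)
    (hBb : Bi i ≤ 40 * b) (hR : M.Ri T i ≤ 40 * ρ) :
    ((Fintype.card S * Fintype.card A *
      (M.offset T ε δ (i + 1) + M.finalN batchConst T ε δ i) : ℕ) : ℝ) ≤
      polylog finalConst 3 (Fintype.card S) (Fintype.card A) T ε δ *
        (ρ * b ^ 2 * Fintype.card S * Fintype.card A / ε ^ 2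
          + ρ * b * (Fintype.card S : ℝ) ^ 2 * Fintype.card A / ε
          + ρ ^ 2 * (Fintype.card S : ℝ) ^ 2 * Fintype.card A) := by
  have h1 := M.offset_le hT hε hε1 hδ hδ1 hi hB
  have h2 := M.finalN_le hT hε hε1 hδ hδ1 hi hB
  have hΛ := log_logArg_ge (S := S) (A := A) hT hε hε1 hδ hδ1
  have hκ := batchConst_spec.1
  have hR1 := M.one_le_Ri hT hi
  have hB2 := two_le_Bi hi
  rw [show polylog finalConst 3 (Fintype.card S) (Fintype.card A) T ε δ =
    10 ^ 12 * batchConst * Real.log (logArg S A T ε δ) ^ 3 from rfl]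
  set Λ := Real.log (logArg S A T ε δ)
  set s : ℝ := (Fintype.card S : ℝ)
  set a : ℝ := (Fintype.card A : ℝ)
  set R := M.Ri T i
  set B := Bi i
  have hρ : 0 ≤ ρ := by linarith
  have hoff : (M.offset T ε δ (i + 1) : ℝ) ≤ 5280000 * batchConst *
      (B ^ 2 * R / ε ^ 2 + s * B * R / ε + s * R ^ 2) * Λ ^ 3 := by
    refine h1.trans ?_
    have e1 : s * R ≤ B ^ 2 * R / ε ^ 2 + s * B * R / ε + s * R ^ 2 := by
      have e2 : s * R ≤ s * R ^ 2 := by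
        rw [sq, ← mul_assoc]; exact le_mul_of_one_le_right (by positivity) hR1
      have e3 : 0 ≤ B ^ 2 * R / ε ^ 2 := by positivity
      have e4 : 0 ≤ s * B * R / ε := by positivity
      linarith
    calc _ = 5280000 * batchConst * (s * R) * Λ ^ 3 := by ring
      _ ≤ _ := by gcongr
  have hQ : B ^ 2 * R / ε ^ 2 + s * B * R / ε + s * R ^ 2 ≤
      64000 * (ρ * b ^ 2 / ε ^ 2 + ρ * b * s / ε + ρ ^ 2 * s) := by
    -- The leading term is cubic in quantities known up to the factor `40`, whence `64000 = 40³`.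
    calc _ ≤ (40 * b) ^ 2 * (40 * ρ) / ε ^ 2 + s * (40 * b) * (40 * ρ) / ε
          + s * (40 * ρ) ^ 2 := by gcongr
      _ = 64000 * (ρ * b ^ 2 / ε ^ 2) + 1600 * (ρ * b * s / ε) + 1600 * (ρ ^ 2 * s) := by ring
      _ ≤ 64000 * (ρ * b ^ 2 / ε ^ 2) + 64000 * (ρ * b * s / ε) + 64000 * (ρ ^ 2 * s) := by
          gcongr <;> norm_num
      _ = _ := by ring
  push_cast
  calc s * a * (M.offset T ε δ (i + 1) + M.finalN batchConst T ε δ i)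
      ≤ s * a * (5280000 * batchConst * (B ^ 2 * R / ε ^ 2 + s * B * R / ε + s * R ^ 2) * Λ ^ 3
        + 260000 * batchConst * (B ^ 2 * R / ε ^ 2 + s * B * R / ε + s * R ^ 2) * Λ ^ 3) := by
        gcongr
    _ = 5540000 * (s * a * batchConst * (B ^ 2 * R / ε ^ 2 + s * B * R / ε + s * R ^ 2) * Λ ^ 3) := by
        ring
    _ ≤ 5540000 * (s * a * batchConst *
        (64000 * (ρ * b ^ 2 / ε ^ 2 + ρ * b * s / ε + ρ ^ 2 * s)) * Λ ^ 3) := by gcongr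
    _ = 354560000000 * (s * a * batchConst *
        (ρ * b ^ 2 / ε ^ 2 + ρ * b * s / ε + ρ ^ 2 * s) * Λ ^ 3) := by ring
    _ ≤ 10 ^ 12 * (s * a * batchConst *
        (ρ * b ^ 2 / ε ^ 2 + ρ * b * s / ε + ρ ^ 2 * s) * Λ ^ 3) := by gcongr; norm_num
    _ = _ := by ring

-- When `B_{⋆,T}` is infinite, the claimed bound is vacuous. The effective horizon has to be nonzero
-- for this, as `0 * ∞ = 0`.
omit hT hε1 hδ hδ1 in
theorem policyBound_eq_top (hT : 0 < T) (h : M.BstarT T = ∞) : M.policyBound T ε = ∞ := by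
  have hρ : M.effHorizon T ≠ 0 := by
    have h1 : 0 < max M.Bstar 1 / ENNReal.ofReal M.cmin :=
      ENNReal.div_pos (by positivity) ENNReal.ofReal_ne_top
    exact (lt_min h1 (ENNReal.ofReal_pos.2 hT)).ne'
  have hS : (Fintype.card S : ℝ≥0∞) ≠ 0 := by exact_mod_cast Fintype.card_ne_zero
  have hA : (Fintype.card A : ℝ≥0∞) ≠ 0 := by exact_mod_cast Fintype.card_ne_zero
  have h1 : M.effHorizon T * max (M.BstarT T) 1 ^ 2 * Fintype.card S * Fintype.card A
      / ENNReal.ofReal ε ^ 2 = ∞ := by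
    rw [h, max_eq_left le_top, ENNReal.top_pow two_ne_zero, ENNReal.mul_top hρ,
      ENNReal.top_mul hS, ENNReal.top_mul hA, ENNReal.top_div_of_ne_top]
    exact ENNReal.pow_ne_top ENNReal.ofReal_ne_top
  rw [policyBound, h1, top_add, top_add]

omit hδ hδ1 hε1 in
theorem policyBound_eq {b bs : ℝ} (hb : 1 ≤ b) (hbs : 1 ≤ bs)
    (hBT : max (M.BstarT T) 1 = ENNReal.ofReal b) (hBs : max M.Bstar 1 = ENNReal.ofReal bs) :
    M.policyBound T ε = ENNReal.ofReal
      ((if M.cmin = 0 then T else min (bs / M.cmin) T) * b ^ 2 * Fintype.card S * Fintype.card A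
          / ε ^ 2
        + (if M.cmin = 0 then T else min (bs / M.cmin) T) * b * (Fintype.card S : ℝ) ^ 2
          * Fintype.card A / ε
        + (if M.cmin = 0 then T else min (bs / M.cmin) T) ^ 2 * (Fintype.card S : ℝ) ^ 2
          * Fintype.card A) := by
  have hρ : M.effHorizon T =
      ENNReal.ofReal (if M.cmin = 0 then T else min (bs / M.cmin) T) := by
    rw [effHorizon, hBs]
    split_ifs with hc
    · rw [hc, ENNReal.ofReal_zero, ENNReal.div_zero (ENNReal.ofReal_pos.2 (by linarith)).ne',
        min_eq_right le_top]
    · have hc0 : 0 < M.cmin := lt_of_le_of_ne M.cmin_nonneg (Ne.symm hc)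
      rw [← ENNReal.ofReal_div_of_pos hc0, ENNReal.ofReal_min]
  have hρ0 : 0 ≤ if M.cmin = 0 then T else min (bs / M.cmin) T := by
    split_ifs
    · linarith
    · exact le_min (div_nonneg (by linarith) M.cmin_nonneg) (by linarith)
  have hb0 : 0 ≤ b := by linarith
  rw [policyBound, hρ, hBT]
  generalize (if M.cmin = 0 then T else min (bs / M.cmin) T) = ρ at *
  rw [ENNReal.ofReal_add (by positivity) (by positivity),
    ENNReal.ofReal_add (by positivity) (by positivity),
    ENNReal.ofReal_div_of_pos (by positivity), ENNReal.ofReal_div_of_pos hε]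
  simp only [ENNReal.ofReal_mul', ENNReal.ofReal_pow, hε.le, hρ0, hb0, Nat.cast_nonneg,
    ENNReal.ofReal_natCast, pow_nonneg]

/-- On the event that all estimates are accurate the run of Search Horizon is as claimed. -/
theorem searchHorizon_spec (hg : M.RunGood T ε δ x) :
    let r := M.searchHorizon batchConst T ε δ x
    (r.output = none ∧ ENNReal.ofReal T < M.diam ∧
      (r.samples : ℝ) ≤ polylog finalConst 3 (Fintype.card S) (Fintype.card A) T ε δ *
        ((Fintype.card S : ℝ) ^ 2 * Fintype.card A * T)) ∨
    (∃ π : ℕ → S → A, r.output = some π ∧ M.IsOptimalT ε T (ofDet π) ∧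
      (r.samples : ℝ≥0∞) ≤
        ENNReal.ofReal (polylog finalConst 3 (Fintype.card S) (Fintype.card A) T ε δ) *
          M.policyBound T ε) := by
  intro r
  obtain ⟨i, hend⟩ := M.searchHorizon_endsAt (ε := ε) (δ := δ) hT x
  have hend' : M.EndsAt T ε δ x i r := hend
  obtain ⟨hi, hB, -, hcase⟩ := hend'
  obtain ⟨hg1, hg2⟩ := hg i hi hB
  rcases hcase with ⟨hs, hout, hsam⟩ | ⟨hs, hlt, hout, hsam⟩
  · refine Or.inr ⟨_, hout, M.isOptimalT_of_stops hT hε hε1 hδ hδ1 hi hg1 hs hg2, ?_⟩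
    have hpos := polylog_pos (S := S) (A := A) hT hε hε1 hδ hδ1 finalConst_pos 3
    by_cases htop : M.BstarT T = ∞
    · rw [M.policyBound_eq_top hε (by linarith) htop,
        ENNReal.mul_top (ENNReal.ofReal_pos.2 hpos).ne']
      exact le_top
    have htop' : M.Bstar ≠ ∞ := ne_top_of_le_ne_top htop (M.Bstar_le_BstarT T)
    have hone : ∀ y : ℝ≥0∞, y ≠ ∞ → max y 1 = ENNReal.ofReal (max y 1).toReal ∧
        1 ≤ (max y 1).toReal := fun y hy => by
      have hne : max y 1 ≠ ∞ := by simp [hy]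
      refine ⟨(ENNReal.ofReal_toReal hne).symm, ?_⟩
      rw [← ENNReal.toReal_one]
      exact ENNReal.toReal_mono hne (le_max_right _ _)
    obtain ⟨e1, hb⟩ := hone _ htop
    obtain ⟨e2, hbs⟩ := hone _ htop'
    rw [M.policyBound_eq hT hε hb hbs e1 e2, ← ENNReal.ofReal_mul hpos.le, hsam,
      ← ENNReal.ofReal_natCast]
    exact ENNReal.ofReal_le_ofReal (M.samples_le_of_some hT hε hε1 hδ hδ1 hi hB hb
      (M.Bi_le_of_endsAt hT hε hε1 hδ hδ1 hg hend hb (e1 ▸ le_max_left _ _))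
      (M.Ri_le_of_endsAt hT hε hε1 hδ hδ1 hg hend hbs (e2 ▸ le_max_left _ _)))
  · refine Or.inl ⟨hout, ?_, ?_⟩
    · by_contra! hD
      -- The search gives up only if `40T < B_{i+1} = 2B_i`, that is `T < B_i/20`; with `D ≤ T` the
      -- test of iteration `i` would have been passed.
      refine hs (M.stops_of_diam_le hT hε hε1 hδ hδ1 hi hg1 hD ?_)
      rw [Bi, pow_succ] at hlt
      unfold Bi
      linarith
    · rw [hsam]
      exact M.samples_le_of_none hT hε hε1 hδ hδ1 hi hB

end Main

end SSP

/-! ### The main theorem. -/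

theorem mainTheorem3 :
    ∃ (κ C : ℝ) (k : ℕ), 0 < κ ∧ 0 < C ∧
      ∀ (S A : Type*) [Fintype S] [Nonempty S] [Fintype A] [Nonempty A] (M : SSP S A)
        (T ε δ : ℝ), 1 ≤ T → ε ∈ Set.Ioo (0 : ℝ) 1 → δ ∈ Set.Ioo (0 : ℝ) 1 →
      ∀ (Ω : Type*) [MeasurableSpace Ω] (μ : Measure Ω) [IsProbabilityMeasure μ]
        (X : ℕ → S → A → Ω → Option S), M.IsGenerativeModel μ X →
      ENNReal.ofReal (1 - δ) ≤ μ {ω |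
        let r := M.searchHorizon κ T ε δ (fun t s a => X t s a ω)
        (r.output = none ∧ ENNReal.ofReal T < M.diam ∧
          (r.samples : ℝ) ≤
            SSP.polylog C k (Fintype.card S) (Fintype.card A) T ε δ *
              ((Fintype.card S : ℝ) ^ 2 * Fintype.card A * T)) ∨
        (∃ π : ℕ → S → A, r.output = some π ∧ M.IsOptimalT ε T (SSP.ofDet π) ∧
          (r.samples : ℝ≥0∞) ≤
            ENNReal.ofReal (SSP.polylog C k (Fintype.card S) (Fintype.card A) T ε δ) *
              M.policyBound T ε)} := by

  refine ⟨SSP.batchConst, SSP.finalConst, 3, by linarith [SSP.batchConst_spec.1],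
    SSP.finalConst_pos, ?_⟩
  intro S A _ _ _ _ M T ε δ hT hε hδ Ω _ μ _ X hX
  have hbad := M.measure_not_runGood_le hX hT hε.1 hε.2.le hδ.1 hδ.2.le
  have hgood : ENNReal.ofReal (1 - δ) ≤
      μ {ω | M.RunGood T ε δ (fun t s a => X t s a ω)} := by
    rw [ENNReal.ofReal_sub _ hδ.1.le, ENNReal.ofReal_one]
    refine tsub_le_iff_right.2 ?_
    -- Subadditivity of the outer measure suffices, so the measurability of the events plays no
    -- role.
    calc (1 : ℝ≥0∞) = μ Set.univ := measure_univ.symm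
      _ ≤ μ ({ω | M.RunGood T ε δ (fun t s a => X t s a ω)} ∪
          {ω | ¬ M.RunGood T ε δ (fun t s a => X t s a ω)}) :=
        measure_mono fun ω _ => em _
      _ ≤ _ := (measure_union_le _ _).trans (add_le_add le_rfl hbad)
  exact hgood.trans (measure_mono fun ω hω =>
    M.searchHorizon_spec hT hε.1 hε.2.le hδ.1 hδ.2.le hω)
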